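/- Let $Q$ be a smooth manifold of dimension $m$ and let $\tau_{\mathcal A}:\mathcal A\to Q$ be a Lie affgebroid of rank $n$, with bidual Lie algebroid $(\widetilde{\mathcal A},[\![\cdot,\cdot]\!],\rho)$ over $Q$ (a vector bundle of rank $n+1$) and $1$-cocycle $1_{\mathcal A}$, which vanishes on no fibre. Thus $\mathcal A=\{v\in\widetilde{\mathcal A}: 1_{\mathcal A}(v)=1\}$, and the bundle $\mathcal A^+$ of fibrewise affine functions on $\mathcal A$ is $\widetilde{\mathcal A}^*$. Let $\mathcal M\subseteq\mathcal A$ be an embedded submanifold of dimension $m+n-\bar m$ such that $\tau_{\mathcal A|\mathcal M}:\mathcal M\to Q$ is a surjective submersion, let $L:\mathcal A\to\mathbb R$ be smooth and put $\tilde L=L_{|\mathcal M}$. For a smooth map $\nu:P\to Q$ write $\mathcal T^{\widetilde{\mathcal A}}_pP=\{(e,X)\in\widetilde{\mathcal A}_{\nu(p)}\times T_pP:\rho(e)=T_p\nu(X)\}$. When $\nu$ is a submersion this is the prolongation, a Lie algebroid over $P$ with anchor $(e,X)\mapsto X$ and with bracket $([\![\sigma,\tau]\!]\circ\nu,[X,Y])$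 on projectable sections $(\sigma\circ\nu,X)$, $(\tau\circ\nu,Y)$. Write $d$ for its differential. Let $W_0=\mathcal A^+\oplus_Q\mathcal M$, with projections $\nu:W_0\to Q$ and $\pi_1:W_0\to\mathcal A^+$. On $\mathcal T^{\widetilde{\mathcal A}}W_0$ let $\Omega=(\mathcal T\pi_1,\pi_1)^*(-d\lambda)$, where $\lambda_\varphi(e,X)=\varphi(e)$ is the Liouville section over $\mathcal A^+$, and let $\eta(e,X)=1_{\mathcal A}(e)$. Put $H_{W_0}(\varphi,\mathrm a)=\varphi(\mathrm a)-\tilde L(\mathrm a)$ and $\Omega_{W_0}=\Omega+dH_{W_0}\wedge\eta$. Let $$W_1=\{w\in W_0:\exists Z\in\mathcal T^{\widetilde{\mathcal A}}_wW_0,\ i_Z\Omega_{W_0}(w)=0,\ i_Z\eta(w)=1\},\qquad W_1'=\{w\in W_1:H_{W_0}(w)=0\},$$ regard $W_1'$ as an embedded submanifold of $W_0$, and let $\Omega_{W_1'},\eta_{W_1'}$ be the restrictions of $\Omega_{W_0},\eta$ to $\mathcal T^{\widetilde{\mathcal A}}W_1'$. Then $(\Omega_{W_1'},\eta_{W_1'})$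 is a cosymplectic structure on $\mathcal T^{\widetilde{\mathcal A}}W_1'\to W_1'$, that is, $d\Omega_{W_1'}=0$, $d\eta_{W_1'}=0$ and $\eta_{W_1'}\wedge\Omega_{W_1'}^{\,n}$ vanishes nowhere, if and only if for every system of adapted local coordinates $$\det\left(\frac{\partial^2\tilde L}{\partial y^a\partial y^b}-\sum_A y_A\frac{\partial^2\Psi^A}{\partial y^a\partial y^b}\right)_{a,b}\neq0$$ at all points of $W_1'$ in its domain. Here a system of adapted local coordinates consists of a chart $(x^i)$ of $Q$ on an open set $U$, a local frame $\{e_0,e_A,e_a\}$ of $\widetilde{\mathcal A}$ over $U$ (with $1\le A\le\bar m<a\le n$) such that $1_{\mathcal A}(e_0)=1$ and $1_{\mathcal A}(e_A)=1_{\mathcal A}(e_a)=0$, and smooth functions $\Psi^A(x^i,y^a)$ such that, in some open set lying over $U$, a point $e_0+\sum_Ay^Ae_A+\sum_ay^ae_a$ of $\mathcal A$ belongs to $\mathcal M$ exactly when $y^A=\Psi^A(x^i,y^a)$ for all $A$. At $(\varphi,\mathrm a)\in W_0$ one has $y_A=\varphi(e_A)$, and $\tilde L$ is expressed in the coordinates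 $(x^i,y^a)$ of $\mathcal M$. (When there are no indices $a$, the determinant is $1$.) -/

import Mathlib

open Bundle Manifold Module
open scoped ContDiff Topology

noncomputable section

namespace Vakonomic

section LieAlgebroids

variable {m : ℕ}
  {Q : Type*} [TopologicalSpace Q] [ChartedSpace (EuclideanSpace ℝ (Fin m)) Q]
  [IsManifold (𝓡 m) ∞ Q]
  {F : Type*} [NormedAddCommGroup F] [NormedSpace ℝ F]
  {E : Q → Type*} [TopologicalSpace (TotalSpace F E)]
  [∀ x, AddCommGroup (E x)] [∀ x, Module ℝ (E x)] [∀ x, TopologicalSpace (E x)]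
  [FiberBundle F E] [VectorBundle ℝ F E]

/-- The derivative `X(f)` of a real function along a tangent vector `X` at `p`. -/
def derivAlong {EP : Type*} [NormedAddCommGroup EP] [NormedSpace ℝ EP]
    {HP : Type*} [TopologicalSpace HP] (IP : ModelWithCorners ℝ EP HP)
    {P : Type*} [TopologicalSpace P] [ChartedSpace HP P]
    (p : P) (X : TangentSpace IP p) (f : P → ℝ) : ℝ :=
  mfderiv IP 𝓘(ℝ, ℝ) f p X

/-- The product of a smooth function and a smooth section. -/
def smulSection (f : C^∞⟮𝓡 m, Q; 𝓘(ℝ, ℝ), ℝ⟯) (σ : Cₛ^∞⟮𝓡 m; F, E⟯) : Cₛ^∞⟮𝓡 m; F, E⟯ :=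
  ⟨fun x => f x • σ x, f.contMDiff.smul_section σ.contMDiff⟩

variable (m F E) in
/-- A Lie algebroid structure on the smooth vector bundle `E → Q`: a real Lie bracket on the
smooth sections and a smooth vector bundle map `anchor : E → TQ` which is a Lie algebra
homomorphism on sections and for which the Leibniz rule holds. -/
structure LieAlgebroid where
  bracket : Cₛ^∞⟮𝓡 m; F, E⟯ → Cₛ^∞⟮𝓡 m; F, E⟯ → Cₛ^∞⟮𝓡 m; F, E⟯
  anchor : ∀ x : Q, E x →L[ℝ] TangentSpace (𝓡 m) x
  anchor_smooth : ContMDiff ((𝓡 m).prod 𝓘(ℝ, F)) (𝓡 m).tangent ∞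
    (fun v : TotalSpace F E => (⟨v.1, anchor v.1 v.2⟩ : TangentBundle (𝓡 m) Q))
  bracket_add : ∀ σ τ τ', bracket σ (τ + τ') = bracket σ τ + bracket σ τ'
  bracket_smul : ∀ (c : ℝ) (σ τ), bracket σ (c • τ) = c • bracket σ τ
  bracket_skew : ∀ σ τ, bracket σ τ = - bracket τ σ
  jacobi : ∀ σ τ υ,
    bracket σ (bracket τ υ) = bracket (bracket σ τ) υ + bracket τ (bracket σ υ)
  leibniz : ∀ (f : C^∞⟮𝓡 m, Q; 𝓘(ℝ, ℝ), ℝ⟯) (σ τ) (x : Q),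
    bracket σ (smulSection f τ) x =
      f x • bracket σ τ x + derivAlong (𝓡 m) x (anchor x (σ x)) f • τ x
  anchor_bracket : ∀ (σ τ) (x : Q),
    anchor x (bracket σ τ x) =
      VectorField.mlieBracket (𝓡 m) (fun y => anchor y (σ y)) (fun y => anchor y (τ y)) x

variable (m F E) in
/-- A Lie affgebroid, presented by its bidual Lie algebroid `E` together with the
`1`-cocycle `one` (the function `1_𝒜`), which does not vanish on any fibre.  The affine bundle is
`𝒜 = {v | one v = 1}`, it is modelled on the vector bundle `{v | one v = 0}`, and the dual bundle
`𝒜⁺` of fibrewise affine functions on `𝒜` is the dual vector bundle of `E`. -/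
structure LieAffgebroid extends LieAlgebroid m F E where
  one : ∀ x : Q, E x →L[ℝ] ℝ
  one_smooth : ContMDiff ((𝓡 m).prod 𝓘(ℝ, F)) 𝓘(ℝ, ℝ) ∞
    (fun v : TotalSpace F E => one v.1 v.2)
  one_ne_zero : ∀ x, one x ≠ 0
  one_cocycle : ∀ (σ τ : Cₛ^∞⟮𝓡 m; F, E⟯) (x : Q),
    derivAlong (𝓡 m) x (anchor x (σ x)) (fun y => one y (τ y))
      - derivAlong (𝓡 m) x (anchor x (τ x)) (fun y => one y (σ y))
      - one x (bracket σ τ x) = 0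

/-- The affine bundle `𝒜`, as a subset of the total space of its bidual `E`. -/
def LieAffgebroid.affineBundle (A : LieAffgebroid m F E) : Set (TotalSpace F E) :=
  {v | A.one v.1 v.2 = 1}

section Prolongation

variable {EP : Type*} [NormedAddCommGroup EP] [NormedSpace ℝ EP]
  {HP : Type*} [TopologicalSpace HP] (IP : ModelWithCorners ℝ EP HP)
  {P : Type*} [TopologicalSpace P] [ChartedSpace HP P] [IsManifold IP ∞ P]

/-- The fibre at `p` of the prolongation of the Lie algebroid `E` over `ν : P → Q`:
the pairs `(e, X)` in `E (ν p) × T_p P` with `anchor e = Tν X`. -/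
def prolongFiber (A : LieAlgebroid m F E) (ν : P → Q) (p : P) :
    Submodule ℝ (E (ν p) × TangentSpace IP p) where
  carrier := {z | A.anchor (ν p) z.1 = mfderiv IP (𝓡 m) ν p z.2}
  zero_mem' := by simp
  add_mem' := by
    intro a b ha hb
    change A.anchor (ν p) (a.1 + b.1) = mfderiv IP (𝓡 m) ν p (a.2 + b.2)
    rw [map_add, map_add, ha, hb]
  smul_mem' := by
    intro c a ha
    change A.anchor (ν p) (c • a.1) = mfderiv IP (𝓡 m) ν p (c • a.2)
    rw [map_smul, map_smul, ha]

/-- A projectable section of the prolongation: a pair of a smooth section `sec` of `E` and a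
smooth vector field `vf` on `P` which is `ν`-related to `anchor sec`. These sections generate all
sections of the prolongation locally when `ν` is a submersion. -/
structure ProjSection (A : LieAlgebroid m F E) (ν : P → Q) where
  sec : Cₛ^∞⟮𝓡 m; F, E⟯
  vf : Cₛ^∞⟮IP; EP, (TangentSpace IP : P → Type _)⟯
  related : ∀ p, A.anchor (ν p) (sec (ν p)) = mfderiv IP (𝓡 m) ν p (vf p)

variable {IP} {A : LieAlgebroid m F E} {ν : P → Q}

/-- The value at `p` of a projectable section. -/
def ProjSection.val (s : ProjSection IP A ν) (p : P) : E (ν p) × TangentSpace IP p :=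
  (s.sec (ν p), s.vf p)

/-- The value at `p` of the prolongation bracket `([σ, τ] ∘ ν, [X, Y])` of the projectable
sections `(σ ∘ ν, X)` and `(τ ∘ ν, Y)`. -/
def ProjSection.bracketVal (s t : ProjSection IP A ν) (p : P) : E (ν p) × TangentSpace IP p :=
  (A.bracket s.sec t.sec (ν p), VectorField.mlieBracket IP (s.vf) (t.vf) p)

/-- The action of a section of the prolongation on functions, through the anchor
`(e, X) ↦ X` of the prolongation. -/
def ProjSection.act (s : ProjSection IP A ν) (f : P → ℝ) (p : P) : ℝ :=
  derivAlong IP p (s.vf p) f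

variable (IP A ν)

/-- `1`-sections of the prolongation. Only the values on `prolongFiber` matter. -/
abbrev OneSection := ∀ p : P, E (ν p) × TangentSpace IP p → ℝ

/-- `2`-sections of the prolongation. Only the values on `prolongFiber` matter. -/
abbrev TwoSection :=
  ∀ p : P, E (ν p) × TangentSpace IP p → E (ν p) × TangentSpace IP p → ℝ

/-- `dθ = 0` for the Lie algebroid differential of the prolongation: the (tensorial) expression
`dθ(s,t) = s(θ(t)) - t(θ(s)) - θ([s,t])` vanishes on the generating sections. -/
def IsClosedOne (θ : OneSection (E := E) IP ν) : Prop :=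
  ∀ (s t : ProjSection IP A ν) (p : P),
    s.act (fun q => θ q (t.val q)) p - t.act (fun q => θ q (s.val q)) p
      - θ p (s.bracketVal t p) = 0

/-- `dΘ = 0` for the Lie algebroid differential of the prolongation: the (tensorial) expression
`dΘ(r,s,t) = r(Θ(s,t)) - s(Θ(r,t)) + t(Θ(r,s)) - Θ([r,s],t) + Θ([r,t],s) - Θ([s,t],r)`
vanishes on the generating sections. -/
def IsClosedTwo (Θ : TwoSection (E := E) IP ν) : Prop :=
  ∀ (r s t : ProjSection IP A ν) (p : P),
    r.act (fun q => Θ q (s.val q) (t.val q)) p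
      - s.act (fun q => Θ q (r.val q) (t.val q)) p
      + t.act (fun q => Θ q (r.val q) (s.val q)) p
      - Θ p (r.bracketVal s p) (t.val p)
      + Θ p (r.bracketVal t p) (s.val p)
      - Θ p (s.bracketVal t p) (r.val p) = 0

/-- Up to a positive factor depending only on `n`, the value of `η ∧ Θ ∧ ⋯ ∧ Θ` (`n` factors `Θ`)
on `2 n + 1` vectors. -/
def wedgePow {V : Type*} (n : ℕ) (η : V → ℝ) (Θ : V → V → ℝ) (v : Fin (2 * n + 1) → V) : ℝ :=
  ∑ σ : Equiv.Perm (Fin (2 * n + 1)), ((Equiv.Perm.sign σ : ℤ) : ℝ) *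
    (η (v (σ 0)) * ∏ i : Fin n,
      Θ (v (σ ⟨2 * i.1 + 1, by omega⟩)) (v (σ ⟨2 * i.1 + 2, by omega⟩)))

/-- `(Θ, η)` is a cosymplectic structure on the prolongation of `A` over `ν`:
`dΘ = 0`, `dη = 0` and `η ∧ Θⁿ` vanishes nowhere. -/
def IsCosymplectic (n : ℕ) (Θ : TwoSection (E := E) IP ν) (η : OneSection (E := E) IP ν) :
    Prop :=
  IsClosedTwo IP A ν Θ ∧ IsClosedOne IP A ν η ∧
    ∀ p : P, ∃ v : Fin (2 * n + 1) → E (ν p) × TangentSpace IP p,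
      (∀ i, v i ∈ prolongFiber IP A ν p) ∧ wedgePow n (η p) (Θ p) v ≠ 0

variable {IP ν}

/-- The pullback `(Tg, g)^* Θ` under the prolongation `Tg = (Id, Tg)` of a map `g : P' → P`. -/
def TwoSection.pullback {EP' : Type*} [NormedAddCommGroup EP'] [NormedSpace ℝ EP']
    {HP' : Type*} [TopologicalSpace HP'] (IP' : ModelWithCorners ℝ EP' HP')
    {P' : Type*} [TopologicalSpace P'] [ChartedSpace HP' P']
    (g : P' → P) (Θ : TwoSection (E := E) IP ν) : TwoSection (E := E) IP' (ν ∘ g) :=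
  fun p z z' => Θ (g p) (z.1, mfderiv IP' IP g p z.2) (z'.1, mfderiv IP' IP g p z'.2)

/-- The pullback `(Tg, g)^* θ` under the prolongation `Tg = (Id, Tg)` of a map `g : P' → P`. -/
def OneSection.pullback {EP' : Type*} [NormedAddCommGroup EP'] [NormedSpace ℝ EP']
    {HP' : Type*} [TopologicalSpace HP'] (IP' : ModelWithCorners ℝ EP' HP')
    {P' : Type*} [TopologicalSpace P'] [ChartedSpace HP' P']
    (g : P' → P) (θ : OneSection (E := E) IP ν) : OneSection (E := E) IP' (ν ∘ g) :=
  fun p z => θ (g p) (z.1, mfderiv IP' IP g p z.2)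

end Prolongation

end LieAlgebroids

section Extension

variable {m : ℕ}
  {Q : Type*} [TopologicalSpace Q] [T2Space Q]
  [ChartedSpace (EuclideanSpace ℝ (Fin m)) Q] [IsManifold (𝓡 m) ∞ Q]
  {F : Type*} [NormedAddCommGroup F] [NormedSpace ℝ F]
  {E : Q → Type*} [TopologicalSpace (TotalSpace F E)]
  [∀ x, AddCommGroup (E x)] [∀ x, Module ℝ (E x)] [∀ x, TopologicalSpace (E x)]
  [FiberBundle F E] [VectorBundle ℝ F E] [ContMDiffVectorBundle ∞ F E (𝓡 m)]

variable (m F) in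
/-- Through each vector of a smooth vector bundle passes a smooth global section. -/
theorem exists_section_through {x : Q} (v : E x) : ∃ σ : Cₛ^∞⟮𝓡 m; F, E⟯, σ x = v := by
  obtain ⟨s, hs, hsσ⟩ := FiberBundle.exists_contMDiffOn_extend (k := ∞) (𝓡 m) F v
  obtain ⟨u, hus, hu, hxu⟩ := mem_nhds_iff.1 hs
  obtain ⟨b, -, hb⟩ := (SmoothBumpFunction.nhds_basis_tsupport (I := 𝓡 m) x).mem_iff.1
    (hu.mem_nhds hxu)
  refine ⟨⟨fun y => b y • FiberBundle.extend F v y, ?_⟩, ?_⟩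
  · exact ContMDiffOn.smul_section_of_tsupport (b.contMDiff.contMDiffOn) hu hb (hsσ.mono hus)
  · change b x • FiberBundle.extend F v x = v
    rw [b.eq_one, one_smul, FiberBundle.extend_apply_self]

variable (m F) in
/-- A smooth global section through a given vector. -/
def sectionThrough {x : Q} (v : E x) : Cₛ^∞⟮𝓡 m; F, E⟯ :=
  (exists_section_through m F v).choose

end Extension

section Vakonomic

variable {m n k d : ℕ}
  {Q : Type*} [TopologicalSpace Q] [T2Space Q]
  [ChartedSpace (EuclideanSpace ℝ (Fin m)) Q] [IsManifold (𝓡 m) ∞ Q]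
  {F : Type*} [NormedAddCommGroup F] [NormedSpace ℝ F]
  {E : Q → Type*} [TopologicalSpace (TotalSpace F E)]
  [∀ x, AddCommGroup (E x)] [∀ x, Module ℝ (E x)] [∀ x, TopologicalSpace (E x)]
  [∀ x, IsTopologicalAddGroup (E x)] [∀ x, ContinuousSMul ℝ (E x)]
  [FiberBundle F E] [VectorBundle ℝ F E] [ContMDiffVectorBundle ∞ F E (𝓡 m)]

variable (F E) in
/-- The total space of the dual bundle `𝒜⁺ = E^*`. -/
abbrev DualTotal := TotalSpace (F →L[ℝ] ℝ) (fun x : Q => E x →L[ℝ] ℝ)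

variable (m F) in
/-- The model with corners of total spaces of bundles with fibre `F^*`. -/
abbrev dualModel := (𝓡 m).prod 𝓘(ℝ, F →L[ℝ] ℝ)

variable (m F E) in
/-- The Liouville section `λ(φ)(e, X) = φ(e)` of the prolongation of `E` over `E^*`. -/
def liouville : OneSection (E := E) (dualModel m F) (TotalSpace.proj : DualTotal F E → Q) :=
  fun φ z => φ.2 z.1

/-- The canonical symplectic section `Ω = -dλ` of the prolongation of `E` over `E^*`. Through
`zᵢ = (eᵢ, Xᵢ)` choose projectable sections `(σᵢ ∘ proj, X̂ᵢ)`; then `λ(σᵢ ∘ proj, X̂ᵢ)` is the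
function `ψ ↦ ψ(σᵢ)`, and so `dλ(z₁, z₂) = X₁(ψ ↦ ψ(σ₂)) - X₂(ψ ↦ ψ(σ₁)) - φ([σ₁, σ₂])`, which
does not involve the extensions `X̂ᵢ` and, on the prolongation, does not depend on the choice
of the `σᵢ`. -/
def canonicalTwo (A : LieAlgebroid m F E) :
    TwoSection (E := E) (dualModel m F) (TotalSpace.proj : DualTotal F E → Q) :=
  fun φ z₁ z₂ =>
    let σ₁ : Cₛ^∞⟮𝓡 m; F, E⟯ := sectionThrough m F z₁.1
    let σ₂ : Cₛ^∞⟮𝓡 m; F, E⟯ := sectionThrough m F z₂.1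
    derivAlong (dualModel m F) φ z₂.2 (fun ψ => liouville m F E ψ (σ₁ ψ.1, 0))
      - derivAlong (dualModel m F) φ z₁.2 (fun ψ => liouville m F E ψ (σ₂ ψ.1, 0))
      + liouville m F E φ (A.bracket σ₁ σ₂ φ.1, 0)

/-- A constraint submanifold `ℳ` of dimension `m + k`: an embedded submanifold of the affine
bundle `𝒜` (given by a manifold `M` and the inclusion `incl`) on which the bundle projection is a
surjective submersion onto `Q`. -/
structure ConstraintSubmanifold (A : LieAffgebroid m F E) (k : ℕ) (M : Type*) [TopologicalSpace M]
    [ChartedSpace (EuclideanSpace ℝ (Fin (m + k))) M] where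
  incl : C^∞⟮𝓡 (m + k), M; (𝓡 m).prod 𝓘(ℝ, F), TotalSpace F E⟯
  isEmbedding : IsSmoothEmbedding (𝓡 (m + k)) ((𝓡 m).prod 𝓘(ℝ, F)) ∞ incl
  mem_affineBundle : ∀ a, incl a ∈ A.affineBundle
  isSubmersion : IsSubmersion (𝓡 (m + k)) (𝓡 m) ∞ (fun a => (incl a).1)
  surjective : Function.Surjective (fun a => (incl a).1)

namespace ConstraintSubmanifold

variable {A : LieAffgebroid m F E} {M : Type*} [TopologicalSpace M]
  [ChartedSpace (EuclideanSpace ℝ (Fin (m + k))) M] [IsManifold (𝓡 (m + k)) ∞ M]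
  (C : ConstraintSubmanifold A k M)

/-- The projection `τ_ℳ : ℳ → Q`. -/
def proj : C^∞⟮𝓡 (m + k), M; 𝓡 m, Q⟯ :=
  ⟨fun a => (C.incl a).1, (contMDiff_proj E).comp C.incl.contMDiff⟩

/-- `W₀ = 𝒜⁺ ⊕_Q ℳ`, as the total space of the pullback of `𝒜⁺` along `τ_ℳ`. Its points are
`⟨a, φ⟩` with `a ∈ ℳ` and `φ ∈ 𝒜⁺` over the same point of `Q`. -/
abbrev W₀ := TotalSpace (F →L[ℝ] ℝ) (C.proj *ᵖ (fun x : Q => E x →L[ℝ] ℝ))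

variable (m k F) in
/-- The model with corners of `W₀`. -/
abbrev modelW₀ := (𝓡 (m + k)).prod 𝓘(ℝ, F →L[ℝ] ℝ)

/-- The projection `ν : W₀ → Q`. -/
def nu (w : C.W₀) : Q := C.proj w.1

/-- The covector `φ` of a point `(φ, a)` of `W₀`. -/
def covector (w : C.W₀) : E (C.nu w) →L[ℝ] ℝ := w.2

/-- The projection `π₁ : W₀ → 𝒜⁺`. -/
def pr₁ (w : C.W₀) : DualTotal F E := ⟨C.nu w, C.covector w⟩

/-- The presymplectic section `Ω = (𝒯π₁, π₁)^* Ω_E` on the prolongation over `W₀`. -/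
def Omega : TwoSection (E := E) (modelW₀ m k F) C.nu :=
  TwoSection.pullback (modelW₀ m k F) C.pr₁ (canonicalTwo A.toLieAlgebroid)

/-- The `1`-cocycle `η(e, X) = 1_𝒜(e)` on the prolongation over `W₀`. -/
def eta : OneSection (E := E) (modelW₀ m k F) C.nu :=
  fun w z => A.one (C.nu w) z.1

/-- The Pontryagin Hamiltonian `H(φ, a) = φ(a) - L(a)` on `W₀`. -/
def hamiltonian (L : TotalSpace F E → ℝ) (w : C.W₀) : ℝ :=
  C.covector w (C.incl w.1).2 - L (C.incl w.1)

/-- `Ω_{W₀} = Ω + dH ∧ η`, where `dH(e, X) = X(H)`. -/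
def OmegaW₀ (L : TotalSpace F E → ℝ) : TwoSection (E := E) (modelW₀ m k F) C.nu :=
  fun w z z' => C.Omega w z z' +
    (derivAlong (modelW₀ m k F) w z.2 (C.hamiltonian L) * C.eta w z'
      - derivAlong (modelW₀ m k F) w z'.2 (C.hamiltonian L) * C.eta w z)

/-- `W₁`: the points `w` of `W₀` at which there is `Z` in the prolongation with
`i_Z Ω_{W₀} = 0` and `η(Z) = 1`. -/
def W₁ (L : TotalSpace F E → ℝ) : Set C.W₀ :=
  {w | ∃ Z ∈ prolongFiber (modelW₀ m k F) A.toLieAlgebroid C.nu w,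
    (∀ Z' ∈ prolongFiber (modelW₀ m k F) A.toLieAlgebroid C.nu w, C.OmegaW₀ L w Z Z' = 0) ∧
    C.eta w Z = 1}

/-- `W₁'`: the points of `W₁` at which the Pontryagin Hamiltonian vanishes. -/
def W₁' (L : TotalSpace F E → ℝ) : Set C.W₀ :=
  {w | w ∈ C.W₁ L ∧ C.hamiltonian L w = 0}

/-- A system of adapted local coordinates: a chart `(xⁱ)` of `Q` on `U`, a local frame
`{e₀, e_A, e_a}` of `E` on `U` (indexed by `none`, `some (inl A)`, `some (inr a)`) adapted to
`1_𝒜`, and an open set `dom` over `U` in which `ℳ` is the graph `y^A = Ψ^A(xⁱ, y^a)` of smooth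
functions. Then `(xⁱ, y^a)` are coordinates on `ℳ` and `(xⁱ, y₀, y_A, y_a, y^a)` are
coordinates on `W₀`. -/
structure AdaptedCoordinates (mbar : ℕ) where
  chart : OpenPartialHomeomorph Q (EuclideanSpace ℝ (Fin m))
  chart_mem : chart ∈ IsManifold.maximalAtlas (𝓡 m) ∞ Q
  frame : Option (Fin mbar ⊕ Fin k) → (x : Q) → E x
  isLocalFrame : IsLocalFrameOn (𝓡 m) F ∞ frame chart.source
  one_frame_none : ∀ x ∈ chart.source, A.one x (frame none x) = 1
  one_frame_some : ∀ x ∈ chart.source, ∀ i, A.one x (frame (some i) x) = 0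
  dom : Set (TotalSpace F E)
  isOpen_dom : IsOpen dom
  dom_subset : ∀ v ∈ dom, v.1 ∈ chart.source
  psiDom : Set (EuclideanSpace ℝ (Fin m) × (Fin k → ℝ))
  isOpen_psiDom : IsOpen psiDom
  psi : Fin mbar → EuclideanSpace ℝ (Fin m) × (Fin k → ℝ) → ℝ
  psi_smooth : ∀ i, ContDiffOn ℝ ∞ (psi i) psiDom
  mem_psiDom : ∀ v ∈ dom, v ∈ A.affineBundle →
    (chart v.1, fun a => isLocalFrame.coeff (some (.inr a)) v.1 v.2) ∈ psiDom
  mem_iff : ∀ v ∈ dom, v ∈ A.affineBundle →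
    (v ∈ Set.range C.incl ↔ ∀ i, isLocalFrame.coeff (some (.inl i)) v.1 v.2 =
      psi i (chart v.1, fun a => isLocalFrame.coeff (some (.inr a)) v.1 v.2))

namespace AdaptedCoordinates

variable {C} {mbar : ℕ} (c : C.AdaptedCoordinates mbar)

/-- The coordinates `(xⁱ)` of a point of `W₀`. -/
def xCoord (w : C.W₀) : EuclideanSpace ℝ (Fin m) := c.chart (C.nu w)

/-- The coordinates `(y^a)` of a point of `W₀`. -/
def yCoord (w : C.W₀) : Fin k → ℝ :=
  fun a => c.isLocalFrame.coeff (some (.inr a)) (C.incl w.1).1 (C.incl w.1).2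

/-- The coordinates `y_A` of a point `(φ, a)` of `W₀`, that is `φ(e_A)`. -/
def momentum (w : C.W₀) (i : Fin mbar) : ℝ := C.covector w (c.frame (some (.inl i)) (C.nu w))

/-- The point of `ℳ` with coordinates `(xⁱ, y^a)`, that is `e₀ + Ψ^A e_A + y^a e_a`. -/
def point (x : EuclideanSpace ℝ (Fin m)) (y : Fin k → ℝ) : TotalSpace F E :=
  ⟨c.chart.symm x, c.frame none (c.chart.symm x)
    + ∑ i, c.psi i (x, y) • c.frame (some (.inl i)) (c.chart.symm x)
    + ∑ a, y a • c.frame (some (.inr a)) (c.chart.symm x)⟩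

/-- The second partial derivative `∂²f / ∂y^a ∂y^b`. -/
def secondPartial (f : (Fin k → ℝ) → ℝ) (y : Fin k → ℝ) (a b : Fin k) : ℝ :=
  fderiv ℝ (fun y' => fderiv ℝ f y' (Pi.single b 1)) y (Pi.single a 1)

/-- The matrix `R_ab = ∂²L̃/∂y^a∂y^b - y_A ∂²Ψ^A/∂y^a∂y^b` at a point of `W₀`. -/
def matrixR (L : TotalSpace F E → ℝ) (w : C.W₀) : Matrix (Fin k) (Fin k) ℝ :=
  Matrix.of fun a b =>
    secondPartial (fun y => L (c.point (c.xCoord w) y)) (c.yCoord w) a b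
      - ∑ i, c.momentum w i *
          secondPartial (fun y => c.psi i (c.xCoord w, y)) (c.yCoord w) a b

end AdaptedCoordinates

end ConstraintSubmanifold

end Vakonomic

end Vakonomic

end

set_option linter.unusedSectionVars false

noncomputable section

/-! Put n = mbar + k. Closedness turns out to be automatic, so the content is nondegeneracy. The
Hamiltonian H vanishes on W₁', hence dH ∧ η restricts to zero there and the restricted form is just
the pullback of the canonical section −dλ along W₁' → 𝒜⁺ (`isCanonicalPullback_pullback_OmegaW₀`).
On projectable sections its differential vanishes by the commutator formula for vector fields and
the Jacobi identity (`IsCanonicalPullback.isClosedTwo`); closedness of η is the cocycle identity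
(`eta_closed`).

On W₀ the radical of Ω consists of the vectors tangent to the fibres of π₁, because Ω is pulled back
from a nondegenerate section. So i_Z Ω = dH is solvable exactly where dH kills those vectors, and a
solution Z then satisfies Z(H) = 0 and η(Z) = 1 by itself (`mem_W₁_iff`). In adapted coordinates H =
y₀ + Ψ^A y_A + y^a y_a − L. Stationarity in y^a gives y_a = ∂L/∂y^a − y_A ∂Ψ^A/∂y^a, and H = 0 then
determines y₀. Thus W₁' is locally a graph over the coordinates (xⁱ, y^a, y_A) (`mem_W₁'_iff`). It
has dimension m + n, its prolongation has rank 2n + 1, and η ∧ Ωⁿ is a form of top degree.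

Let X be tangent to W₁' and vertical over Q, with components y along y^a and q along y_A. It pairs
with a section σ to σ^α r_α, where r is the variation of the momenta: r_A = q_A and r_b = (yR)_b −
q_A ∂Ψ^A/∂y^b, with R the matrix of the theorem. The remaining r₀ is fixed by r(a) = 0, the
derivative of H = 0 along the graph (`AdaptedCoordinates.exists_vertical`).

If R is singular, q = 0 and y in its left kernel give r = 0: a nonzero vector in the kernels of η
and Ω, so η ∧ Ωⁿ = 0 (`det_matrixR_ne_zero`). If R is invertible, r ranges over all covectors
annihilating a, which are dual to ker 1_𝒜. Vertical vectors are mutually Ω-orthogonal, so together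
with lifts of a and of a basis of ker 1_𝒜 they produce a Darboux basis
(`exists_wedgePow_pullback_ne_zero`). To use the determinant hypothesis everywhere one needs adapted
coordinates around each point of ℳ; the inverse function theorem provides them once the frame is
suitably rotated (`exists_adaptedCoordinates`). -/

namespace Vakonomic

/-! ### Tensorial functionals on smooth sections. -/

section Sections

variable {m : ℕ}
  {Q : Type*} [TopologicalSpace Q] [T2Space Q]
  [ChartedSpace (EuclideanSpace ℝ (Fin m)) Q] [IsManifold (𝓡 m) ∞ Q]
  {F : Type*} [NormedAddCommGroup F] [NormedSpace ℝ F] [FiniteDimensional ℝ F]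
  {E : Q → Type*} [TopologicalSpace (TotalSpace F E)]
  [∀ x, AddCommGroup (E x)] [∀ x, Module ℝ (E x)] [∀ x, TopologicalSpace (E x)]
  [FiberBundle F E] [VectorBundle ℝ F E] [ContMDiffVectorBundle ∞ F E (𝓡 m)]

/-- A `C^∞`-linear functional on smooth sections, at a point `x`, depends only on the value of
the section at `x`. -/
theorem eq_zero_of_tensorial {x : Q} (D : Cₛ^∞⟮𝓡 m; F, E⟯ →+ ℝ)
    (hD : ∀ (f : C^∞⟮𝓡 m, Q; 𝓘(ℝ, ℝ), ℝ⟯) σ, D (smulSection f σ) = f x * D σ)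
    {σ : Cₛ^∞⟮𝓡 m; F, E⟯} (hσ : σ x = 0) : D σ = 0 := by
  have : ContMDiffVectorBundle 1 F E (𝓡 m) := ContMDiffVectorBundle.of_le (n := ∞) (by simp)
  set t := trivializationAt F E x
  have hxt : x ∈ t.baseSet := FiberBundle.mem_baseSet_trivializationAt F E x
  let B := Module.finBasis ℝ F
  obtain ⟨b, -, hb⟩ := (SmoothBumpFunction.nhds_basis_tsupport (I := 𝓡 m) x).mem_iff.1
    (t.open_baseSet.mem_nhds hxt)
  let τ (i) : Cₛ^∞⟮𝓡 m; F, E⟯ := ⟨fun y => b y • t.localFrame B i y,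
    ContMDiffOn.smul_section_of_tsupport b.contMDiff.contMDiffOn t.open_baseSet hb
      (t.contMDiffOn_localFrame_baseSet ∞ B i)⟩
  have hc (i) : ContMDiffOn (𝓡 m) 𝓘(ℝ, ℝ) ∞
      (fun y => t.localFrameCoeff (𝓡 m) B i y (σ y)) t.baseSet :=
    contMDiffOn_baseSet_localFrameCoeff B σ.contMDiff.contMDiffOn i
  let f (i) : C^∞⟮𝓡 m, Q; 𝓘(ℝ, ℝ), ℝ⟯ :=
    ⟨fun y => b y * t.localFrameCoeff (𝓡 m) B i y (σ y), by
      refine contMDiff_of_tsupport fun y hy => ?_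
      have hy' : y ∈ t.baseSet := hb (tsupport_mul_subset_left hy)
      exact b.contMDiff.contMDiffAt.mul ((hc i).contMDiffAt (t.open_baseSet.mem_nhds hy'))⟩
  -- The cutoff enters squared: one factor `b` globalizes the local frame, the other the
  -- coefficients of `σ`. Then `b²σ` is a finite combination of global sections, and `D` does not
  -- see the cutoff because `b x = 1`.
  let bb : C^∞⟮𝓡 m, Q; 𝓘(ℝ, ℝ), ℝ⟯ := ⟨fun y => b y * b y, b.contMDiff.mul b.contMDiff⟩
  have key : smulSection bb σ = ∑ i, smulSection (f i) (τ i) := by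
    ext y
    rw [show ⇑(∑ i, smulSection (f i) (τ i)) = ∑ i, ⇑(smulSection (f i) (τ i)) from
      map_sum (ContMDiffSection.coeAddHom (𝓡 m) F ∞ E) _ _, Finset.sum_apply]
    change (b y * b y) • σ y =
      ∑ i, (b y * t.localFrameCoeff (𝓡 m) B i y (σ y)) • b y • t.localFrame B i y
    by_cases hy : y ∈ t.baseSet
    · conv_lhs => rw [Bundle.Trivialization.eq_sum_localFrameCoeff_smul (I := 𝓡 m) (b := B) (s := σ) hy]
      rw [Finset.smul_sum]
      refine Finset.sum_congr rfl fun i _ => ?_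
      simp only [smul_smul]
      congr 1
      ring
    · have : b y = 0 := image_eq_zero_of_notMem_tsupport fun h => hy (hb h)
      simp [this]
  have h1 : D (smulSection bb σ) = D σ := by
    rw [hD]; change b x * b x * _ = _; rw [b.eq_one]; simp
  rw [← h1, key, map_sum]
  refine Finset.sum_eq_zero fun i _ => ?_
  rw [hD]
  change b x * t.localFrameCoeff (𝓡 m) B i x (σ x) * _ = 0
  simp [hσ]

end Sections

/-! ### Smoothness of pairings, of frame coefficients and of families of covectors. -/

section Frames

variable {EB : Type*} [NormedAddCommGroup EB] [NormedSpace ℝ EB]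
  {HB : Type*} [TopologicalSpace HB] {IB : ModelWithCorners ℝ EB HB}
  {Q : Type*} [TopologicalSpace Q] [ChartedSpace HB Q]
  {F : Type*} [NormedAddCommGroup F] [NormedSpace ℝ F]
  {E : Q → Type*} [TopologicalSpace (TotalSpace F E)]
  [∀ x, AddCommGroup (E x)] [∀ x, Module ℝ (E x)] [∀ x, TopologicalSpace (E x)]
  [FiberBundle F E] [VectorBundle ℝ F E]
  {EX : Type*} [NormedAddCommGroup EX] [NormedSpace ℝ EX]
  {HX : Type*} [TopologicalSpace HX] {IX : ModelWithCorners ℝ EX HX}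
  {X : Type*} [TopologicalSpace X] [ChartedSpace HX X]
  {n : WithTop ℕ∞}

/-- Pairing of a smooth family of covectors with a smooth family of vectors. -/
theorem contMDiffAt_pairing [ContMDiffVectorBundle n F E IB] {b : X → Q}
    {φ : ∀ t, E (b t) →L[ℝ] ℝ} {v : ∀ t, E (b t)} {t₀ : X}
    (hφ : ContMDiffAt IX (IB.prod 𝓘(ℝ, F →L[ℝ] ℝ)) n
      (fun t => (⟨b t, φ t⟩ : TotalSpace (F →L[ℝ] ℝ) fun x : Q => E x →L[ℝ] ℝ)) t₀)
    (hv : ContMDiffAt IX (IB.prod 𝓘(ℝ, F)) n (fun t => (⟨b t, v t⟩ : TotalSpace F E)) t₀) :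
    ContMDiffAt IX 𝓘(ℝ, ℝ) n (fun t => φ t (v t)) t₀ := by
  have := ContMDiffAt.clm_bundle_apply (E₁ := E) (E₂ := Bundle.Trivial Q ℝ) (F₂ := ℝ)
    (b := b) (ϕ := φ) hφ hv
  exact (contMDiffAt_totalSpace.1 this).2

/-- The coefficients of vectors in a local frame depend smoothly on the vectors. -/
theorem _root_.IsLocalFrameOn.contMDiffAt_coeff [FiniteDimensional ℝ F]
    [ContMDiffVectorBundle n F E IB] {ι : Type*} [Fintype ι]
    {s : ι → (x : Q) → E x} {u : Set Q} (hs : IsLocalFrameOn IB F n s u) (hu : IsOpen u)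
    {v₀ : TotalSpace F E} (hv₀ : v₀.1 ∈ u) (i : ι) :
    ContMDiffAt (IB.prod 𝓘(ℝ, F)) 𝓘(ℝ, ℝ) n (fun v : TotalSpace F E => hs.coeff i v.1 v.2) v₀ := by
  classical
  set t := trivializationAt F E v₀.1
  have hxt : v₀.1 ∈ t.baseSet := FiberBundle.mem_baseSet_trivializationAt F E v₀.1
  -- the components of the frame in the trivialization
  let c (α : ι) (x : Q) : F := t.continuousLinearMapAt ℝ x (s α x)
  let S (x : Q) : (ι → ℝ) →L[ℝ] F :=
    ∑ α, (ContinuousLinearMap.proj (R := ℝ) (φ := fun _ : ι => ℝ) α).smulRight (c α x)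
  have hSapp (x : Q) (y : ι → ℝ) : S x y = ∑ α, y α • c α x := by
    simp [S]
  have hc (α) : ContMDiffAt IB 𝓘(ℝ, F) n (c α) v₀.1 := by
    have h := (contMDiffAt_totalSpace.1 (hs.contMDiffAt hu hv₀ α)).2
    refine h.congr_of_eventuallyEq ?_
    filter_upwards [t.open_baseSet.mem_nhds hxt] with x hx
    simp only [c]
    rw [Trivialization.continuousLinearMapAt_apply, Trivialization.linearMapAt_apply, if_pos hx]
  have hS : ContMDiffAt IB 𝓘(ℝ, (ι → ℝ) →L[ℝ] F) n S v₀.1 := by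
    have : ContMDiffAt IB 𝓘(ℝ, (ι → ℝ) →L[ℝ] F) n (fun x => ∑ α,
      ContinuousLinearMap.smulRightL ℝ (ι → ℝ) F
        (ContinuousLinearMap.proj (R := ℝ) (φ := fun _ : ι => ℝ) α) (c α x)) v₀.1 := by
      refine ContMDiffAt.sum fun α _ => ?_
      exact (ContinuousLinearMap.contMDiff
        (ContinuousLinearMap.smulRightL ℝ (ι → ℝ) F _)).contMDiffAt.comp _ (hc α)
    exact this
  have hrepr (x : Q) (hx : x ∈ u) (v : E x) :
      S x (fun α => hs.coeff α x v) = t.continuousLinearMapAt ℝ x v := by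
    have h := (hs.toBasisAt hx).sum_repr v
    rw [hSapp]
    conv_rhs => rw [← h]
    rw [map_sum]
    refine Finset.sum_congr rfl fun α _ => ?_
    rw [map_smul, IsLocalFrameOn.toBasisAt_coe]
    simp [c, IsLocalFrameOn.coeff, hx]
  have hbij (x : Q) (hx : x ∈ u) (hx' : x ∈ t.baseSet) : (S x).IsInvertible := by
    let e₁ : (ι → ℝ) ≃ₗ[ℝ] F := (hs.toBasisAt hx).equivFun.symm.trans (t.linearEquivAt ℝ x hx')
    refine ⟨e₁.toContinuousLinearEquiv, ?_⟩
    ext y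
    rw [hSapp]
    change e₁ y = _
    simp only [e₁, LinearEquiv.trans_apply, Basis.equivFun_symm_apply, map_sum, map_smul,
      IsLocalFrameOn.toBasisAt_coe]
    refine Finset.sum_congr rfl fun α _ => ?_
    congr 1
    simp only [c]
    rw [Trivialization.continuousLinearMapAt_apply, Trivialization.linearMapAt_apply, if_pos hx']
    rfl
  -- The coefficients of a vector are the inverse of `S` applied to its trivialized value, and
  -- inversion of continuous linear maps is smooth at the invertible ones.
  have hinv : ContMDiffAt (IB.prod 𝓘(ℝ, F)) 𝓘(ℝ, F →L[ℝ] (ι → ℝ)) n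
      (fun v : TotalSpace F E => ContinuousLinearMap.inverse (S v.1)) v₀ := by
    obtain ⟨e, he⟩ := hbij _ hv₀ hxt
    have h1 := contDiffAt_map_inverse (𝕜 := ℝ) (n := n) e
    rw [he] at h1
    have h2 : ContMDiffAt (IB.prod 𝓘(ℝ, F)) IB n (fun v : TotalSpace F E => v.1) v₀ :=
      contMDiffAt_proj E
    exact ContMDiffAt.comp v₀ (g := ContinuousLinearMap.inverse) h1.contMDiffAt (hS.comp v₀ h2)
  have htriv : ContMDiffAt (IB.prod 𝓘(ℝ, F)) 𝓘(ℝ, F) n (fun v : TotalSpace F E => (t v).2) v₀ :=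
    (contMDiffAt_totalSpace.1 (contMDiffAt_id (x := v₀))).2
  have hfin := hinv.clm_apply htriv
  have hproj : ContMDiffAt 𝓘(ℝ, ι → ℝ) 𝓘(ℝ, ℝ) n (fun y : ι → ℝ => y i)
      (ContinuousLinearMap.inverse (S v₀.1) (t v₀).2) :=
    (ContinuousLinearMap.contMDiff (ContinuousLinearMap.proj (R := ℝ) (φ := fun _ : ι => ℝ) i))
      |>.contMDiffAt
  refine (hproj.comp v₀ hfin).congr_of_eventuallyEq ?_
  have hcont := (FiberBundle.continuous_proj F E).continuousAt (x := v₀)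
  filter_upwards [hcont.preimage_mem_nhds (hu.mem_nhds hv₀),
    hcont.preimage_mem_nhds (t.open_baseSet.mem_nhds hxt)] with v hv hv'
  have h := hrepr v.1 hv v.2
  rw [Trivialization.continuousLinearMapAt_apply, Trivialization.linearMapAt_apply,
    if_pos (show v.1 ∈ t.baseSet from hv')] at h
  obtain ⟨e, he⟩ := hbij _ hv hv'
  simp only [Function.comp]
  rw [show (t v).2 = S v.1 (fun α => hs.coeff α v.1 v.2) from h.symm, ← he,
    ContinuousLinearMap.inverse_equiv]
  simp

/-- A family of covectors is smooth when the base points are and the values on a local frame are. -/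
theorem _root_.IsLocalFrameOn.contMDiffAt_covector [FiniteDimensional ℝ F]
    [ContMDiffVectorBundle n F E IB] {ι : Type*} [Fintype ι]
    {s : ι → (x : Q) → E x} {u : Set Q} (hs : IsLocalFrameOn IB F n s u) (hu : IsOpen u)
    {b : X → Q} {φ : ∀ t, E (b t) →L[ℝ] ℝ} {t₀ : X} (ht₀ : b t₀ ∈ u)
    (hb : ContMDiffAt IX IB n b t₀)
    (hφ : ∀ i, ContMDiffAt IX 𝓘(ℝ, ℝ) n (fun t => φ t (s i (b t))) t₀) :
    ContMDiffAt IX (IB.prod 𝓘(ℝ, F →L[ℝ] ℝ)) n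
      (fun t => (⟨b t, φ t⟩ : TotalSpace (F →L[ℝ] ℝ) fun x : Q => E x →L[ℝ] ℝ)) t₀ := by
  classical
  set T := trivializationAt F E (b t₀)
  have hxt : b t₀ ∈ T.baseSet := FiberBundle.mem_baseSet_trivializationAt F E (b t₀)
  refine (contMDiffAt_hom_bundle (E₁ := E) (E₂ := Bundle.Trivial Q ℝ) _).2 ⟨hb, ?_⟩
  let B := Module.finBasis ℝ F
  -- it suffices to evaluate on a basis of the fibre
  let R : (Fin (finrank ℝ F) → ℝ) →ₗ[ℝ] (F →L[ℝ] ℝ) :=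
    { toFun := fun y => LinearMap.toContinuousLinearMap (B.constr ℝ y)
      map_add' := by intro y z; ext v; simp
      map_smul' := by intro c y; ext v; simp }
  have hR : ContMDiff 𝓘(ℝ, Fin (finrank ℝ F) → ℝ) 𝓘(ℝ, F →L[ℝ] ℝ) n R :=
    (LinearMap.toContinuousLinearMap R).contMDiff
  have heval (j) : ContMDiffAt IX 𝓘(ℝ, ℝ) n (fun t => φ t (T.symm (b t) (B j))) t₀ := by
    have h1 : ContMDiffAt IX (IB.prod 𝓘(ℝ, F)) n
        (fun t => (⟨b t, T.symm (b t) (B j)⟩ : TotalSpace F E)) t₀ := by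
      refine contMDiffAt_totalSpace.2 ⟨hb, ?_⟩
      refine (contMDiffAt_const (c := B j)).congr_of_eventuallyEq ?_
      filter_upwards [hb.continuousAt.preimage_mem_nhds (T.open_baseSet.mem_nhds hxt)] with t ht
      exact congrArg Prod.snd (T.apply_mk_symm ht (B j))
    -- The vector with constant value `B j` in the trivialization is expanded in the frame `s`, on
    -- which `φ` is smooth by assumption.
    have h2 (i) : ContMDiffAt IX 𝓘(ℝ, ℝ) n
        (fun t => hs.coeff i (b t) (T.symm (b t) (B j)) * φ t (s i (b t))) t₀ :=
      (ContMDiffAt.comp (g := fun v : TotalSpace F E => hs.coeff i v.1 v.2)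
        (f := fun t => (⟨b t, T.symm (b t) (B j)⟩ : TotalSpace F E)) t₀
        (hs.contMDiffAt_coeff hu ht₀ i) h1).mul (hφ i)
    refine (ContMDiffAt.sum (t := Finset.univ) fun i _ => h2 i).congr_of_eventuallyEq ?_
    filter_upwards [hb.continuousAt.preimage_mem_nhds (hu.mem_nhds ht₀)] with t ht
    have h3 := (hs.toBasisAt ht).sum_repr (T.symm (b t) (B j))
    conv_lhs => rw [← h3]
    rw [map_sum]
    refine Finset.sum_congr rfl fun α _ => ?_
    rw [map_smul, IsLocalFrameOn.toBasisAt_coe]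
    simp [IsLocalFrameOn.coeff, show b t ∈ u from ht]
  have hall : ContMDiffAt IX 𝓘(ℝ, Fin (finrank ℝ F) → ℝ) n
      (fun t j => φ t (T.symm (b t) (B j))) t₀ := contMDiffAt_pi_space.2 heval
  refine (hR.contMDiffAt.comp t₀ hall).congr_of_eventuallyEq ?_
  filter_upwards [hb.continuousAt.preimage_mem_nhds (T.open_baseSet.mem_nhds hxt)] with t ht
  ext v
  rw [ContinuousLinearMap.inCoordinates_eq ht (by simp)]
  set eT := T.continuousLinearEquivAt ℝ (b t) ht
  have hT (y : F) : T.symm (b t) y = eT.symm y := by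
    rw [T.symm_continuousLinearEquivAt_eq ht, T.symmL_apply ht]
  simp only [Function.comp, R, LinearMap.coe_mk, AddHom.coe_mk,
    LinearMap.coe_toContinuousLinearMap', Basis.constr_apply_fintype, hT]
  change φ t (eT.symm v) = _
  conv_lhs => rw [← B.sum_repr v, map_sum, map_sum]
  simp

end Frames

end Vakonomic

namespace Vakonomic

/-! ### Differentials of immersions and submersions; lifting through embeddings. -/

section Immersions

variable {E₁ E₂ E₃ : Type*} [NormedAddCommGroup E₁] [NormedSpace ℝ E₁]
  [NormedAddCommGroup E₂] [NormedSpace ℝ E₂] [NormedAddCommGroup E₃] [NormedSpace ℝ E₃]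
  {H₁ H₂ H₃ : Type*} [TopologicalSpace H₁] [TopologicalSpace H₂] [TopologicalSpace H₃]
  {I : ModelWithCorners ℝ E₁ H₁} {J : ModelWithCorners ℝ E₂ H₂} {K : ModelWithCorners ℝ E₃ H₃}
  {X : Type*} [TopologicalSpace X] [ChartedSpace H₁ X]
  {Y : Type*} [TopologicalSpace Y] [ChartedSpace H₂ Y]
  {Z : Type*} [TopologicalSpace Z] [ChartedSpace H₃ Z]

/-- An immersion has injective differential. -/
theorem _root_.Manifold.IsImmersionAt.mfderiv_injective [I.Boundaryless] [IsManifold I ∞ X]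
    [IsManifold J ∞ Y] {f : X → Y}
    {x : X} (h : IsImmersionAt I J ∞ f x) : Function.Injective (mfderiv I J f x) := by
  obtain ⟨φ, ψ, G, _, _, e, hx, hfx, hφm, hψm, hw⟩ : ∃ (φ : OpenPartialHomeomorph X H₁)
      (ψ : OpenPartialHomeomorph Y H₂) (G : Type _) (_ : NormedAddCommGroup G)
      (_ : NormedSpace ℝ G) (e : (E₁ × G) ≃L[ℝ] E₂), x ∈ φ.source ∧ f x ∈ ψ.source ∧
      φ ∈ IsManifold.maximalAtlas I ∞ X ∧ ψ ∈ IsManifold.maximalAtlas J ∞ Y ∧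
      ∀ u ∈ (φ.extend I).target, ψ.extend J (f ((φ.extend I).symm u)) = e (u, 0) :=
    ⟨h.domChart, h.codChart, h.complement, inferInstance, inferInstance, h.equiv,
      h.mem_domChart_source, h.mem_codChart_source, h.domChart_mem_maximalAtlas,
      h.codChart_mem_maximalAtlas, fun u hu => h.writtenInCharts hu⟩
  -- In the charts `f` reads `u ↦ e (u, 0)`, so the first component of `e.symm` provides a
  -- differentiable local left inverse.
  let r : Y → X := fun y => (φ.extend I).symm (e.symm (ψ.extend J y)).1
  have hw' (x') (hx' : x' ∈ φ.source) : (e.symm (ψ.extend J (f x'))).1 = φ.extend I x' := by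
    have h1 := hw (φ.extend I x') ((φ.extend I).map_source (by rwa [φ.extend_source]))
    rw [φ.extend_left_inv hx'] at h1
    rw [h1, e.symm_apply_apply]
  have hr0 (x' : X) (hx' : x' ∈ φ.source) : r (f x') = x' := by
    simp only [r]
    rw [hw' _ hx', φ.extend_left_inv hx']
  have hpt := hw' x hx
  have hψ : MDifferentiableAt J 𝓘(ℝ, E₂) (ψ.extend J) (f x) :=
    (OpenPartialHomeomorph.contMDiffAt_extend hψm hfx).mdifferentiableAt (by simp)
  have hmid : MDifferentiableAt 𝓘(ℝ, E₂) 𝓘(ℝ, E₁) (fun u => (e.symm u).1)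
      (ψ.extend J (f x)) := by
    refine DifferentiableAt.mdifferentiableAt ?_
    fun_prop
  have hφ : MDifferentiableAt 𝓘(ℝ, E₁) I (φ.extend I).symm
      ((e.symm (ψ.extend J (f x))).1) := by
    have h1 := contMDiffOn_extend_symm hφm
    have h2 : (φ.extend I) x ∈ I '' φ.target :=
      ⟨φ x, φ.map_source hx, by simp [OpenPartialHomeomorph.extend]⟩
    rw [hpt]
    refine (h1.contMDiffAt (IsOpen.mem_nhds ?_ h2)).mdifferentiableAt (by simp)
    exact I.toHomeomorph.isOpenMap _ φ.open_target
  have hmid' : MDifferentiableAt J 𝓘(ℝ, E₁) (fun y => (e.symm (ψ.extend J y)).1) (f x) :=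
    MDifferentiableAt.comp (g := fun u => (e.symm u).1) (f x) hmid hψ
  have hr : MDifferentiableAt J I r (f x) :=
    MDifferentiableAt.comp (g := (φ.extend I).symm) (f x) hφ hmid'
  have hf : MDifferentiableAt I J f x := h.contMDiffAt.mdifferentiableAt (by simp)
  have hcomp : mfderiv I I (r ∘ f) x = ContinuousLinearMap.id ℝ (TangentSpace I x) := by
    rw [← mfderiv_id]
    refine Filter.EventuallyEq.mfderiv_eq ?_
    filter_upwards [φ.open_source.mem_nhds hx] with x' hx' using hr0 x' hx'
  rw [mfderiv_comp x hr hf] at hcomp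
  intro v w hvw
  have h3 (v : TangentSpace I x) : mfderiv J I r (f x) (mfderiv I J f x v) = v :=
    DFunLike.congr_fun hcomp v
  have := congrArg (mfderiv J I r (f x)) hvw
  exact (h3 v).symm.trans (this.trans (h3 w))

/-- A submersion has surjective differential. -/
theorem _root_.Manifold.IsSubmersionAt.mfderiv_surjective [I.Boundaryless] [IsManifold I ∞ X]
    [IsManifold J ∞ Y] {f : X → Y}
    {x : X} (h : IsSubmersionAt I J ∞ f x) : Function.Surjective (mfderiv I J f x) := by
  obtain ⟨φ, ψ, G, _, _, e, hx, hfx, hφm, hψm, hw⟩ : ∃ (φ : OpenPartialHomeomorph X H₁)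
      (ψ : OpenPartialHomeomorph Y H₂) (G : Type _) (_ : NormedAddCommGroup G)
      (_ : NormedSpace ℝ G) (e : E₁ ≃L[ℝ] (E₂ × G)), x ∈ φ.source ∧ f x ∈ ψ.source ∧
      φ ∈ IsManifold.maximalAtlas I ∞ X ∧ ψ ∈ IsManifold.maximalAtlas J ∞ Y ∧
      ∀ u ∈ (φ.extend I).target, ψ.extend J (f ((φ.extend I).symm u)) = (e u).1 :=
    ⟨h.domChart, h.codChart, h.complement, inferInstance, inferInstance, h.equiv,
      h.mem_domChart_source, h.mem_codChart_source, h.domChart_mem_maximalAtlas,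
      h.codChart_mem_maximalAtlas, fun u hu => h.writtenInCharts hu⟩
  set c := (e (φ.extend I x)).2
  -- In the charts `f` reads `u ↦ (e u).1`; freezing the second component of `e` at its value at `x`
  -- gives a differentiable local right inverse through `x`.
  let s : Y → X := fun y => (φ.extend I).symm (e.symm (ψ.extend J y, c))
  have hxt : φ.extend I x ∈ (φ.extend I).target :=
    (φ.extend I).map_source (by rwa [φ.extend_source])
  have hpt : e.symm (ψ.extend J (f x), c) = φ.extend I x := by
    have := hw _ hxt
    rw [φ.extend_left_inv hx] at this
    rw [this]
    simp [c]
  have hsx : s (f x) = x := by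
    simp only [s]; rw [hpt, φ.extend_left_inv hx]
  have hψ : MDifferentiableAt J 𝓘(ℝ, E₂) (ψ.extend J) (f x) :=
    (OpenPartialHomeomorph.contMDiffAt_extend hψm hfx).mdifferentiableAt (by simp)
  have hmid : MDifferentiableAt 𝓘(ℝ, E₂) 𝓘(ℝ, E₁) (fun u => e.symm (u, c))
      (ψ.extend J (f x)) := by
    refine DifferentiableAt.mdifferentiableAt ?_
    fun_prop
  have hop : IsOpen (φ.extend I).target := by
    rw [φ.extend_target]
    exact (φ.open_target.preimage I.continuous_symm).inter (by simp [I.range_eq_univ])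
  have hφ : MDifferentiableAt 𝓘(ℝ, E₁) I (φ.extend I).symm
      (e.symm (ψ.extend J (f x), c)) := by
    have h1 := contMDiffOn_extend_symm hφm
    have h2 : (φ.extend I) x ∈ I '' φ.target :=
      ⟨φ x, φ.map_source hx, by simp [OpenPartialHomeomorph.extend]⟩
    rw [hpt]
    refine (h1.contMDiffAt (IsOpen.mem_nhds ?_ h2)).mdifferentiableAt (by simp)
    exact I.toHomeomorph.isOpenMap _ φ.open_target
  have hmid' : MDifferentiableAt J 𝓘(ℝ, E₁) (fun y => e.symm (ψ.extend J y, c)) (f x) :=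
    MDifferentiableAt.comp (g := fun u => e.symm (u, c)) (f x) hmid hψ
  have hs : MDifferentiableAt J I s (f x) :=
    MDifferentiableAt.comp (g := (φ.extend I).symm) (f x) hφ hmid'
  have hf : MDifferentiableAt I J f (s (f x)) := by
    rw [hsx]; exact h.contMDiffAt.mdifferentiableAt (by simp)
  have hcomp : mfderiv J J (f ∘ s) (f x) = ContinuousLinearMap.id ℝ (TangentSpace J (f x)) := by
    rw [← mfderiv_id]
    refine Filter.EventuallyEq.mfderiv_eq ?_
    have h1 : ∀ᶠ y in 𝓝 (f x), e.symm (ψ.extend J y, c) ∈ (φ.extend I).target :=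
      hmid'.continuousAt (hop.mem_nhds (by
        rw [hpt]; exact hxt))
    have h2 : ∀ᶠ y in 𝓝 (f x), f (s y) ∈ ψ.source :=
      (hf.continuousAt.comp hs.continuousAt) (ψ.open_source.mem_nhds (by simpa [hsx] using hfx))
    filter_upwards [h1, h2, ψ.open_source.mem_nhds hfx] with y hy1 hy2 hy3
    have h4 := hw _ hy1
    simp only [ContinuousLinearEquiv.apply_symm_apply] at h4
    have := congrArg (ψ.extend J).symm h4
    change (ψ.extend J).symm (ψ.extend J (f (s y))) = _ at this
    rw [ψ.extend_left_inv hy2, ψ.extend_left_inv hy3] at this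
    exact this
  intro v
  have h5 := mfderiv_comp_apply (f x) hf hs v
  rw [hcomp, hsx] at h5
  exact ⟨_, h5.symm⟩

/-- A smooth map into the range of a smooth embedding factors smoothly through it. -/
theorem _root_.Manifold.IsSmoothEmbedding.exists_lift [IsManifold J ∞ Y] [IsManifold K ∞ Z]
    {j : Y → Z} (hj : IsSmoothEmbedding J K ∞ j)
    {f : X → Z} {x : X} (hf : ContMDiffAt I K ∞ f x) (hfr : ∀ᶠ x' in 𝓝 x, f x' ∈ Set.range j)
    {p : Y} (hp : j p = f x) :
    ∃ g : X → Y, ContMDiffAt I J ∞ g x ∧ g x = p ∧ ∀ᶠ x' in 𝓝 x, j (g x') = f x' := by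
  classical
  -- The value `p` off the preimage of the range is a dummy: near `x` every value of `f` lies in the
  -- range of `j`.
  let g : X → Y := fun x' => if h : ∃ y, j y = f x' then h.choose else p
  have hg (x') (h : f x' ∈ Set.range j) : j (g x') = f x' := by
    have h : ∃ y, j y = f x' := h
    simp only [g, dif_pos h]
    exact h.choose_spec
  have hgx : g x = p := hj.isEmbedding.injective ((hg x ⟨p, hp⟩).trans hp.symm)
  have hev : ∀ᶠ x' in 𝓝 x, j (g x') = f x' := hfr.mono hg
  have hjg : ContMDiffAt I K ∞ (j ∘ g) x := hf.congr_of_eventuallyEq hev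
  refine ⟨g, ?_, hgx, hev⟩
  -- Being a topological embedding makes `g` continuous, and a continuous map whose composite with
  -- an immersion is smooth is itself smooth.
  exact (ContMDiffAt.iff_comp_isImmersionAt (hj.isImmersion.isImmersionAt (g x))).2
    ⟨hj.isEmbedding.isInducing.continuousAt_iff.2 hjg.continuousAt, hjg⟩

end Immersions

end Vakonomic

namespace Vakonomic

/-! ### Vector fields as derivations: commutators and related fields. -/

section VectorFields

variable {EP : Type*} [NormedAddCommGroup EP] [NormedSpace ℝ EP]
  {HP : Type*} [TopologicalSpace HP] {IP : ModelWithCorners ℝ EP HP}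
  {P : Type*} [TopologicalSpace P] [ChartedSpace HP P]
  {EQ : Type*} [NormedAddCommGroup EQ] [NormedSpace ℝ EQ]
  {HQ : Type*} [TopologicalSpace HQ] {IQ : ModelWithCorners ℝ EQ HQ}
  {Q : Type*} [TopologicalSpace Q] [ChartedSpace HQ Q]
  {G : Type*} [NormedAddCommGroup G] [NormedSpace ℝ G]

/-- The derivative of a function with values in a normed space along a tangent vector. -/
def tderiv (IP : ModelWithCorners ℝ EP HP) (f : P → G) (p : P) (X : TangentSpace IP p) : G :=
  mfderiv IP 𝓘(ℝ, G) f p X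

theorem two_le_infty : (2 : WithTop ℕ∞) ≤ ∞ :=
  WithTop.coe_le_coe.2 (le_top : (2 : ℕ∞) ≤ ⊤)

theorem derivAlong_eq_tderiv (f : P → ℝ) (p : P) (X : TangentSpace IP p) :
    derivAlong IP p X f = tderiv IP f p X := rfl

theorem tderiv_congr {f g : P → G} {p : P} (h : f =ᶠ[𝓝 p] g) (X : TangentSpace IP p) :
    tderiv IP f p X = tderiv IP g p X := by
  have := h.mfderiv_eq (I := IP) (I' := 𝓘(ℝ, G))
  exact DFunLike.congr_fun this X

theorem tderiv_comp {f : Q → G} {g : P → Q} {p : P} (hf : MDifferentiableAt IQ 𝓘(ℝ, G) f (g p))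
    (hg : MDifferentiableAt IP IQ g p) (X : TangentSpace IP p) :
    tderiv IP (f ∘ g) p X = tderiv IQ f (g p) (mfderiv IP IQ g p X) :=
  mfderiv_comp_apply p hf hg X

theorem tderiv_eq_fderiv (f : EP → G) (u : EP) (X : EP) :
    tderiv 𝓘(ℝ, EP) f u X = fderiv ℝ f u X := by
  have := mfderiv_eq_fderiv (𝕜 := ℝ) (f := f) (x := u)
  exact DFunLike.congr_fun this X

theorem tderiv_add_right (f : P → G) (p : P) (X Y : TangentSpace IP p) :
    tderiv IP f p (X + Y) = tderiv IP f p X + tderiv IP f p Y :=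
  map_add (mfderiv IP 𝓘(ℝ, G) f p) X Y

theorem tderiv_smul_right (f : P → G) (p : P) (c : ℝ) (X : TangentSpace IP p) :
    tderiv IP f p (c • X) = c • tderiv IP f p X :=
  map_smul (mfderiv IP 𝓘(ℝ, G) f p) c X

theorem tderiv_zero_right (f : P → G) (p : P) : tderiv IP f p (0 : TangentSpace IP p) = 0 :=
  map_zero (mfderiv IP 𝓘(ℝ, G) f p)

theorem tderiv_add {f g : P → G} {p : P} (hf : MDifferentiableAt IP 𝓘(ℝ, G) f p)
    (hg : MDifferentiableAt IP 𝓘(ℝ, G) g p) (X : TangentSpace IP p) :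
    tderiv IP (fun q => f q + g q) p X = tderiv IP f p X + tderiv IP g p X :=
  DFunLike.congr_fun (hf.hasMFDerivAt.add hg.hasMFDerivAt).mfderiv X

theorem tderiv_sub {f g : P → G} {p : P} (hf : MDifferentiableAt IP 𝓘(ℝ, G) f p)
    (hg : MDifferentiableAt IP 𝓘(ℝ, G) g p) (X : TangentSpace IP p) :
    tderiv IP (fun q => f q - g q) p X = tderiv IP f p X - tderiv IP g p X :=
  DFunLike.congr_fun (hf.hasMFDerivAt.sub hg.hasMFDerivAt).mfderiv X

theorem tderiv_mul {f g : P → ℝ} {p : P} (hf : MDifferentiableAt IP 𝓘(ℝ, ℝ) f p)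
    (hg : MDifferentiableAt IP 𝓘(ℝ, ℝ) g p) (X : TangentSpace IP p) :
    tderiv IP (fun q => f q * g q) p X = tderiv IP f p X * g p + f p * tderiv IP g p X := by
  have := DFunLike.congr_fun (hf.hasMFDerivAt.mul hg.hasMFDerivAt).mfderiv X
  refine this.trans ?_
  change f p * tderiv IP g p X + g p * tderiv IP f p X = _
  ring

theorem tderiv_const (c : G) (p : P) (X : TangentSpace IP p) :
    tderiv IP (fun _ : P => c) p X = 0 := by
  have := DFunLike.congr_fun (mfderiv_const (I := IP) (I' := 𝓘(ℝ, G)) (x := p) (c := c)) X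
  exact this

/-- The derivative of a function with values in a normed space along a vector field. -/
def vfDeriv (IP : ModelWithCorners ℝ EP HP) (f : P → G)
    (V : (p : P) → TangentSpace IP p) (p : P) : G :=
  tderiv IP f p (V p)

/-- A vector field in the chart at `p`. -/
def vfChart (IP : ModelWithCorners ℝ EP HP) (V : (p : P) → TangentSpace IP p) (p : P) : EP → EP :=
  VectorField.mpullbackWithin 𝓘(ℝ, EP) IP (extChartAt IP p).symm V (Set.range IP)

/-- Pulling the chart representation back along the chart returns `V` near `p`; applying the
invertible differential of the chart cancels the inverse hidden in the pullback. -/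
theorem vfChart_apply [IsManifold IP ∞ P] (V : (p : P) → TangentSpace IP p) (p : P) :
    ∀ᶠ q in 𝓝 p, vfChart IP V p (extChartAt IP p q) = tderiv IP (extChartAt IP p) q (V q) := by
  have hP1 : IsManifold IP 1 P := IsManifold.of_le (n := ∞) (by simp)
  have h1 := VectorField.eventuallyEq_mpullback_mpullbackWithin_extChartAt (I := IP) (s := Set.univ)
    (x := p) V
  rw [nhdsWithin_univ] at h1
  filter_upwards [h1, extChartAt_source_mem_nhds (I := IP) p] with q hq hqs
  rw [hq, VectorField.mpullback_apply]
  obtain ⟨e, he⟩ := isInvertible_mfderiv_extChartAt (I := IP) hqs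
  simp only [tderiv]
  rw [← he, ContinuousLinearMap.inverse_equiv]
  exact (e.apply_symm_apply _).symm

variable [IP.Boundaryless]

theorem contDiffAt_comp_extChartAt_symm {f : P → G} {p : P} (hf : ContMDiffAt IP 𝓘(ℝ, G) ∞ f p) :
    ContDiffAt ℝ ∞ (f ∘ (extChartAt IP p).symm) (extChartAt IP p p) := by
  have := (contMDiffAt_iff.1 hf).2
  rw [IP.range_eq_univ, contDiffWithinAt_univ] at this
  exact this

variable [IsManifold IP ∞ P]

/-- The derivative of a function along a vector field, read in the chart at `p`. -/
theorem vfDeriv_eq_fderiv {f : P → G} {p : P} (hf : ContMDiffAt IP 𝓘(ℝ, G) ∞ f p)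
    (V : (p : P) → TangentSpace IP p) :
    vfDeriv IP f V =ᶠ[𝓝 p] (fun u => fderiv ℝ (f ∘ (extChartAt IP p).symm) u
      (vfChart IP V p u)) ∘ extChartAt IP p := by
  have hP1 : IsManifold IP 1 P := IsManifold.of_le (n := ∞) (by simp)
  have h2 : ∀ᶠ u in 𝓝 (extChartAt IP p p),
      DifferentiableAt ℝ (f ∘ (extChartAt IP p).symm) u := by
    have := ((contDiffAt_comp_extChartAt_symm hf).of_le (m := 1) (by simp)).eventually (by simp)
    exact this.mono fun u hu => hu.differentiableAt (by simp)
  have h3 := (continuousAt_extChartAt (I := IP) p).eventually h2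
  filter_upwards [vfChart_apply V p, h3, extChartAt_source_mem_nhds (I := IP) p] with q hq hq3 hqs
  have hχ : MDifferentiableAt IP 𝓘(ℝ, EP) (extChartAt IP p) q :=
    mdifferentiableAt_extChartAt (by simpa using hqs)
  rw [Function.comp_apply, hq, ← tderiv_eq_fderiv, vfDeriv]
  refine Eq.trans ?_ (tderiv_comp hq3.mdifferentiableAt hχ (V q))
  refine tderiv_congr ?_ _
  filter_upwards [(isOpen_extChartAt_source (I := IP) p).mem_nhds hqs] with y hy
  simp only [Function.comp_apply]
  rw [(extChartAt IP p).left_inv hy]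

variable [CompleteSpace EP]

theorem differentiableAt_vfChart {p : P} {V : (p : P) → TangentSpace IP p}
    (hV : MDifferentiableAt IP IP.tangent (fun q => (⟨q, V q⟩ : TangentBundle IP P)) p) :
    DifferentiableAt ℝ (vfChart IP V p) (extChartAt IP p p) := by
  have hP2 : IsManifold IP 2 P := IsManifold.of_le (n := ∞) two_le_infty
  have h := MDifferentiableWithinAt.differentiableWithinAt_mpullbackWithin_vectorField
    (I := IP) (s := Set.univ) (V := V) (x := p) hV.mdifferentiableWithinAt
  have : (extChartAt IP p).symm ⁻¹' Set.univ ∩ Set.range IP = Set.univ := by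
    simp [IP.range_eq_univ]
  rw [this] at h
  exact differentiableWithinAt_univ.1 h

theorem differentiableAt_fderiv_vfChart {f : P → G} {p : P} (hf : ContMDiffAt IP 𝓘(ℝ, G) ∞ f p)
    {V : (p : P) → TangentSpace IP p}
    (hV : MDifferentiableAt IP IP.tangent (fun q => (⟨q, V q⟩ : TangentBundle IP P)) p) :
    DifferentiableAt ℝ (fun u => fderiv ℝ (f ∘ (extChartAt IP p).symm) u (vfChart IP V p u))
      (extChartAt IP p p) := by
  have hfd : DifferentiableAt ℝ (fderiv ℝ (f ∘ (extChartAt IP p).symm)) (extChartAt IP p p) :=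
    ((contDiffAt_comp_extChartAt_symm hf).fderiv_right (m := 1) (by norm_cast)).differentiableAt
      (by simp)
  exact hfd.clm_apply (differentiableAt_vfChart hV)

theorem mdifferentiableAt_vfDeriv {f : P → G} {p : P} (hf : ContMDiffAt IP 𝓘(ℝ, G) ∞ f p)
    {V : (p : P) → TangentSpace IP p}
    (hV : MDifferentiableAt IP IP.tangent (fun q => (⟨q, V q⟩ : TangentBundle IP P)) p) :
    MDifferentiableAt IP 𝓘(ℝ, G) (vfDeriv IP f V) p := by
  have hP1 : IsManifold IP 1 P := IsManifold.of_le (n := ∞) (by simp)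
  refine MDifferentiableAt.congr_of_eventuallyEq ?_ (vfDeriv_eq_fderiv hf V)
  exact MDifferentiableAt.comp p (differentiableAt_fderiv_vfChart hf hV).mdifferentiableAt
    (contMDiffAt_extChartAt (n := 1) |>.mdifferentiableAt (by simp))

/-- The Lie bracket of vector fields acts on functions as the commutator. -/
theorem vfDeriv_mlieBracket {f : P → G} {p : P} (hf : ContMDiffAt IP 𝓘(ℝ, G) ∞ f p)
    {V W : (p : P) → TangentSpace IP p}
    (hV : MDifferentiableAt IP IP.tangent (fun q => (⟨q, V q⟩ : TangentBundle IP P)) p)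
    (hW : MDifferentiableAt IP IP.tangent (fun q => (⟨q, W q⟩ : TangentBundle IP P)) p) :
    tderiv IP f p (VectorField.mlieBracket IP V W p) =
      tderiv IP (vfDeriv IP f W) p (V p) - tderiv IP (vfDeriv IP f V) p (W p) := by
  have hP1 : IsManifold IP 1 P := IsManifold.of_le (n := ∞) (by simp)
  have hχ : MDifferentiableAt IP 𝓘(ℝ, EP) (extChartAt IP p) p :=
    mdifferentiableAt_extChartAt (by simp)
  have hcomm := VectorField.fderiv_apply_lieBracket (contDiffAt_comp_extChartAt_symm hf)
    (by simpa using two_le_infty) (differentiableAt_vfChart hW) (differentiableAt_vfChart hV)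
  -- Both iterated derivatives are transported to the chart at `p`, where the identity is the
  -- commutator formula `hcomm` in a normed space.
  have outer (Z Y : (p : P) → TangentSpace IP p)
      (hZ : MDifferentiableAt IP IP.tangent (fun q => (⟨q, Z q⟩ : TangentBundle IP P)) p) :
      tderiv IP (vfDeriv IP f Z) p (Y p) =
      fderiv ℝ (fun u => fderiv ℝ (f ∘ (extChartAt IP p).symm) u (vfChart IP Z p u))
      (extChartAt IP p p) (vfChart IP Y p (extChartAt IP p p)) := by
    rw [tderiv_congr (vfDeriv_eq_fderiv hf Z), tderiv_comp
      (differentiableAt_fderiv_vfChart hf hZ).mdifferentiableAt hχ, ← tderiv_eq_fderiv,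
      (vfChart_apply Y p).self_of_nhds]
    rfl
  rw [outer V W hV, outer W V hW]
  refine Eq.trans ?_ hcomm
  have h1 := (vfDeriv_eq_fderiv hf (VectorField.mlieBracket IP V W)).self_of_nhds
  rw [vfDeriv, Function.comp_apply, (vfChart_apply _ p).self_of_nhds] at h1
  rw [h1]
  congr 1
  have h2 : (extChartAt IP p).symm ⁻¹' Set.univ ∩ Set.range IP = Set.univ := by
    simp [IP.range_eq_univ]
  rw [← VectorField.mlieBracketWithin_univ, VectorField.mlieBracketWithin_apply, h2]
  obtain ⟨e, he⟩ := isInvertible_mfderiv_extChartAt (I := IP) (mem_extChartAt_source (I := IP) p)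
  simp only [tderiv]
  rw [← he, ContinuousLinearMap.inverse_equiv]
  refine (e.apply_symm_apply _).trans ?_
  rw [← VectorField.lieBracketWithin_univ]
  rfl

variable [IsManifold IQ ∞ Q] [IQ.Boundaryless] [CompleteSpace EQ]

/-- Brackets of related vector fields are related. -/
theorem mfderiv_mlieBracket_of_related
    {ν : P → Q} (hν : ContMDiff IP IQ ∞ ν)
    {V W : (p : P) → TangentSpace IP p} {V' W' : (x : Q) → TangentSpace IQ x} {p : P}
    (hV : MDifferentiableAt IP IP.tangent (fun q => (⟨q, V q⟩ : TangentBundle IP P)) p)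
    (hW : MDifferentiableAt IP IP.tangent (fun q => (⟨q, W q⟩ : TangentBundle IP P)) p)
    (hV' : MDifferentiableAt IQ IQ.tangent (fun q => (⟨q, V' q⟩ : TangentBundle IQ Q)) (ν p))
    (hW' : MDifferentiableAt IQ IQ.tangent (fun q => (⟨q, W' q⟩ : TangentBundle IQ Q)) (ν p))
    (hVV' : ∀ p, V' (ν p) = mfderiv IP IQ ν p (V p))
    (hWW' : ∀ p, W' (ν p) = mfderiv IP IQ ν p (W p)) :
    VectorField.mlieBracket IQ V' W' (ν p) =
      mfderiv IP IQ ν p (VectorField.mlieBracket IP V W p) := by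
  have hQ1 : IsManifold IQ 1 Q := IsManifold.of_le (n := ∞) (by simp)
  -- Both vectors are tested on one vector-valued function, the chart at `ν p`: its differential is
  -- injective there, and relatedness identifies the iterated derivatives of the chart with those of
  -- its composite with `ν`.
  have hχ : ContMDiffAt IQ 𝓘(ℝ, EQ) ∞ (extChartAt IQ (ν p)) (ν p) := contMDiffAt_extChartAt
  have hχd := hχ.mdifferentiableAt (n := ∞) (by simp)
  have hνd (q) : MDifferentiableAt IP IQ ν q := hν.contMDiffAt.mdifferentiableAt (by simp)
  have step (Z : (p : P) → TangentSpace IP p) (Z' : (x : Q) → TangentSpace IQ x)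
      (hZ : ∀ p, Z' (ν p) = mfderiv IP IQ ν p (Z p)) :
      vfDeriv IP (extChartAt IQ (ν p) ∘ ν) Z =ᶠ[𝓝 p]
        vfDeriv IQ (extChartAt IQ (ν p)) Z' ∘ ν := by
    filter_upwards [hν.continuous.continuousAt.preimage_mem_nhds
      (extChartAt_source_mem_nhds (I := IQ) (ν p))] with q hq
    have h1 : MDifferentiableAt IQ 𝓘(ℝ, EQ) (extChartAt IQ (ν p)) (ν q) :=
      mdifferentiableAt_extChartAt (by simpa using hq)
    rw [vfDeriv, tderiv_comp h1 (hνd q), ← hZ q]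
    rfl
  have step2 (Z Y : (p : P) → TangentSpace IP p) (Z' Y' : (x : Q) → TangentSpace IQ x)
      (hZ : ∀ p, Z' (ν p) = mfderiv IP IQ ν p (Z p)) (hY : ∀ p, Y' (ν p) = mfderiv IP IQ ν p (Y p))
      (hZd : MDifferentiableAt IQ IQ.tangent (fun q => (⟨q, Z' q⟩ : TangentBundle IQ Q)) (ν p)) :
      tderiv IP (vfDeriv IP (extChartAt IQ (ν p) ∘ ν) Z) p (Y p) =
        tderiv IQ (vfDeriv IQ (extChartAt IQ (ν p)) Z') (ν p) (Y' (ν p)) := by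
    rw [tderiv_congr (step Z Z' hZ), tderiv_comp (mdifferentiableAt_vfDeriv hχ hZd) (hνd p), hY p]
  have h1 := vfDeriv_mlieBracket (IP := IP) (f := extChartAt IQ (ν p) ∘ ν)
    (hχ.comp p hν.contMDiffAt) hV hW
  have h2 := vfDeriv_mlieBracket (IP := IQ) hχ hV' hW'
  rw [step2 V W V' W' hVV' hWW' hV', step2 W V W' V' hWW' hVV' hW', ← h2,
    tderiv_comp hχd (hνd p)] at h1
  obtain ⟨e, he⟩ := isInvertible_mfderiv_extChartAt (I := IQ)
    (mem_extChartAt_source (I := IQ) (ν p))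
  simp only [tderiv] at h1
  rw [← he] at h1
  exact (e.injective h1).symm

end VectorFields

end Vakonomic

namespace Vakonomic

/-! ### The canonical symplectic section, its pullbacks and their closedness. -/

section CanonicalForm

variable {m : ℕ}
  {Q : Type*} [TopologicalSpace Q] [T2Space Q]
  [ChartedSpace (EuclideanSpace ℝ (Fin m)) Q] [IsManifold (𝓡 m) ∞ Q]
  {F : Type*} [NormedAddCommGroup F] [NormedSpace ℝ F]
  {E : Q → Type*} [TopologicalSpace (TotalSpace F E)]
  [∀ x, AddCommGroup (E x)] [∀ x, Module ℝ (E x)] [∀ x, TopologicalSpace (E x)]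
  [∀ x, IsTopologicalAddGroup (E x)] [∀ x, ContinuousSMul ℝ (E x)]
  [FiberBundle F E] [VectorBundle ℝ F E] [ContMDiffVectorBundle ∞ F E (𝓡 m)]
  {EP : Type*} [NormedAddCommGroup EP] [NormedSpace ℝ EP]
  {HP : Type*} [TopologicalSpace HP] {IP : ModelWithCorners ℝ EP HP}
  {P : Type*} [TopologicalSpace P] [ChartedSpace HP P]

/-- The linear function on the dual bundle defined by a section. -/
def pairSec (σ : Cₛ^∞⟮𝓡 m; F, E⟯) (φ : DualTotal F E) : ℝ := φ.2 (σ φ.1)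

theorem contMDiff_pairSec (σ : Cₛ^∞⟮𝓡 m; F, E⟯) :
    ContMDiff (dualModel m F) 𝓘(ℝ, ℝ) ∞ (pairSec σ) := fun φ =>
  contMDiffAt_pairing (b := fun ψ : DualTotal F E => ψ.1) (φ := fun ψ => ψ.2)
    (v := fun ψ => σ ψ.1) contMDiffAt_id
    (ContMDiffAt.comp φ (g := fun x => (⟨x, σ x⟩ : TotalSpace F E)) σ.contMDiff.contMDiffAt
      (contMDiff_proj (fun x => E x →L[ℝ] ℝ)).contMDiffAt)

theorem mdifferentiableAt_pairSec (σ : Cₛ^∞⟮𝓡 m; F, E⟯) (φ : DualTotal F E) :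
    MDifferentiableAt (dualModel m F) 𝓘(ℝ, ℝ) (pairSec σ) φ :=
  (contMDiff_pairSec σ).contMDiffAt.mdifferentiableAt (by simp)

theorem bracket_add_left (A : LieAlgebroid m F E) (σ σ' τ : Cₛ^∞⟮𝓡 m; F, E⟯) :
    A.bracket (σ + σ') τ = A.bracket σ τ + A.bracket σ' τ := by
  rw [A.bracket_skew, A.bracket_add, A.bracket_skew τ σ, A.bracket_skew τ σ']
  abel

variable [FiniteDimensional ℝ F]

theorem mdifferentiableAt_dualProj (φ : DualTotal F E) :
    MDifferentiableAt (dualModel m F) (𝓡 m) (TotalSpace.proj : DualTotal F E → Q) φ :=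
  ((contMDiff_proj (n := ∞) (fun x => E x →L[ℝ] ℝ)).contMDiffAt).mdifferentiableAt (by simp)

/-- In `dλ(σ, τ)` the value at a point depends only on the value of the first section. -/
theorem tderiv_pairSec_add_bracket_eq_zero (A : LieAlgebroid m F E) {φ : DualTotal F E}
    {τ : Cₛ^∞⟮𝓡 m; F, E⟯} {X : TangentSpace (dualModel m F) φ}
    (hX : A.anchor φ.1 (τ φ.1) = mfderiv (dualModel m F) (𝓡 m) TotalSpace.proj φ X)
    {σ : Cₛ^∞⟮𝓡 m; F, E⟯} (hσ : σ φ.1 = 0) :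
    tderiv (dualModel m F) (pairSec σ) φ X + φ.2 (A.bracket σ τ φ.1) = 0 := by
  -- With `τ` and `X` fixed the expression is tensorial in `σ`: replacing `σ` by `fσ`, the
  -- derivative of `f` along `X` cancels against the Leibniz term of the bracket, since `X` projects
  -- to the anchor of `τ`.
  let D : Cₛ^∞⟮𝓡 m; F, E⟯ →+ ℝ := AddMonoidHom.mk'
    (fun σ => tderiv (dualModel m F) (pairSec σ) φ X + φ.2 (A.bracket σ τ φ.1)) (by
      intro σ σ'
      have h : pairSec (σ + σ') = fun ψ => pairSec σ ψ + pairSec σ' ψ := by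
        ext ψ; simp [pairSec]
      rw [h, tderiv_add (mdifferentiableAt_pairSec σ φ) (mdifferentiableAt_pairSec σ' φ),
        bracket_add_left]
      simp only [ContMDiffSection.coe_add, Pi.add_apply, map_add]
      ring)
  refine eq_zero_of_tensorial (x := φ.1) D (fun f σ => ?_) hσ
  change tderiv (dualModel m F) (pairSec (smulSection f σ)) φ X
      + φ.2 (A.bracket (smulSection f σ) τ φ.1) =
    f φ.1 * (tderiv (dualModel m F) (pairSec σ) φ X + φ.2 (A.bracket σ τ φ.1))
  have h : pairSec (smulSection f σ) = fun ψ => (f ∘ TotalSpace.proj) ψ * pairSec σ ψ := by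
    ext ψ
    change ψ.2 (f ψ.1 • σ ψ.1) = _
    rw [map_smul]; rfl
  have hf : MDifferentiableAt (𝓡 m) 𝓘(ℝ, ℝ) f φ.1 :=
    f.contMDiff.contMDiffAt.mdifferentiableAt (by simp)
  rw [h, tderiv_mul (hf.comp φ (mdifferentiableAt_dualProj φ)) (mdifferentiableAt_pairSec σ φ),
    tderiv_comp hf (mdifferentiableAt_dualProj φ), ← hX, A.bracket_skew,
    A.bracket_skew σ τ]
  have h2 := A.leibniz f τ σ φ.1
  simp only [ContMDiffSection.coe_neg, Pi.neg_apply]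
  rw [h2, derivAlong_eq_tderiv]
  simp only [map_neg, map_add, map_smul, smul_eq_mul, Function.comp_apply]
  change _ * φ.2 (σ φ.1) + _ + _ = _
  ring

/-- The canonical symplectic section evaluated through arbitrary sections. -/
theorem canonicalTwo_apply (A : LieAlgebroid m F E) {φ : DualTotal F E}
    {σ₁ σ₂ : Cₛ^∞⟮𝓡 m; F, E⟯} {X₁ X₂ : TangentSpace (dualModel m F) φ}
    (h₁ : A.anchor φ.1 (σ₁ φ.1) = mfderiv (dualModel m F) (𝓡 m) TotalSpace.proj φ X₁)
    (h₂ : A.anchor φ.1 (σ₂ φ.1) = mfderiv (dualModel m F) (𝓡 m) TotalSpace.proj φ X₂) :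
    canonicalTwo A φ (σ₁ φ.1, X₁) (σ₂ φ.1, X₂) =
      tderiv (dualModel m F) (pairSec σ₁) φ X₂ - tderiv (dualModel m F) (pairSec σ₂) φ X₁
        + φ.2 (A.bracket σ₁ σ₂ φ.1) := by
  set s₁ : Cₛ^∞⟮𝓡 m; F, E⟯ := sectionThrough m F (σ₁ φ.1) with hs₁
  set s₂ : Cₛ^∞⟮𝓡 m; F, E⟯ := sectionThrough m F (σ₂ φ.1) with hs₂
  have e₁ : s₁ φ.1 = σ₁ φ.1 := (exists_section_through m F (σ₁ φ.1)).choose_spec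
  have e₂ : s₂ φ.1 = σ₂ φ.1 := (exists_section_through m F (σ₂ φ.1)).choose_spec
  change tderiv (dualModel m F) (pairSec s₁) φ X₂ - tderiv (dualModel m F) (pairSec s₂) φ X₁
        + φ.2 (A.bracket s₁ s₂ φ.1) = _
  have sub (s σ : Cₛ^∞⟮𝓡 m; F, E⟯) (X : TangentSpace (dualModel m F) φ) :
      tderiv (dualModel m F) (pairSec (s - σ)) φ X =
      tderiv (dualModel m F) (pairSec s) φ X - tderiv (dualModel m F) (pairSec σ) φ X := by
    rw [← tderiv_sub (mdifferentiableAt_pairSec s φ) (mdifferentiableAt_pairSec σ φ)]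
    congr 1
    ext ψ; simp [pairSec]
  have bsub (s σ τ : Cₛ^∞⟮𝓡 m; F, E⟯) :
      A.bracket (s - σ) τ φ.1 = A.bracket s τ φ.1 - A.bracket σ τ φ.1 := by
    have := bracket_add_left A (s - σ) σ τ
    rw [sub_add_cancel] at this
    rw [this]; simp
  -- The two chosen sections are exchanged one at a time: first `s₁` for `σ₁` against `s₂`, then
  -- `s₂` for `σ₂` against `σ₁`.
  have k₁ := tderiv_pairSec_add_bracket_eq_zero A (τ := s₂) (X := X₂) (by rw [e₂, h₂])
    (σ := s₁ - σ₁) (by simp [e₁])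
  have k₂ := tderiv_pairSec_add_bracket_eq_zero A (τ := σ₁) (X := X₁) h₁
    (σ := s₂ - σ₂) (by simp [e₂])
  rw [sub, bsub, A.bracket_skew s₂ σ₁, A.bracket_skew σ₂ σ₁] at k₂
  rw [sub, bsub] at k₁
  simp only [ContMDiffSection.coe_neg, Pi.neg_apply, map_neg, map_sub] at k₁ k₂
  linarith

/-- A `2`-section is given by the pullback of the canonical symplectic section along a map
`Φ` to the dual bundle. -/
def IsCanonicalPullback (IP : ModelWithCorners ℝ EP HP) (A : LieAlgebroid m F E)
    (Φ : P → DualTotal F E) (Θ : TwoSection (E := E) IP (TotalSpace.proj ∘ Φ)) : Prop :=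
  ∀ (p : P) (σ₁ σ₂ : Cₛ^∞⟮𝓡 m; F, E⟯) (X₁ X₂ : TangentSpace IP p),
    A.anchor (Φ p).1 (σ₁ (Φ p).1) = mfderiv IP (𝓡 m) (TotalSpace.proj ∘ Φ) p X₁ →
    A.anchor (Φ p).1 (σ₂ (Φ p).1) = mfderiv IP (𝓡 m) (TotalSpace.proj ∘ Φ) p X₂ →
    Θ p (σ₁ (Φ p).1, X₁) (σ₂ (Φ p).1, X₂) =
      tderiv IP (pairSec σ₁ ∘ Φ) p X₂ - tderiv IP (pairSec σ₂ ∘ Φ) p X₁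
        + (Φ p).2 (A.bracket σ₁ σ₂ (Φ p).1)

/-- The formula only involves derivatives of functions `pairSec σ`, so by the chain rule it survives
pullback along any smooth map to the dual bundle. -/
theorem isCanonicalPullback_pullback (A : LieAlgebroid m F E) {Φ : P → DualTotal F E}
    (hΦ : ContMDiff IP (dualModel m F) ∞ Φ) :
    IsCanonicalPullback IP A Φ (TwoSection.pullback IP Φ (canonicalTwo A)) := by
  intro p σ₁ σ₂ X₁ X₂ h₁ h₂
  have hΦp : MDifferentiableAt IP (dualModel m F) Φ p := hΦ.contMDiffAt.mdifferentiableAt (by simp)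
  rw [mfderiv_comp_apply p (mdifferentiableAt_dualProj (Φ p)) hΦp] at h₁ h₂
  rw [tderiv_comp (mdifferentiableAt_pairSec _ _) hΦp,
    tderiv_comp (mdifferentiableAt_pairSec _ _) hΦp]
  exact canonicalTwo_apply A h₁ h₂

variable [IsManifold IP ∞ P] [IP.Boundaryless] [CompleteSpace EP]

/-- The prolongation bracket of projectable sections lies again in the prolongation. This is what
permits evaluating a pulled back canonical form on brackets. -/
theorem anchor_bracketVal (A : LieAlgebroid m F E) {ν : P → Q} (hν : ContMDiff IP (𝓡 m) ∞ ν)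
    (s t : ProjSection IP A ν) (p : P) :
    A.anchor (ν p) (A.bracket s.sec t.sec (ν p)) =
      mfderiv IP (𝓡 m) ν p (VectorField.mlieBracket IP s.vf t.vf p) := by
  have hvf (r : ProjSection IP A ν) : MDifferentiableAt IP IP.tangent
      (fun q => (⟨q, r.vf q⟩ : TangentBundle IP P)) p :=
    r.vf.contMDiff.contMDiffAt.mdifferentiableAt (by simp)
  have hanc (r : ProjSection IP A ν) : MDifferentiableAt (𝓡 m) (𝓡 m).tangent
      (fun y => (⟨y, A.anchor y (r.sec y)⟩ : TangentBundle (𝓡 m) Q)) (ν p) :=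
    (A.anchor_smooth.comp r.sec.contMDiff).contMDiffAt.mdifferentiableAt (by simp)
  rw [A.anchor_bracket]
  exact mfderiv_mlieBracket_of_related hν (hvf s) (hvf t) (hanc s) (hanc t) s.related t.related

/-- The pullback of the canonical symplectic section is closed. -/
theorem IsCanonicalPullback.isClosedTwo {A : LieAlgebroid m F E} {Φ : P → DualTotal F E}
    (hΦ : ContMDiff IP (dualModel m F) ∞ Φ)
    {Θ : TwoSection (E := E) IP (TotalSpace.proj ∘ Φ)} (hΘ : IsCanonicalPullback IP A Φ Θ) :
    IsClosedTwo IP A (TotalSpace.proj ∘ Φ) Θ := by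
  have hν : ContMDiff IP (𝓡 m) ∞ (TotalSpace.proj ∘ Φ) :=
    (contMDiff_proj (fun x => E x →L[ℝ] ℝ)).comp hΦ
  intro r s t p
  have hvf (r : ProjSection IP A (TotalSpace.proj ∘ Φ)) : MDifferentiableAt IP IP.tangent
      (fun q => (⟨q, r.vf q⟩ : TangentBundle IP P)) p :=
    r.vf.contMDiff.contMDiffAt.mdifferentiableAt (by simp)
  have hsm (σ : Cₛ^∞⟮𝓡 m; F, E⟯) : ContMDiffAt IP 𝓘(ℝ, ℝ) ∞ (pairSec σ ∘ Φ) p :=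
    ((contMDiff_pairSec σ).comp hΦ).contMDiffAt
  have hval (s t : ProjSection IP A (TotalSpace.proj ∘ Φ)) (q : P) :
      Θ q (s.val q) (t.val q) = vfDeriv IP (pairSec s.sec ∘ Φ) t.vf q
        - vfDeriv IP (pairSec t.sec ∘ Φ) s.vf q + (pairSec (A.bracket s.sec t.sec) ∘ Φ) q :=
    hΘ q s.sec t.sec (s.vf q) (t.vf q) (s.related q) (t.related q)
  have hact (r s t : ProjSection IP A (TotalSpace.proj ∘ Φ)) :
      r.act (fun q => Θ q (s.val q) (t.val q)) p =
        tderiv IP (vfDeriv IP (pairSec s.sec ∘ Φ) t.vf) p (r.vf p)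
        - tderiv IP (vfDeriv IP (pairSec t.sec ∘ Φ) s.vf) p (r.vf p)
        + tderiv IP (pairSec (A.bracket s.sec t.sec) ∘ Φ) p (r.vf p) := by
    have e : (fun q => Θ q (s.val q) (t.val q)) = _ := funext (hval s t)
    have d1 := mdifferentiableAt_vfDeriv (hsm s.sec) (hvf t)
    have d2 := mdifferentiableAt_vfDeriv (hsm t.sec) (hvf s)
    have d3 : MDifferentiableAt IP 𝓘(ℝ, ℝ) (fun q => vfDeriv IP (pairSec s.sec ∘ Φ) t.vf q
      - vfDeriv IP (pairSec t.sec ∘ Φ) s.vf q) p := d1.sub d2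
    rw [ProjSection.act, derivAlong_eq_tderiv, e, tderiv_add d3
      ((hsm _).mdifferentiableAt (by simp)), tderiv_sub d1 d2]
  have hbr (r s t : ProjSection IP A (TotalSpace.proj ∘ Φ)) :
      Θ p (r.bracketVal s p) (t.val p) =
        tderiv IP (pairSec (A.bracket r.sec s.sec) ∘ Φ) p (t.vf p)
        - (tderiv IP (vfDeriv IP (pairSec t.sec ∘ Φ) s.vf) p (r.vf p)
          - tderiv IP (vfDeriv IP (pairSec t.sec ∘ Φ) r.vf) p (s.vf p))
        + (Φ p).2 (A.bracket (A.bracket r.sec s.sec) t.sec (Φ p).1) := by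
    rw [← vfDeriv_mlieBracket (hsm t.sec) (hvf r) (hvf s)]
    exact hΘ p (A.bracket r.sec s.sec) t.sec (VectorField.mlieBracket IP r.vf s.vf p) (t.vf p)
      (anchor_bracketVal A hν r s p) (t.related p)
  have hjac : (Φ p).2 (A.bracket (A.bracket r.sec s.sec) t.sec (Φ p).1)
      - (Φ p).2 (A.bracket (A.bracket r.sec t.sec) s.sec (Φ p).1)
      + (Φ p).2 (A.bracket (A.bracket s.sec t.sec) r.sec (Φ p).1) = 0 := by
    rw [A.bracket_skew (A.bracket r.sec t.sec), A.bracket_skew (A.bracket s.sec t.sec),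
      A.jacobi r.sec s.sec t.sec]
    simp only [ContMDiffSection.coe_neg, ContMDiffSection.coe_add, Pi.neg_apply, Pi.add_apply,
      map_neg, map_add]
    ring
  -- The iterated derivatives cancel by the commutator formula inside `hbr`, the derivatives of
  -- pairings with brackets cancel in pairs, and what is left is `hjac`.
  rw [hact, hact, hact, hbr, hbr, hbr]
  linarith

end CanonicalForm

end Vakonomic

namespace Vakonomic

/-! ### Smooth structure of W₀ and the forms restricted to submanifolds of it. -/

namespace ConstraintSubmanifold

variable {m k : ℕ}
  {Q : Type*} [TopologicalSpace Q] [T2Space Q]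
  [ChartedSpace (EuclideanSpace ℝ (Fin m)) Q] [IsManifold (𝓡 m) ∞ Q]
  {F : Type*} [NormedAddCommGroup F] [NormedSpace ℝ F]
  {E : Q → Type*} [TopologicalSpace (TotalSpace F E)]
  [∀ x, AddCommGroup (E x)] [∀ x, Module ℝ (E x)] [∀ x, TopologicalSpace (E x)]
  [∀ x, IsTopologicalAddGroup (E x)] [∀ x, ContinuousSMul ℝ (E x)]
  [FiberBundle F E] [VectorBundle ℝ F E] [ContMDiffVectorBundle ∞ F E (𝓡 m)]
  {A : LieAffgebroid m F E} {M : Type*} [TopologicalSpace M]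
  [ChartedSpace (EuclideanSpace ℝ (Fin (m + k))) M] [IsManifold (𝓡 (m + k)) ∞ M]
  (C : ConstraintSubmanifold A k M)
  {EP : Type*} [NormedAddCommGroup EP] [NormedSpace ℝ EP]
  {HP : Type*} [TopologicalSpace HP] {IP : ModelWithCorners ℝ EP HP}
  {P : Type*} [TopologicalSpace P] [ChartedSpace HP P]

/-- Smoothness of maps to `W₀`, in terms of the two projections. -/
theorem contMDiffAt_W₀_iff {f : P → C.W₀} {t : P} :
    ContMDiffAt IP (modelW₀ m k F) ∞ f t ↔
      ContMDiffAt IP (𝓡 (m + k)) ∞ (fun s => (f s).1) t ∧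
      ContMDiffAt IP (dualModel m F) ∞ (fun s => C.pr₁ (f s)) t := by
  constructor
  · intro h
    obtain ⟨h1, h2⟩ := contMDiffAt_totalSpace.1 h
    refine ⟨h1, contMDiffAt_totalSpace.2 ⟨?_, h2⟩⟩
    exact ContMDiffAt.comp t (g := C.proj) (f := fun s => (f s).1)
      C.proj.contMDiff.contMDiffAt h1
  · rintro ⟨h1, h2⟩
    exact contMDiffAt_totalSpace.2 ⟨h1, (contMDiffAt_totalSpace.1 h2).2⟩

theorem contMDiff_pr₁ : ContMDiff (modelW₀ m k F) (dualModel m F) ∞ C.pr₁ := fun _ =>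
  (C.contMDiffAt_W₀_iff.1 contMDiffAt_id).2

theorem contMDiff_fst : ContMDiff (modelW₀ m k F) (𝓡 (m + k)) ∞ (fun w : C.W₀ => w.1) := fun _ =>
  (C.contMDiffAt_W₀_iff.1 contMDiffAt_id).1

theorem contMDiff_nu : ContMDiff (modelW₀ m k F) (𝓡 m) ∞ C.nu :=
  C.proj.contMDiff.comp C.contMDiff_fst

theorem contMDiff_incl_fst : ContMDiff (modelW₀ m k F) ((𝓡 m).prod 𝓘(ℝ, F)) ∞
    (fun w : C.W₀ => C.incl w.1) :=
  C.incl.contMDiff.comp C.contMDiff_fst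

theorem contMDiff_hamiltonian {L : TotalSpace F E → ℝ}
    (hL : ContMDiffOn ((𝓡 m).prod 𝓘(ℝ, F)) 𝓘(ℝ, ℝ) ∞ L A.affineBundle) :
    ContMDiff (modelW₀ m k F) 𝓘(ℝ, ℝ) ∞ (C.hamiltonian L) := by
  intro w
  have h1 : ContMDiffAt (modelW₀ m k F) 𝓘(ℝ, ℝ) ∞
      (fun w : C.W₀ => C.covector w (C.incl w.1).2) w :=
    contMDiffAt_pairing (b := C.nu) (φ := C.covector) (v := fun w => (C.incl w.1).2)
      C.contMDiff_pr₁.contMDiffAt C.contMDiff_incl_fst.contMDiffAt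
  have h2 : ContMDiff (modelW₀ m k F) 𝓘(ℝ, ℝ) ∞ (fun w : C.W₀ => L (C.incl w.1)) :=
    hL.comp_contMDiff C.contMDiff_incl_fst fun w => C.mem_affineBundle w.1
  exact h1.sub h2.contMDiffAt

theorem injective_incl : Function.Injective C.incl := C.isEmbedding.isEmbedding.injective

/-- On a projectable section η is a function pulled back from `Q`, and a vector field related to the
anchor differentiates it as the anchor does; the expression becomes the cocycle identity at the base
point. -/
theorem eta_closed [FiniteDimensional ℝ F] {j : P → C.W₀} [IsManifold IP ∞ P]
    (hj : ContMDiff IP (modelW₀ m k F) ∞ j) :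
    IsClosedOne IP A.toLieAlgebroid (C.nu ∘ j) (OneSection.pullback IP j C.eta) := by
  intro s t p
  have hν : MDifferentiableAt IP (𝓡 m) (C.nu ∘ j) p :=
    (C.contMDiff_nu.comp hj).contMDiffAt.mdifferentiableAt (by simp)
  have hs (s : Cₛ^∞⟮𝓡 m; F, E⟯) : MDifferentiableAt (𝓡 m) 𝓘(ℝ, ℝ) (fun y => A.one y (s y))
      ((C.nu ∘ j) p) :=
    (A.one_smooth.comp s.contMDiff).contMDiffAt.mdifferentiableAt (by simp)
  have key (s t : ProjSection IP A.toLieAlgebroid (C.nu ∘ j)) :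
      s.act (fun q => OneSection.pullback IP j C.eta q (t.val q)) p =
      derivAlong (𝓡 m) ((C.nu ∘ j) p) (A.anchor ((C.nu ∘ j) p) (s.sec ((C.nu ∘ j) p)))
        (fun y => A.one y (t.sec y)) := by
    rw [s.related p]
    exact tderiv_comp (hs t.sec) hν (s.vf p)
  rw [key, key]
  exact A.one_cocycle s.sec t.sec ((C.nu ∘ j) p)

theorem isCanonicalPullback_Omega [FiniteDimensional ℝ F] :
    IsCanonicalPullback (modelW₀ m k F) A.toLieAlgebroid C.pr₁ C.Omega :=
  isCanonicalPullback_pullback A.toLieAlgebroid C.contMDiff_pr₁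

/-- Since H vanishes along `j`, its derivative vanishes on all vectors in the image of the
differential of `j`. The term dH ∧ η drops out and only the pullback of the canonical section
remains. -/
theorem isCanonicalPullback_pullback_OmegaW₀ [FiniteDimensional ℝ F] {L : TotalSpace F E → ℝ}
    (hL : ContMDiffOn ((𝓡 m).prod 𝓘(ℝ, F)) 𝓘(ℝ, ℝ) ∞ L A.affineBundle) {j : P → C.W₀}
    (hj : ContMDiff IP (modelW₀ m k F) ∞ j) (hH : ∀ p, C.hamiltonian L (j p) = 0) :
    IsCanonicalPullback IP A.toLieAlgebroid (C.pr₁ ∘ j)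
      (TwoSection.pullback IP j (C.OmegaW₀ L)) := by
  intro p σ₁ σ₂ X₁ X₂ h₁ h₂
  have hjp : MDifferentiableAt IP (modelW₀ m k F) j p := hj.contMDiffAt.mdifferentiableAt (by simp)
  have hν : MDifferentiableAt (modelW₀ m k F) (𝓡 m) C.nu (j p) :=
    C.contMDiff_nu.contMDiffAt.mdifferentiableAt (by simp)
  have hz (X : TangentSpace IP p) : derivAlong (modelW₀ m k F) (j p)
      (mfderiv IP (modelW₀ m k F) j p X) (C.hamiltonian L) = 0 := by
    refine (tderiv_comp ((C.contMDiff_hamiltonian hL).contMDiffAt.mdifferentiableAt (by simp))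
      hjp X).symm.trans ?_
    rw [tderiv_congr (f := C.hamiltonian L ∘ j) (g := fun _ => 0) (Filter.Eventually.of_forall hH), tderiv_const]
  have hps (σ : Cₛ^∞⟮𝓡 m; F, E⟯) : MDifferentiableAt (modelW₀ m k F) 𝓘(ℝ, ℝ)
      (pairSec σ ∘ C.pr₁) (j p) :=
    ((contMDiff_pairSec σ).comp C.contMDiff_pr₁).contMDiffAt.mdifferentiableAt (by simp)
  have hcomp (X : TangentSpace IP p) : mfderiv IP (𝓡 m) (TotalSpace.proj ∘ C.pr₁ ∘ j) p X =
      mfderiv (modelW₀ m k F) (𝓡 m) C.nu (j p) (mfderiv IP (modelW₀ m k F) j p X) :=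
    mfderiv_comp_apply p hν hjp X
  have := C.isCanonicalPullback_Omega (j p) σ₁ σ₂ (mfderiv IP (modelW₀ m k F) j p X₁)
    (mfderiv IP (modelW₀ m k F) j p X₂) (h₁.trans (hcomp X₁)) (h₂.trans (hcomp X₂))
  change C.Omega (j p) _ _ + (_ * _ - _ * _) = _
  rw [hz, hz, zero_mul, zero_mul, sub_zero, add_zero]
  refine this.trans ?_
  rw [← tderiv_comp (hps _) hjp, ← tderiv_comp (hps _) hjp]
  rfl

end ConstraintSubmanifold

end Vakonomic

namespace Vakonomic

/-! ### Linear algebra of η ∧ Θⁿ: vanishing on a kernel, nonvanishing on a Darboux basis. -/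

section WedgePow

variable {V : Type*} [AddCommGroup V] [Module ℝ V]

/-- Each slot occurs in exactly one factor of the product, slot `0` in `η` and a slot `i > 0` in the
factor of index `(i - 1) / 2`; the other factors are constants. The parity of `i` decides which
argument of `Θ` it is. -/
theorem exists_linear_wedge_update (n : ℕ) (η : V →ₗ[ℝ] ℝ) (Θ : V →ₗ[ℝ] V →ₗ[ℝ] ℝ)
    [DecidableEq (Fin (2 * n + 1))] (v : Fin (2 * n + 1) → V) (i : Fin (2 * n + 1)) :
    ∃ g : V →ₗ[ℝ] ℝ, ∀ x, η (Function.update v i x 0) * ∏ l : Fin n,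
      Θ (Function.update v i x ⟨2 * l.1 + 1, by omega⟩)
        (Function.update v i x ⟨2 * l.1 + 2, by omega⟩) = g x := by
  rcases Nat.eq_zero_or_pos i.1 with hi | hi
  · obtain rfl : i = 0 := Fin.ext hi
    refine ⟨(∏ l : Fin n, Θ (v ⟨2 * l.1 + 1, by omega⟩) (v ⟨2 * l.1 + 2, by omega⟩)) • η,
      fun x => ?_⟩
    simp [mul_comm]
  · have h0 (x : V) : Function.update v i x 0 = v 0 :=
      Function.update_of_ne (fun h => by simp [← h] at hi) _ _
    have hq : (i.1 - 1) / 2 < n := by omega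
    have hne (x : V) (l : Fin n) (hl : l ∈ ({⟨(i.1 - 1) / 2, hq⟩} : Finset (Fin n))ᶜ) :
        Θ (Function.update v i x ⟨2 * l.1 + 1, by omega⟩)
          (Function.update v i x ⟨2 * l.1 + 2, by omega⟩) =
        Θ (v ⟨2 * l.1 + 1, by omega⟩) (v ⟨2 * l.1 + 2, by omega⟩) := by
      have hl' : l.1 ≠ (i.1 - 1) / 2 := fun h => by simp [← h] at hl
      rw [Function.update_of_ne (fun h => hl' (by rw [← h]; simp)),
        Function.update_of_ne (fun h => hl' (by rw [← h]; simp; omega))]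
    simp only [h0, Fintype.prod_eq_mul_prod_compl (⟨(i.1 - 1) / 2, hq⟩ : Fin n)]
    set c := ∏ l ∈ ({⟨(i.1 - 1) / 2, hq⟩} : Finset (Fin n))ᶜ,
      Θ (v ⟨2 * l.1 + 1, by omega⟩) (v ⟨2 * l.1 + 2, by omega⟩)
    rcases Nat.even_or_odd i.1 with he | ho
    · have e1 : i = ⟨2 * ((i.1 - 1) / 2) + 2, by omega⟩ := Fin.ext (by
        obtain ⟨r, hr⟩ := he; simp; omega)
      have e2 : i ≠ ⟨2 * ((i.1 - 1) / 2) + 1, by omega⟩ := fun h => by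
        obtain ⟨r, hr⟩ := he; have := congrArg Fin.val h; simp at this; omega
      have u (x : V) : Function.update v i x ⟨2 * ((i.1 - 1) / 2) + 2, by omega⟩ = x := by
        conv_lhs => enter [4]; rw [← e1]
        simp
      refine ⟨(η (v 0) * c) • Θ (v ⟨2 * ((i.1 - 1) / 2) + 1, by omega⟩), fun x => ?_⟩
      rw [Finset.prod_congr rfl (hne x)]
      simp only [u, Function.update_of_ne e2.symm, LinearMap.smul_apply, smul_eq_mul]
      ring
    · have e1 : i = ⟨2 * ((i.1 - 1) / 2) + 1, by omega⟩ := Fin.ext (by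
        obtain ⟨r, hr⟩ := ho; simp; omega)
      have e2 : i ≠ ⟨2 * ((i.1 - 1) / 2) + 2, by omega⟩ := fun h => by
        obtain ⟨r, hr⟩ := ho; have := congrArg Fin.val h; simp at this; omega
      have u (x : V) : Function.update v i x ⟨2 * ((i.1 - 1) / 2) + 1, by omega⟩ = x := by
        conv_lhs => enter [4]; rw [← e1]
        simp
      refine ⟨(η (v 0) * c) • Θ.flip (v ⟨2 * ((i.1 - 1) / 2) + 2, by omega⟩), fun x => ?_⟩
      rw [Finset.prod_congr rfl (hne x)]
      simp only [u, Function.update_of_ne e2.symm, LinearMap.smul_apply, smul_eq_mul,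
        LinearMap.flip_apply]
      ring

/-- The multilinear map whose alternatization is `η ∧ Θ ∧ ⋯ ∧ Θ`. -/
def wedgeMultilinear (n : ℕ) (η : V →ₗ[ℝ] ℝ) (Θ : V →ₗ[ℝ] V →ₗ[ℝ] ℝ) :
    MultilinearMap ℝ (fun _ : Fin (2 * n + 1) => V) ℝ where
  toFun v := η (v 0) * ∏ i : Fin n, Θ (v ⟨2 * i.1 + 1, by omega⟩) (v ⟨2 * i.1 + 2, by omega⟩)
  map_update_add' v i x y := by
    obtain ⟨g, hg⟩ := exists_linear_wedge_update n η Θ v i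
    rw [hg, hg, hg, map_add]
  map_update_smul' v i c x := by
    obtain ⟨g, hg⟩ := exists_linear_wedge_update n η Θ v i
    rw [hg, hg, map_smul]

theorem wedgePow_eq_alternatization (n : ℕ) (η : V →ₗ[ℝ] ℝ) (Θ : V →ₗ[ℝ] V →ₗ[ℝ] ℝ)
    (v : Fin (2 * n + 1) → V) :
    wedgePow n η (fun x y => Θ x y) v = (wedgeMultilinear n η Θ).alternatization v := by
  rw [MultilinearMap.alternatization_apply]
  refine Finset.sum_congr rfl fun σ _ => ?_
  simp [wedgeMultilinear, Units.smul_def]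

/-- Exchange argument: if `f v ≠ 0`, then `v` is a basis by the dimension bound, `Z` has a nonzero
coordinate along some `v i`, and replacing `v i` by `Z` multiplies `f v` by that coordinate. -/
theorem alternating_eq_zero_of_forall_eq_zero {ι : Type*} [Fintype ι] [DecidableEq ι]
    [FiniteDimensional ℝ V] (hV : finrank ℝ V ≤ Fintype.card ι)
    (f : V [⋀^ι]→ₗ[ℝ] ℝ) {Z : V} (hZ : Z ≠ 0)
    (hf : ∀ v i, v i = Z → f v = 0) (v : ι → V) : f v = 0 := by
  by_contra h
  have hli : LinearIndependent ℝ v := by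
    by_contra hld
    exact h (f.map_linearDependent v hld)
  have hsp := hli.span_eq_top_of_card_eq_finrank'
    (le_antisymm hli.fintype_card_le_finrank hV)
  obtain ⟨c, hc⟩ := (Submodule.mem_span_range_iff_exists_fun ℝ).1
    (hsp ▸ Submodule.mem_top : Z ∈ Submodule.span ℝ (Set.range v))
  obtain ⟨i, hi⟩ : ∃ i, c i ≠ 0 := by
    by_contra! h0
    exact hZ (by simp [← hc, h0])
  have h1 : f (Function.update v i Z) = 0 := hf _ i (by simp)
  rw [← hc, ← AlternatingMap.coe_multilinearMap, MultilinearMap.map_update_sum,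
    Finset.sum_eq_single i] at h1
  · simp only [MultilinearMap.map_update_smul] at h1
    simp [hi, h] at h1
  · intro l _ hl
    rw [MultilinearMap.map_update_smul, AlternatingMap.coe_multilinearMap,
      f.map_update_self v hl.symm, smul_zero]
  · simp

/-- As soon as `Z` is among the arguments, every summand contains it in the slot of `η` or in a slot
of some `Θ`, hence vanishes; in top degree this forces the whole form to vanish. -/
theorem wedgePow_eq_zero [FiniteDimensional ℝ V] {n : ℕ} (hV : finrank ℝ V ≤ 2 * n + 1)
    (η : V →ₗ[ℝ] ℝ) (Θ : V →ₗ[ℝ] V →ₗ[ℝ] ℝ) {Z : V} (hZ : Z ≠ 0) (hη : η Z = 0)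
    (hl : ∀ z, Θ Z z = 0) (hr : ∀ z, Θ z Z = 0) (v : Fin (2 * n + 1) → V) :
    wedgePow n η (fun x y => Θ x y) v = 0 := by
  rw [wedgePow_eq_alternatization]
  refine alternating_eq_zero_of_forall_eq_zero (by simpa using hV) _ hZ (fun v i hi => ?_) v
  rw [← wedgePow_eq_alternatization]
  refine Finset.sum_eq_zero fun σ _ => ?_
  obtain ⟨l, rfl⟩ := σ.surjective i
  rw [mul_eq_zero]; right
  rw [mul_eq_zero]
  rcases Nat.eq_zero_or_pos l.1 with h0 | h0
  · obtain rfl : l = 0 := Fin.ext h0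
    left; rw [hi, hη]
  · right
    have hq : (l.1 - 1) / 2 < n := by omega
    refine Finset.prod_eq_zero (Finset.mem_univ (⟨(l.1 - 1) / 2, hq⟩ : Fin n)) ?_
    rcases Nat.even_or_odd l.1 with he | ho
    · have e1 : (⟨2 * ((l.1 - 1) / 2) + 2, by omega⟩ : Fin (2 * n + 1)) = l := Fin.ext (by
        obtain ⟨r, hr⟩ := he; simp; omega)
      simp only [e1, hi, hr]
    · have e1 : (⟨2 * ((l.1 - 1) / 2) + 1, by omega⟩ : Fin (2 * n + 1)) = l := Fin.ext (by
        obtain ⟨r, hr⟩ := ho; simp; omega)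
      simp only [e1, hi, hl]

/-- The standard symplectic pairing of the index set `Fin n × Bool`. -/
def stdPairing {n : ℕ} (x y : Fin n × Bool) : ℝ :=
  if x.1 = y.1 then (if x.2 = y.2 then 0 else if x.2 = false then 1 else -1) else 0

/-- A nonzero product forces `ρ` to send pairs to pairs, so it is a permutation of the pairs after
swaps inside them. The permutation of pairs acts on both members and has even sign, so the sign of
`ρ` and the product are both the product of the signs of the swaps. -/
theorem stdPairing_sign_nonneg {n : ℕ} (ρ : Equiv.Perm (Fin n × Bool)) :
    0 ≤ ((Equiv.Perm.sign ρ : ℤ) : ℝ) * ∏ i, stdPairing (ρ (i, false)) (ρ (i, true)) := by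
  by_cases hp : ∏ i, stdPairing (ρ (i, false)) (ρ (i, true)) = 0
  · simp [hp]
  have h1 (i) : (ρ (i, false)).1 = (ρ (i, true)).1 ∧ (ρ (i, false)).2 ≠ (ρ (i, true)).2 := by
    have := (Finset.prod_ne_zero_iff.1 hp) i (Finset.mem_univ i)
    simp only [stdPairing] at this
    split_ifs at this with a b <;> simp_all
  have hinj : Function.Injective fun i => (ρ (i, false)).1 := by
    intro i i' hii
    by_contra hne
    have h2 := h1 i
    have h3 := h1 i'
    have e : ρ (i', false) = ρ (i, false) ∨ ρ (i', false) = ρ (i, true) := by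
      rcases h : (ρ (i', false)).2 == (ρ (i, false)).2
      · right
        refine Prod.ext ?_ ?_
        · rw [← h2.1]; exact hii.symm
        · have : (ρ (i', false)).2 ≠ (ρ (i, false)).2 := by simpa using h
          revert this
          have := h2.2
          revert this
          cases (ρ (i', false)).2 <;> cases (ρ (i, false)).2 <;> cases (ρ (i, true)).2 <;> simp
      · left
        exact Prod.ext hii.symm (by simpa using h)
    rcases e with e | e
    · exact hne (congrArg Prod.fst (ρ.injective e)).symm
    · exact hne (congrArg Prod.fst (ρ.injective e)).symm
  let T : Equiv.Perm (Fin n) := Equiv.ofBijective _ (Finite.injective_iff_bijective.1 hinj)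
  let g : Fin n → Equiv.Perm Bool := fun i =>
    if (ρ (i, false)).2 = false then 1 else Equiv.swap false true
  have hρ : ρ = Equiv.prodCongrLeft (fun _ => T) * Equiv.prodCongrRight g := by
    ext1 ⟨i, b⟩
    have h2 := h1 i
    have hT : T i = (ρ (i, false)).1 := rfl
    simp only [Equiv.Perm.coe_mul, Function.comp_apply, Equiv.prodCongrRight_apply,
      Equiv.prodCongrLeft_apply, hT, g]
    refine Prod.ext ?_ ?_
    · cases b
      · rfl
      · exact h2.1.symm
    · rcases hb : (ρ (i, false)).2 <;> rcases hb' : (ρ (i, true)).2 <;> cases b <;> simp_all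
  have hprod : ∏ i, stdPairing (ρ (i, false)) (ρ (i, true)) =
      ∏ i, ((Equiv.Perm.sign (g i) : ℤ) : ℝ) := by
    refine Finset.prod_congr rfl fun i _ => ?_
    have h2 := h1 i
    simp only [stdPairing, if_pos h2.1, if_neg h2.2, g]
    split_ifs <;> simp
  have hs : Equiv.Perm.sign ρ = ∏ i, Equiv.Perm.sign (g i) := by
    conv_lhs => rw [hρ]
    rw [Equiv.Perm.sign_mul, Equiv.Perm.sign_prodCongrLeft, Equiv.Perm.sign_prodCongrRight]
    simp
  rw [hprod, hs]
  push_cast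
  exact mul_self_nonneg _

/-- The indices of `η ∧ Θ ∧ ⋯ ∧ Θ`: one for `η` and a pair for each `Θ`. -/
def wedgeIndex (n : ℕ) : Fin (2 * n + 1) ≃ Option (Fin n × Bool) where
  toFun x := if h : x.1 = 0 then none else
    some (⟨(x.1 - 1) / 2, by omega⟩, decide ((x.1 - 1) % 2 = 1))
  invFun o := match o with
    | none => 0
    | some (i, false) => ⟨2 * i.1 + 1, by omega⟩
    | some (i, true) => ⟨2 * i.1 + 2, by omega⟩
  left_inv := by
    intro x
    by_cases h : x.1 = 0
    · simp [h, Fin.ext_iff]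
    · rcases Nat.mod_two_eq_zero_or_one (x.1 - 1) with h2 | h2
      · simp only [h, dite_false, h2, Fin.ext_iff]; simp; omega
      · simp only [h, dite_false, h2, Fin.ext_iff]; simp; omega
  right_inv := by
    rintro (_ | ⟨i, _ | _⟩)
    · simp
    · simp
    · simp [Fin.ext_iff]; omega

/-- `η ∧ Θ ∧ ⋯ ∧ Θ` does not vanish on a Darboux basis. -/
theorem wedgePow_ne_zero_of_darboux {W : Type*} {n : ℕ} (η : W → ℝ) (Θ : W → W → ℝ)
    (v : Option (Fin n × Bool) → W) (h0 : η (v none) = 1) (h1 : ∀ x, η (v (some x)) = 0)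
    (h2 : ∀ x y, Θ (v (some x)) (v (some y)) = stdPairing x y) :
    wedgePow n η Θ (v ∘ wedgeIndex n) ≠ 0 := by
  have e0 : (wedgeIndex n).symm none = 0 := rfl
  have ef (i : Fin n) : (wedgeIndex n).symm (some (i, false)) = ⟨2 * i.1 + 1, by omega⟩ := rfl
  have et (i : Fin n) : (wedgeIndex n).symm (some (i, true)) = ⟨2 * i.1 + 2, by omega⟩ := rfl
  refine ne_of_gt (Finset.sum_pos' (fun σ _ => ?_) ⟨1, Finset.mem_univ _, ?_⟩)
  · set σ' : Equiv.Perm (Option (Fin n × Bool)) := (wedgeIndex n).permCongr σ with hσ'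
    have hs : Equiv.Perm.sign σ = Equiv.Perm.sign σ' := (Equiv.Perm.sign_permCongr _ _).symm
    have happ (o) : wedgeIndex n (σ ((wedgeIndex n).symm o)) = σ' o := by simp [hσ']
    simp only [← e0, ← ef, ← et, Function.comp_apply, happ, hs]
    -- A summand survives only if the vector fed to `η` is the one at `none`; then the rest permutes
    -- the Darboux pairs. All summands are nonnegative, so the positive identity term cannot be
    -- cancelled.
    by_cases hn : σ' none = none
    · set ρ := Equiv.removeNone σ' with hρ
      have hσρ : σ' = ρ.optionCongr := by
        have := map_equiv_removeNone σ'
        rw [hn, Equiv.swap_self] at this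
        rw [hρ, this]; rfl
      have hsome (x) : σ' (some x) = some (ρ x) := by rw [hσρ]; rfl
      rw [hn, h0, one_mul, hσρ, Equiv.optionCongr_sign, ← hσρ]
      simp only [hsome, h2]
      exact stdPairing_sign_nonneg ρ
    · obtain ⟨x, hx⟩ := Option.ne_none_iff_exists'.1 hn
      rw [hx, h1]; simp
  · simp only [← e0, ← ef, ← et, Function.comp_apply, Equiv.Perm.coe_one, id,
      Equiv.apply_symm_apply, h0, h2]
    simp [stdPairing]

/-- `η ∧ Θ ∧ ⋯ ∧ Θ` is nonzero as soon as the kernel of `η` contains `n` vectors which are paired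
by `Θ` with the vectors of an isotropic family. -/
theorem exists_wedgePow_ne_zero {n : ℕ} (η : V →ₗ[ℝ] ℝ) (Θ : V →ₗ[ℝ] V →ₗ[ℝ] ℝ)
    (hskew : ∀ x y, Θ x y = - Θ y x) {ξ : V} {e f : Fin n → V} (hξ : η ξ = 1)
    (he : ∀ i, η (e i) = 0) (hf : ∀ i, η (f i) = 0)
    (hef : ∀ i l, Θ (e i) (f l) = if i = l then 1 else 0) (hff : ∀ i l, Θ (f i) (f l) = 0) :
    ∃ v : Fin (2 * n + 1) → V, wedgePow n η (fun x y => Θ x y) v ≠ 0 := by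
  have hfe (i l) : Θ (f l) (e i) = if i = l then -1 else 0 := by
    rw [hskew, hef]; split_ifs <;> simp
  -- The correction by half of `Θ (e i) (e l)` makes the `e'` isotropic: each of the two arguments
  -- contributes minus one half of the defect. The pairing with the isotropic `f` is unchanged.
  let e' : Fin n → V := fun i => e i + ∑ l, ((1 / 2 : ℝ) * Θ (e i) (e l)) • f l
  let v : Option (Fin n × Bool) → V := fun o => o.elim ξ fun x => if x.2 then f x.1 else e' x.1
  refine ⟨v ∘ wedgeIndex n, wedgePow_ne_zero_of_darboux η _ v hξ ?_ ?_⟩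
  · rintro ⟨i, _ | _⟩ <;> simp [v, e', he, hf]
  · rintro ⟨i, _ | _⟩ ⟨l, _ | _⟩
    · simp [v, e', stdPairing, hff, hef, hfe]
      rw [hskew (e l) (e i)]; ring
    · simp [v, e', stdPairing, hff, hef]
    · simp [v, e', stdPairing, hff, hfe, eq_comm (a := i)]
    · simp [v, stdPairing, hff]

end WedgePow

end Vakonomic

namespace Vakonomic

/-! ### Pulled back canonical sections as skew bilinear forms; vertical vectors. -/

section CanonicalPullback

variable {m : ℕ}
  {Q : Type*} [TopologicalSpace Q] [T2Space Q]
  [ChartedSpace (EuclideanSpace ℝ (Fin m)) Q] [IsManifold (𝓡 m) ∞ Q]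
  {F : Type*} [NormedAddCommGroup F] [NormedSpace ℝ F] [FiniteDimensional ℝ F]
  {E : Q → Type*} [TopologicalSpace (TotalSpace F E)]
  [∀ x, AddCommGroup (E x)] [∀ x, Module ℝ (E x)] [∀ x, TopologicalSpace (E x)]
  [∀ x, IsTopologicalAddGroup (E x)] [∀ x, ContinuousSMul ℝ (E x)]
  [FiberBundle F E] [VectorBundle ℝ F E] [ContMDiffVectorBundle ∞ F E (𝓡 m)]
  {EP : Type*} [NormedAddCommGroup EP] [NormedSpace ℝ EP]
  {HP : Type*} [TopologicalSpace HP] {IP : ModelWithCorners ℝ EP HP}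
  {P : Type*} [TopologicalSpace P] [ChartedSpace HP P]

variable (F E) in
/-- The fibres of a vector bundle are isomorphic to the model fibre. -/
def fiberEquiv (x : Q) : E x ≃ₗ[ℝ] F :=
  ((trivializationAt F E x).linearEquivAt ℝ x (FiberBundle.mem_baseSet_trivializationAt F E x))

variable (F E) in
theorem finrank_fiber (x : Q) : finrank ℝ (E x) = finrank ℝ F :=
  (fiberEquiv F E x).finrank_eq

variable (F) in
/-- A linear functional on a fibre is continuous. -/
def fiberFunctional {x : Q} (β : E x →ₗ[ℝ] ℝ) : E x →L[ℝ] ℝ where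
  toLinearMap := β
  cont := by
    have hx := FiberBundle.mem_baseSet_trivializationAt F E x
    have h1 : Continuous ((β ∘ₗ (fiberEquiv F E x).symm.toLinearMap).toContinuousLinearMap.comp
      ((trivializationAt F E x).continuousLinearMapAt ℝ x)) := ContinuousLinearMap.continuous _
    refine h1.congr fun v => ?_
    change β ((fiberEquiv F E x).symm ((trivializationAt F E x).continuousLinearMapAt ℝ x v)) = β v
    rw [Trivialization.continuousLinearMapAt_apply, Trivialization.coe_linearMapAt_of_mem _ hx]
    exact congrArg β ((fiberEquiv F E x).symm_apply_apply v)

theorem pairSec_add (σ σ' : Cₛ^∞⟮𝓡 m; F, E⟯) (φ : DualTotal F E) :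
    pairSec (σ + σ') φ = pairSec σ φ + pairSec σ' φ := by simp [pairSec]

theorem pairSec_smul (c : ℝ) (σ : Cₛ^∞⟮𝓡 m; F, E⟯) (φ : DualTotal F E) :
    pairSec (c • σ) φ = c * pairSec σ φ := by simp [pairSec]

theorem bracket_smul_left (A : LieAlgebroid m F E) (c : ℝ) (σ τ : Cₛ^∞⟮𝓡 m; F, E⟯) :
    A.bracket (c • σ) τ = c • A.bracket σ τ := by
  rw [A.bracket_skew, A.bracket_smul, A.bracket_skew τ σ, smul_neg, neg_neg]

theorem bracket_zero_right (A : LieAlgebroid m F E) (σ : Cₛ^∞⟮𝓡 m; F, E⟯) :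
    A.bracket σ 0 = 0 := by
  have := A.bracket_smul 0 σ 0
  rwa [zero_smul, zero_smul] at this

theorem mdifferentiableAt_pairSec_comp {Φ : P → DualTotal F E} {p : P}
    (hΦ : MDifferentiableAt IP (dualModel m F) Φ p) (σ : Cₛ^∞⟮𝓡 m; F, E⟯) :
    MDifferentiableAt IP 𝓘(ℝ, ℝ) (pairSec σ ∘ Φ) p :=
  (mdifferentiableAt_pairSec σ (Φ p)).comp p hΦ

theorem tderiv_pairSec_comp_add {Φ : P → DualTotal F E} {p : P}
    (hΦ : MDifferentiableAt IP (dualModel m F) Φ p) (σ σ' : Cₛ^∞⟮𝓡 m; F, E⟯)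
    (X : TangentSpace IP p) :
    tderiv IP (pairSec (σ + σ') ∘ Φ) p X =
      tderiv IP (pairSec σ ∘ Φ) p X + tderiv IP (pairSec σ' ∘ Φ) p X := by
  rw [← tderiv_add (mdifferentiableAt_pairSec_comp hΦ σ) (mdifferentiableAt_pairSec_comp hΦ σ')]
  congr 1
  ext q
  exact pairSec_add _ _ _

theorem tderiv_pairSec_comp_smul {Φ : P → DualTotal F E} {p : P}
    (hΦ : MDifferentiableAt IP (dualModel m F) Φ p) (c : ℝ) (σ : Cₛ^∞⟮𝓡 m; F, E⟯)
    (X : TangentSpace IP p) :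
    tderiv IP (pairSec (c • σ) ∘ Φ) p X = c * tderiv IP (pairSec σ ∘ Φ) p X := by
  have h : pairSec (c • σ) ∘ Φ = fun q => (fun _ => c) q * (pairSec σ ∘ Φ) q := by
    ext q
    exact pairSec_smul _ _ _
  rw [h, tderiv_mul mdifferentiableAt_const (mdifferentiableAt_pairSec_comp hΦ σ), tderiv_const]
  simp

/-- On the prolongation, the pullback of the canonical section is a skew bilinear form. -/
theorem IsCanonicalPullback.exists_bilinear {A : LieAlgebroid m F E} {Φ : P → DualTotal F E}
    {Θ : TwoSection (E := E) IP (TotalSpace.proj ∘ Φ)} (hΘ : IsCanonicalPullback IP A Φ Θ) {p : P}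
    (hΦ : MDifferentiableAt IP (dualModel m F) Φ p) :
    ∃ B : prolongFiber IP A (TotalSpace.proj ∘ Φ) p →ₗ[ℝ]
        prolongFiber IP A (TotalSpace.proj ∘ Φ) p →ₗ[ℝ] ℝ,
      (∀ z z', B z z' = Θ p z z') ∧ ∀ z z', B z z' = - B z' z := by
  have hskew (z z' : prolongFiber IP A (TotalSpace.proj ∘ Φ) p) :
      Θ p z z' = - Θ p z' z := by
    obtain ⟨⟨e, X⟩, hz⟩ := z
    obtain ⟨⟨e', X'⟩, hz'⟩ := z'
    obtain ⟨σ, rfl⟩ := exists_section_through m F e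
    obtain ⟨σ', rfl⟩ := exists_section_through m F e'
    refine (hΘ p σ σ' X X' hz hz').trans (Eq.trans ?_ (congrArg Neg.neg (hΘ p σ' σ X' X hz' hz).symm))
    rw [A.bracket_skew σ σ']
    simp only [ContMDiffSection.coe_neg, Pi.neg_apply, map_neg]
    ring
  have hadd (z₁ z₂ z' : prolongFiber IP A (TotalSpace.proj ∘ Φ) p) :
      Θ p (z₁ + z₂ : prolongFiber IP A (TotalSpace.proj ∘ Φ) p) z' = Θ p z₁ z' + Θ p z₂ z' := by
    obtain ⟨⟨e₁, X₁⟩, hz₁⟩ := z₁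
    obtain ⟨⟨e₂, X₂⟩, hz₂⟩ := z₂
    obtain ⟨⟨e', X'⟩, hz'⟩ := z'
    obtain ⟨σ₁, rfl⟩ := exists_section_through m F e₁
    obtain ⟨σ₂, rfl⟩ := exists_section_through m F e₂
    obtain ⟨σ', rfl⟩ := exists_section_through m F e'
    have h := hΘ p (σ₁ + σ₂) σ' (X₁ + X₂) X'
      ((prolongFiber IP A (TotalSpace.proj ∘ Φ) p).add_mem hz₁ hz₂) hz'
    have h1 := hΘ p σ₁ σ' X₁ X' hz₁ hz'
    have h2 := hΘ p σ₂ σ' X₂ X' hz₂ hz'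
    rw [tderiv_pairSec_comp_add hΦ, tderiv_add_right, bracket_add_left] at h
    refine (h.trans ?_).trans (congrArg₂ (· + ·) h1 h2).symm
    simp only [ContMDiffSection.coe_add, Pi.add_apply, map_add]
    ring
  have hsmul (c : ℝ) (z z' : prolongFiber IP A (TotalSpace.proj ∘ Φ) p) :
      Θ p (c • z : prolongFiber IP A (TotalSpace.proj ∘ Φ) p) z' = c • Θ p z z' := by
    obtain ⟨⟨e, X⟩, hz⟩ := z
    obtain ⟨⟨e', X'⟩, hz'⟩ := z'
    obtain ⟨σ, rfl⟩ := exists_section_through m F e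
    obtain ⟨σ', rfl⟩ := exists_section_through m F e'
    have h := hΘ p (c • σ) σ' (c • X) X'
      ((prolongFiber IP A (TotalSpace.proj ∘ Φ) p).smul_mem c hz) hz'
    have h1 := hΘ p σ σ' X X' hz hz'
    rw [tderiv_pairSec_comp_smul hΦ, tderiv_smul_right, bracket_smul_left] at h
    refine (h.trans ?_).trans (congrArg (c • ·) h1).symm
    simp only [ContMDiffSection.coe_smul, Pi.smul_apply, map_smul, smul_eq_mul]
    ring
  refine ⟨LinearMap.mk₂ ℝ (fun z z' => Θ p z z') hadd hsmul (fun z z₁ z₂ => ?_)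
    (fun c z z' => ?_), fun _ _ => rfl, hskew⟩
  · rw [hskew, hadd, hskew z z₁, hskew z z₂, neg_add]
  · rw [hskew, hsmul, hskew z z', smul_neg]

/-- The canonical section against a vertical vector. -/
theorem IsCanonicalPullback.apply_vertical {A : LieAlgebroid m F E} {Φ : P → DualTotal F E}
    {Θ : TwoSection (E := E) IP (TotalSpace.proj ∘ Φ)} (hΘ : IsCanonicalPullback IP A Φ Θ) {p : P}
    {σ : Cₛ^∞⟮𝓡 m; F, E⟯} {Y X : TangentSpace IP p}
    (hY : A.anchor (Φ p).1 (σ (Φ p).1) = mfderiv IP (𝓡 m) (TotalSpace.proj ∘ Φ) p Y)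
    (hX : mfderiv IP (𝓡 m) (TotalSpace.proj ∘ Φ) p X = 0) :
    Θ p (σ (Φ p).1, Y) (0, X) = tderiv IP (pairSec σ ∘ Φ) p X := by
  have h := hΘ p σ 0 Y X hY ((map_zero _).trans hX.symm)
  rw [bracket_zero_right] at h
  have h0 : pairSec (0 : Cₛ^∞⟮𝓡 m; F, E⟯) ∘ Φ = fun _ => (0 : ℝ) := by
    ext q
    exact map_zero _
  rw [h0, tderiv_const] at h
  refine h.trans ?_
  have : (Φ p).2 ((0 : Cₛ^∞⟮𝓡 m; F, E⟯) (Φ p).1) = 0 := map_zero _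
  rw [this]; ring

/-- The derivative of the pairing with a section along a vertical vector, in a local frame. -/
theorem tderiv_pairSec_eq_sum {Φ : P → DualTotal F E} {p : P}
    (hΦ : ContMDiffAt IP (dualModel m F) ∞ Φ p) {ι : Type*} [Fintype ι]
    {s : ι → (x : Q) → E x} {u : Set Q} (hs : IsLocalFrameOn (𝓡 m) F ∞ s u) (hu : IsOpen u)
    (hp : (Φ p).1 ∈ u) (σ : Cₛ^∞⟮𝓡 m; F, E⟯) {X : TangentSpace IP p}
    (hX : mfderiv IP (𝓡 m) (TotalSpace.proj ∘ Φ) p X = 0) :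
    tderiv IP (pairSec σ ∘ Φ) p X =
      ∑ i, hs.coeff i (Φ p).1 (σ (Φ p).1) *
        tderiv IP (fun q => (Φ q).2 (s i (Φ q).1)) p X := by
  have hν : ContMDiffAt IP (𝓡 m) ∞ (TotalSpace.proj ∘ Φ) p :=
    (contMDiff_proj (fun x => E x →L[ℝ] ℝ)).contMDiffAt.comp p hΦ
  have hc (i) : ContMDiffAt (𝓡 m) 𝓘(ℝ, ℝ) ∞ (fun x => hs.coeff i x (σ x)) (Φ p).1 :=
    ContMDiffAt.comp (Φ p).1 (g := fun v : TotalSpace F E => hs.coeff i v.1 v.2)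
      (f := fun x => (⟨x, σ x⟩ : TotalSpace F E)) (hs.contMDiffAt_coeff hu hp i)
      σ.contMDiff.contMDiffAt
  have hc' (i) : MDifferentiableAt IP 𝓘(ℝ, ℝ)
      ((fun x => hs.coeff i x (σ x)) ∘ (TotalSpace.proj ∘ Φ)) p :=
    ((hc i).comp p hν).mdifferentiableAt (by simp)
  have hsec (i) : MDifferentiableAt IP 𝓘(ℝ, ℝ) (fun q => (Φ q).2 (s i (Φ q).1)) p :=
    (contMDiffAt_pairing (b := TotalSpace.proj ∘ Φ) (φ := fun q => (Φ q).2)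
      (v := fun q => s i (Φ q).1) hΦ
      (ContMDiffAt.comp p (g := fun x => (⟨x, s i x⟩ : TotalSpace F E))
        (f := TotalSpace.proj ∘ Φ)
        (hs.contMDiffAt hu hp i) hν)).mdifferentiableAt (by simp)
  -- The frame coefficients of `σ` are functions on `Q`, so a vertical vector does not differentiate
  -- them.
  have hd0 (i) : tderiv IP ((fun x => hs.coeff i x (σ x)) ∘ (TotalSpace.proj ∘ Φ)) p X = 0 := by
    rw [tderiv_comp (IQ := 𝓡 m) (f := fun x => hs.coeff i x (σ x)) (g := TotalSpace.proj ∘ Φ)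
      ((hc i).mdifferentiableAt (by simp)) (hν.mdifferentiableAt (by simp)), hX]
    exact tderiv_zero_right _ _
  have hev : pairSec σ ∘ Φ =ᶠ[𝓝 p] fun q => ∑ i,
      ((fun x => hs.coeff i x (σ x)) ∘ (TotalSpace.proj ∘ Φ)) q * (Φ q).2 (s i (Φ q).1) := by
    filter_upwards [hν.continuousAt.preimage_mem_nhds (hu.mem_nhds hp)] with q hq
    change (Φ q).2 (σ (Φ q).1) = _
    refine (congrArg (Φ q).2 (hs.coeff_sum_eq (fun x => σ x) hq)).trans ?_
    rw [map_sum]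
    refine Finset.sum_congr rfl fun i _ => ?_
    rw [map_smul]; rfl
  rw [tderiv_congr hev]
  have hsum : tderiv IP (fun q => ∑ i,
      ((fun x => hs.coeff i x (σ x)) ∘ (TotalSpace.proj ∘ Φ)) q * (Φ q).2 (s i (Φ q).1)) p X =
      ∑ i, tderiv IP (fun q =>
        ((fun x => hs.coeff i x (σ x)) ∘ (TotalSpace.proj ∘ Φ)) q * (Φ q).2 (s i (Φ q).1)) p X := by
    have : ∀ t : Finset ι, MDifferentiableAt IP 𝓘(ℝ, ℝ) (fun q => ∑ i ∈ t,
      ((fun x => hs.coeff i x (σ x)) ∘ (TotalSpace.proj ∘ Φ)) q * (Φ q).2 (s i (Φ q).1)) p ∧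
      tderiv IP (fun q => ∑ i ∈ t,
      ((fun x => hs.coeff i x (σ x)) ∘ (TotalSpace.proj ∘ Φ)) q * (Φ q).2 (s i (Φ q).1)) p X =
      ∑ i ∈ t, tderiv IP (fun q =>
        ((fun x => hs.coeff i x (σ x)) ∘ (TotalSpace.proj ∘ Φ)) q * (Φ q).2 (s i (Φ q).1)) p X := by
      classical
      intro t
      induction t using Finset.induction_on with
      | empty => exact ⟨by simpa using mdifferentiableAt_const, by simp [tderiv_const]⟩
      | insert a t ha ih =>
        have hm : MDifferentiableAt IP 𝓘(ℝ, ℝ) (fun q =>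
          ((fun x => hs.coeff a x (σ x)) ∘ (TotalSpace.proj ∘ Φ)) q * (Φ q).2 (s a (Φ q).1)) p :=
          (hc' a).mul (hsec a)
        simp only [Finset.sum_insert ha]
        exact ⟨hm.add ih.1, by rw [tderiv_add hm ih.1, ih.2]⟩
    exact (this Finset.univ).2
  rw [hsum]
  refine Finset.sum_congr rfl fun i _ => ?_
  rw [tderiv_mul (hc' i) (hsec i), hd0, zero_mul, zero_add]
  rfl

/-- A functional which vanishes on the radical of a skew form is represented by the form. -/
theorem exists_eq_of_radical {V : Type*} [AddCommGroup V] [Module ℝ V] [FiniteDimensional ℝ V]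
    (B : V →ₗ[ℝ] V →ₗ[ℝ] ℝ) (hB : ∀ x y, B x y = - B y x) (l : V →ₗ[ℝ] ℝ)
    (hl : ∀ x, (∀ y, B x y = 0) → l x = 0) : ∃ z, B z = l := by
  have h : l ∈ LinearMap.range B.dualMap := by
    rw [LinearMap.range_dualMap_eq_dualAnnihilator_ker, Submodule.mem_dualAnnihilator]
    exact fun x hx => hl x fun y => by rw [LinearMap.mem_ker.1 hx]; rfl
  obtain ⟨f, hf⟩ := h
  obtain ⟨z, rfl⟩ := (Module.evalEquiv ℝ V).surjective f
  -- The annihilator argument represents `l` by `z` in the second slot of `B`; moving it to the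
  -- first slot costs a sign.
  refine ⟨-z, ?_⟩
  ext y
  rw [hB, map_neg, neg_neg, ← hf]
  rfl

end CanonicalPullback

end Vakonomic

namespace Vakonomic

/-! ### Intrinsic description of W₁ by stationarity of the Hamiltonian. -/

namespace ConstraintSubmanifold

variable {m k : ℕ}
  {Q : Type*} [TopologicalSpace Q] [T2Space Q]
  [ChartedSpace (EuclideanSpace ℝ (Fin m)) Q] [IsManifold (𝓡 m) ∞ Q]
  {F : Type*} [NormedAddCommGroup F] [NormedSpace ℝ F] [FiniteDimensional ℝ F]
  {E : Q → Type*} [TopologicalSpace (TotalSpace F E)]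
  [∀ x, AddCommGroup (E x)] [∀ x, Module ℝ (E x)] [∀ x, TopologicalSpace (E x)]
  [∀ x, IsTopologicalAddGroup (E x)] [∀ x, ContinuousSMul ℝ (E x)]
  [FiberBundle F E] [VectorBundle ℝ F E] [ContMDiffVectorBundle ∞ F E (𝓡 m)]
  {A : LieAffgebroid m F E} {M : Type*} [TopologicalSpace M]
  [ChartedSpace (EuclideanSpace ℝ (Fin (m + k))) M] [IsManifold (𝓡 (m + k)) ∞ M]
  (C : ConstraintSubmanifold A k M)

/-- A global section of the dual bundle through the covector lifts `ℳ` to a section of W₀ through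
`w`, along which the submersion of `ℳ` onto `Q` factors through `ν`. -/
theorem mfderiv_nu_surjective (w : C.W₀) :
    Function.Surjective (mfderiv (modelW₀ m k F) (𝓡 m) C.nu w) := by
  obtain ⟨ψ, hψ⟩ := exists_section_through m (F →L[ℝ] ℝ) (E := fun x : Q => E x →L[ℝ] ℝ)
    (C.covector w)
  let s : M → C.W₀ := fun a => ⟨a, ψ (C.proj a)⟩
  have hsw : s w.1 = w := by
    obtain ⟨a, φ⟩ := w
    exact congrArg (fun φ => (⟨a, φ⟩ : C.W₀)) hψ
  have hs : ContMDiffAt (𝓡 (m + k)) (modelW₀ m k F) ∞ s w.1 :=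
    C.contMDiffAt_W₀_iff.2 ⟨contMDiffAt_id, (ψ.contMDiff.comp C.proj.contMDiff).contMDiffAt⟩
  intro v
  obtain ⟨X, hX⟩ := (C.isSubmersion.isSubmersionAt w.1).mfderiv_surjective v
  have hn : MDifferentiableAt (modelW₀ m k F) (𝓡 m) C.nu (s w.1) :=
    C.contMDiff_nu.contMDiffAt.mdifferentiableAt (by simp)
  have h := mfderiv_comp_apply w.1 hn (hs.mdifferentiableAt (by simp)) X
  rw [hsw] at h
  exact ⟨_, h.symm.trans hX⟩

/-- The curve in `W₀` which moves the covector in a fixed direction. -/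
def covectorCurve (w : C.W₀) (β : E (C.nu w) →L[ℝ] ℝ) (t : ℝ) : C.W₀ :=
  ⟨w.1, C.covector w + t • β⟩

theorem contMDiffAt_covectorCurve (w : C.W₀) (β : E (C.nu w) →L[ℝ] ℝ) (t : ℝ) :
    ContMDiffAt 𝓘(ℝ, ℝ) (modelW₀ m k F) ∞ (C.covectorCurve w β) t := by
  refine C.contMDiffAt_W₀_iff.2 ⟨contMDiffAt_const, contMDiffAt_totalSpace.2
    ⟨contMDiffAt_const (c := C.nu w), ?_⟩⟩
  have hx := FiberBundle.mem_baseSet_trivializationAt (F →L[ℝ] ℝ)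
    (fun x : Q => E x →L[ℝ] ℝ) (C.nu w)
  set e := trivializationAt (F →L[ℝ] ℝ) (fun x : Q => E x →L[ℝ] ℝ) (C.nu w)
  have h (φ : E (C.nu w) →L[ℝ] ℝ) : (e ⟨C.nu w, φ⟩).2 = e.continuousLinearMapAt ℝ (C.nu w) φ := by
    rw [Trivialization.continuousLinearMapAt_apply, Trivialization.coe_linearMapAt_of_mem _ hx]
  change ContMDiffAt 𝓘(ℝ, ℝ) 𝓘(ℝ, F →L[ℝ] ℝ) ∞
    (fun t : ℝ => (e ⟨C.nu w, C.covector w + t • β⟩).2) t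
  simp only [h, map_add, map_smul]
  rw [contMDiffAt_iff_contDiffAt]
  fun_prop

/-- The vertical tangent vector of `W₀` in the direction of a covector. -/
def covectorVector (w : C.W₀) (β : E (C.nu w) →L[ℝ] ℝ) : TangentSpace (modelW₀ m k F) w :=
  mfderiv 𝓘(ℝ, ℝ) (modelW₀ m k F) (C.covectorCurve w β) 0 (1 : ℝ)

theorem covectorCurve_zero (w : C.W₀) (β : E (C.nu w) →L[ℝ] ℝ) : C.covectorCurve w β 0 = w := by
  obtain ⟨a, φ⟩ := w
  simp only [covectorCurve, zero_smul, add_zero]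
  rfl

theorem tderiv_covectorVector {G : Type*} [NormedAddCommGroup G] [NormedSpace ℝ G] {f : C.W₀ → G}
    {w : C.W₀} (hf : MDifferentiableAt (modelW₀ m k F) 𝓘(ℝ, G) f w) (β : E (C.nu w) →L[ℝ] ℝ) :
    tderiv (modelW₀ m k F) f w (C.covectorVector w β) =
      deriv (fun t => f (C.covectorCurve w β t)) 0 := by
  have hf' : MDifferentiableAt (modelW₀ m k F) 𝓘(ℝ, G) f (C.covectorCurve w β 0) := by
    rwa [C.covectorCurve_zero]
  have h := tderiv_comp hf' ((C.contMDiffAt_covectorCurve w β 0).mdifferentiableAt (by simp))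
    (1 : ℝ)
  rw [tderiv_eq_fderiv] at h
  have h2 : fderiv ℝ (f ∘ C.covectorCurve w β) 0 1 =
    deriv (fun t => f (C.covectorCurve w β t)) 0 := rfl
  rw [← h2, h, C.covectorCurve_zero]
  rfl

theorem mfderiv_nu_covectorVector (w : C.W₀) (β : E (C.nu w) →L[ℝ] ℝ) :
    mfderiv (modelW₀ m k F) (𝓡 m) C.nu w (C.covectorVector w β) = 0 := by
  have hf' : MDifferentiableAt (modelW₀ m k F) (𝓡 m) C.nu (C.covectorCurve w β 0) :=
    C.contMDiff_nu.contMDiffAt.mdifferentiableAt (by simp)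
  have h := mfderiv_comp_apply (0 : ℝ) hf'
    ((C.contMDiffAt_covectorCurve w β 0).mdifferentiableAt (by simp)) (1 : ℝ)
  have h2 : C.nu ∘ C.covectorCurve w β = fun _ => C.nu w := rfl
  rw [C.covectorCurve_zero, h2] at h
  refine h.symm.trans ?_
  have := DFunLike.congr_fun (mfderiv_const (I := 𝓘(ℝ, ℝ)) (I' := 𝓡 m) (x := (0 : ℝ))
    (c := C.nu w)) (1 : ℝ)
  exact this

theorem tderiv_pairSec_covectorVector (w : C.W₀) (β : E (C.nu w) →L[ℝ] ℝ)
    (σ : Cₛ^∞⟮𝓡 m; F, E⟯) :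
    tderiv (modelW₀ m k F) (pairSec σ ∘ C.pr₁) w (C.covectorVector w β) = β (σ (C.nu w)) := by
  rw [C.tderiv_covectorVector (mdifferentiableAt_pairSec_comp
    (C.contMDiff_pr₁.contMDiffAt.mdifferentiableAt (by simp)) σ)]
  have : (fun t => (pairSec σ ∘ C.pr₁) (C.covectorCurve w β t)) =
      fun t : ℝ => C.covector w (σ (C.nu w)) + t * β (σ (C.nu w)) := rfl
  rw [this]
  simp

theorem tderiv_hamiltonian_covectorVector {L : TotalSpace F E → ℝ}
    (hL : ContMDiffOn ((𝓡 m).prod 𝓘(ℝ, F)) 𝓘(ℝ, ℝ) ∞ L A.affineBundle)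
    (w : C.W₀) (β : E (C.nu w) →L[ℝ] ℝ) :
    tderiv (modelW₀ m k F) (C.hamiltonian L) w (C.covectorVector w β) = β (C.incl w.1).2 := by
  rw [C.tderiv_covectorVector ((C.contMDiff_hamiltonian hL).contMDiffAt.mdifferentiableAt
    (by simp))]
  have : (fun t => (C.hamiltonian L) (C.covectorCurve w β t)) =
      fun t : ℝ => C.covector w (C.incl w.1).2 + t * β (C.incl w.1).2 - L (C.incl w.1) := rfl
  rw [this]
  simp

/-- The points of `W₁` are those at which the Hamiltonian is stationary along the vectors
tangent to the fibres of `π₁`. -/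
theorem mem_W₁_iff {L : TotalSpace F E → ℝ}
    (hL : ContMDiffOn ((𝓡 m).prod 𝓘(ℝ, F)) 𝓘(ℝ, ℝ) ∞ L A.affineBundle) (w : C.W₀) :
    w ∈ C.W₁ L ↔ ∀ X : TangentSpace (modelW₀ m k F) w,
      mfderiv (modelW₀ m k F) (𝓡 m) C.nu w X = 0 →
      (∀ σ : Cₛ^∞⟮𝓡 m; F, E⟯, tderiv (modelW₀ m k F) (pairSec σ ∘ C.pr₁) w X = 0) →
      tderiv (modelW₀ m k F) (C.hamiltonian L) w X = 0 := by
  have hΩ := C.isCanonicalPullback_Omega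
  have hvert (X : TangentSpace (modelW₀ m k F) w)
      (hX : mfderiv (modelW₀ m k F) (𝓡 m) C.nu w X = 0) :
      ((0 : E (C.nu w)), X) ∈ prolongFiber (modelW₀ m k F) A.toLieAlgebroid C.nu w :=
    (map_zero _).trans hX.symm
  constructor
  · rintro ⟨⟨e, Y⟩, hZ, hZ0, hZ1⟩ X hX hσ
    obtain ⟨σ, rfl⟩ := exists_section_through m F e
    have h1 := hZ0 (0, X) (hvert X hX)
    have h2 : C.Omega w (σ (C.nu w), Y) (0, X) = 0 :=
      (hΩ.apply_vertical (p := w) (σ := σ) hZ hX).trans (hσ σ)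
    have h3 : C.eta w ((0 : E (C.nu w)), X) = 0 := map_zero _
    change C.Omega w _ _ + (_ * _ - _ * _) = _ at h1
    rw [h2, h3, hZ1, mul_zero, zero_sub, zero_add, mul_one, neg_eq_zero] at h1
    exact h1
  · intro hX
    obtain ⟨B, hB, hskew⟩ : ∃ B : prolongFiber (modelW₀ m k F) A.toLieAlgebroid C.nu w →ₗ[ℝ]
        prolongFiber (modelW₀ m k F) A.toLieAlgebroid C.nu w →ₗ[ℝ] ℝ,
        (∀ z z', B z z' = C.Omega w z z') ∧ ∀ z z', B z z' = - B z' z :=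
      hΩ.exists_bilinear (p := w) (C.contMDiff_pr₁.contMDiffAt.mdifferentiableAt (by simp))
    have : FiniteDimensional ℝ (E (C.nu w)) := (fiberEquiv F E (C.nu w)).symm.finiteDimensional
    have : FiniteDimensional ℝ (TangentSpace (modelW₀ m k F) w) :=
      inferInstanceAs (FiniteDimensional ℝ (EuclideanSpace ℝ (Fin (m + k)) × (F →L[ℝ] ℝ)))
    let dH : TangentSpace (modelW₀ m k F) w →ₗ[ℝ] ℝ :=
      { toFun := tderiv (modelW₀ m k F) (C.hamiltonian L) w
        map_add' := tderiv_add_right _ _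
        map_smul' := tderiv_smul_right _ _ }
    let l := dH ∘ₗ LinearMap.snd ℝ (E (C.nu w)) (TangentSpace (modelW₀ m k F) w) ∘ₗ
      (prolongFiber (modelW₀ m k F) A.toLieAlgebroid C.nu w).subtype
    have hBv (σ : Cₛ^∞⟮𝓡 m; F, E⟯) (Y X : TangentSpace (modelW₀ m k F) w)
        (hY : (σ (C.nu w), Y) ∈ prolongFiber (modelW₀ m k F) A.toLieAlgebroid C.nu w)
        (hX : mfderiv (modelW₀ m k F) (𝓡 m) C.nu w X = 0) :
        B ⟨(σ (C.nu w), Y), hY⟩ ⟨(0, X), hvert X hX⟩ =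
          tderiv (modelW₀ m k F) (pairSec σ ∘ C.pr₁) w X :=
      (hB _ _).trans (hΩ.apply_vertical (p := w) (σ := σ) hY hX)
    -- Solves i_Z Ω = dH. The obstruction is the value of dH on the radical of Ω, whose elements
    -- turn out to have zero component in `E` and to be tangent to the fibres of π₁.
    obtain ⟨Z, hZ⟩ := exists_eq_of_radical B hskew l (by
      rintro ⟨⟨e, Y⟩, hY⟩ hrad
      obtain ⟨σ, rfl⟩ := exists_section_through m F e
      -- Ω against the vertical vector moving the covector in direction `β` is `β` of the component
      -- in `E`, so a radical vector has that component zero.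
      have he : σ (C.nu w) = 0 := by
        rw [← Module.forall_dual_apply_eq_zero_iff ℝ]
        intro β
        have hβ : fiberFunctional F β (σ (C.nu w)) = β (σ (C.nu w)) := rfl
        rw [← hβ, ← C.tderiv_pairSec_covectorVector w (fiberFunctional F β) σ,
          ← hBv σ Y _ hY (C.mfderiv_nu_covectorVector w (fiberFunctional F β)), hrad]
      have hY0 : mfderiv (modelW₀ m k F) (𝓡 m) C.nu w Y = 0 := by
        refine Eq.trans (Eq.symm hY) ?_
        exact (congrArg (A.anchor (C.nu w)) he).trans (map_zero _)
      refine hX Y hY0 fun τ => ?_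
      -- As `ν` is a submersion, any value of `τ` extends to a vector of the prolongation; pairing
      -- it with the radical vector reads off the derivative of `pairSec τ` along `Y`.
      obtain ⟨Y', hY'⟩ := C.mfderiv_nu_surjective w (A.anchor (C.nu w) (τ (C.nu w)))
      rw [← hBv τ Y' Y hY'.symm hY0, hskew]
      have := hrad ⟨(τ (C.nu w), Y'), hY'.symm⟩
      rw [neg_eq_zero, ← this]
      congr 3
      exact Prod.ext he.symm rfl)
    -- Energy conservation: dH(Z) = Ω(Z, Z) = 0 by skewness.
    have hself : l Z = 0 := by
      have := hskew Z Z
      rw [hZ] at this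
      linarith
    -- The normalization comes for free: testing i_Z Ω = dH on the vertical vector in direction 1_𝒜
    -- gives η(Z) on the left and 1_𝒜(a) = 1 on the right.
    have hη : C.eta w (Z : E (C.nu w) × TangentSpace (modelW₀ m k F) w) = 1 := by
      obtain ⟨⟨e, Y⟩, hY⟩ := Z
      obtain ⟨σ, rfl⟩ := exists_section_through m F e
      have h1 := hBv σ Y _ hY (C.mfderiv_nu_covectorVector w (A.one (C.nu w)))
      rw [hZ, C.tderiv_pairSec_covectorVector] at h1
      have h2 := C.tderiv_hamiltonian_covectorVector hL w (A.one (C.nu w))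
      have h3 : A.one (C.nu w) (C.incl w.1).2 = 1 := C.mem_affineBundle w.1
      exact h1.symm.trans (h2.trans h3)
    refine ⟨Z, Z.2, fun Z' hZ' => ?_, hη⟩
    have h1 : C.Omega w Z Z' = tderiv (modelW₀ m k F) (C.hamiltonian L) w Z'.2 :=
      (hB Z ⟨Z', hZ'⟩).symm.trans (DFunLike.congr_fun hZ ⟨Z', hZ'⟩)
    have h2 : tderiv (modelW₀ m k F) (C.hamiltonian L) w Z.1.2 = 0 := hself
    have h3 : C.OmegaW₀ L w Z Z' = C.Omega w Z Z' +
      (tderiv (modelW₀ m k F) (C.hamiltonian L) w Z.1.2 * C.eta w Z'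
      - tderiv (modelW₀ m k F) (C.hamiltonian L) w Z'.2 * C.eta w Z.1) := rfl
    rw [h3, h1, h2, hη]
    ring

end ConstraintSubmanifold

end Vakonomic

namespace Vakonomic

/-! ### Linear combinations and coefficients in a local frame. -/

section Frames

variable {EB HB EX HX : Type*} [NormedAddCommGroup EB] [NormedSpace ℝ EB] [TopologicalSpace HB]
  [NormedAddCommGroup EX] [NormedSpace ℝ EX] [TopologicalSpace HX]
  {IB : ModelWithCorners ℝ EB HB} {IX : ModelWithCorners ℝ EX HX}
  {Q X : Type*} [TopologicalSpace Q] [ChartedSpace HB Q] [TopologicalSpace X] [ChartedSpace HX X]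
  {F : Type*} [NormedAddCommGroup F] [NormedSpace ℝ F]
  {E : Q → Type*} [TopologicalSpace (TotalSpace F E)]
  [∀ x, AddCommGroup (E x)] [∀ x, Module ℝ (E x)] [∀ x, TopologicalSpace (E x)]
  [FiberBundle F E] [VectorBundle ℝ F E] {n : WithTop ℕ∞}

/-- Linear combinations of smooth sections along a map are smooth. -/
theorem contMDiffAt_sum_smul [ContMDiffVectorBundle n F E IB] {ι : Type*} [Fintype ι]
    {s : ι → (x : Q) → E x} {b : X → Q} {f : ι → X → ℝ} {t₀ : X} (hb : ContMDiffAt IX IB n b t₀)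
    (hs : ∀ i, ContMDiffAt IB (IB.prod 𝓘(ℝ, F)) n (fun x => (⟨x, s i x⟩ : TotalSpace F E)) (b t₀))
    (hf : ∀ i, ContMDiffAt IX 𝓘(ℝ, ℝ) n (f i) t₀) :
    ContMDiffAt IX (IB.prod 𝓘(ℝ, F)) n
      (fun t => (⟨b t, ∑ i, f i t • s i (b t)⟩ : TotalSpace F E)) t₀ := by
  refine contMDiffAt_totalSpace.2 ⟨hb, ?_⟩
  set e := trivializationAt F E (b t₀)
  have hx : b t₀ ∈ e.baseSet := FiberBundle.mem_baseSet_trivializationAt F E (b t₀)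
  have hse (i) : ContMDiffAt IX 𝓘(ℝ, F) n (fun t => (e ⟨b t, s i (b t)⟩).2) t₀ :=
    (contMDiffAt_totalSpace.1 (ContMDiffAt.comp t₀
      (g := fun x => (⟨x, s i x⟩ : TotalSpace F E)) (f := b) (hs i) hb)).2
  have h : ContMDiffAt IX 𝓘(ℝ, F) n (fun t => ∑ i, f i t • (e ⟨b t, s i (b t)⟩).2) t₀ :=
    ContMDiffAt.sum fun i _ => (hf i).smul (hse i)
  refine h.congr_of_eventuallyEq ?_
  filter_upwards [hb.continuousAt.preimage_mem_nhds (e.open_baseSet.mem_nhds hx)] with t ht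
  have hlin (v : E (b t)) : (e ⟨b t, v⟩).2 = e.linearMapAt ℝ (b t) v := by
    rw [Trivialization.coe_linearMapAt_of_mem _ ht]
  change (e ⟨b t, _⟩).2 = _
  simp only [hlin, map_sum, map_smul]

variable {ι : Type*} [Fintype ι] {s : ι → (x : Q) → E x} {u : Set Q}

theorem _root_.IsLocalFrameOn.coeff_sum_smul (hs : IsLocalFrameOn IB F n s u) {x : Q} (hx : x ∈ u)
    (f : ι → ℝ) (α : ι) : hs.coeff α x (∑ β, f β • s β x) = f α := by
  classical
  have h (β) : hs.coeff α x (s β x) = if β = α then 1 else 0 := by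
    rw [← hs.toBasisAt_coe hx]
    simp only [IsLocalFrameOn.coeff, hx, dite_true, Basis.coord_apply, Basis.repr_self]
    exact Finsupp.single_apply
  rw [map_sum]
  simp [h]

theorem _root_.IsLocalFrameOn.sum_coeff_smul (hs : IsLocalFrameOn IB F n s u) {x : Q} (hx : x ∈ u)
    (v : E x) : ∑ α, hs.coeff α x v • s α x = v := by
  simp only [IsLocalFrameOn.coeff, hx, dite_true]
  have := (hs.toBasisAt hx).sum_repr v
  simpa [hs.toBasisAt_coe] using this

end Frames

/-! ### Adapted coordinates as smooth local coordinates of ℳ and of W₀. -/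

namespace ConstraintSubmanifold

variable {m k mbar : ℕ}
  {Q : Type*} [TopologicalSpace Q] [T2Space Q]
  [ChartedSpace (EuclideanSpace ℝ (Fin m)) Q] [IsManifold (𝓡 m) ∞ Q]
  {F : Type*} [NormedAddCommGroup F] [NormedSpace ℝ F] [FiniteDimensional ℝ F]
  {E : Q → Type*} [TopologicalSpace (TotalSpace F E)]
  [∀ x, AddCommGroup (E x)] [∀ x, Module ℝ (E x)] [∀ x, TopologicalSpace (E x)]
  [∀ x, IsTopologicalAddGroup (E x)] [∀ x, ContinuousSMul ℝ (E x)]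
  [FiberBundle F E] [VectorBundle ℝ F E] [ContMDiffVectorBundle ∞ F E (𝓡 m)]
  {A : LieAffgebroid m F E} {M : Type*} [TopologicalSpace M]
  [ChartedSpace (EuclideanSpace ℝ (Fin (m + k))) M] [IsManifold (𝓡 (m + k)) ∞ M]
  {C : ConstraintSubmanifold A k M}

namespace AdaptedCoordinates

variable (m k mbar) in
/-- The values of the coordinates `(xⁱ, y^a, y₀, y_A, y_a)` of `W₀`. -/
abbrev CoordSpace := EuclideanSpace ℝ (Fin m) × (Fin k → ℝ) × (Option (Fin mbar ⊕ Fin k) → ℝ)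

variable (c : C.AdaptedCoordinates mbar)

/-- The coordinates on `W₀`. -/
def coords (w : C.W₀) : CoordSpace m k mbar :=
  (c.xCoord w, c.yCoord w, fun α => C.covector w (c.frame α (C.nu w)))

/-- The coordinates `(xⁱ, y^a)` of a vector. -/
def baseCoords (v : TotalSpace F E) : EuclideanSpace ℝ (Fin m) × (Fin k → ℝ) :=
  (c.chart v.1, fun a => c.isLocalFrame.coeff (some (.inr a)) v.1 v.2)

/-- The frame components of the vector of `𝒜` with coordinates `(xⁱ, y^a)` in `ℳ`. -/
def pointCoeff (α : Option (Fin mbar ⊕ Fin k)) (u : EuclideanSpace ℝ (Fin m) × (Fin k → ℝ)) : ℝ :=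
  α.elim 1 (Sum.elim (fun i => c.psi i u) (fun a => u.2 a))

theorem point_eq (u : EuclideanSpace ℝ (Fin m) × (Fin k → ℝ)) :
    c.point u.1 u.2 = ⟨c.chart.symm u.1, ∑ α, c.pointCoeff α u • c.frame α (c.chart.symm u.1)⟩ := by
  simp only [point, pointCoeff, Fintype.sum_option, Fintype.sum_sum_type, Option.elim,
    Sum.elim_inl, Sum.elim_inr, one_smul, add_assoc]

theorem coeff_frame {x : Q} (hx : x ∈ c.chart.source) (f : Option (Fin mbar ⊕ Fin k) → ℝ)
    (α : Option (Fin mbar ⊕ Fin k)) :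
    c.isLocalFrame.coeff α x (∑ β, f β • c.frame β x) = f α :=
  c.isLocalFrame.coeff_sum_smul hx f α

theorem sum_coeff_frame {v : TotalSpace F E} (hv : v.1 ∈ c.chart.source) :
    ∑ α, c.isLocalFrame.coeff α v.1 v.2 • c.frame α v.1 = v.2 :=
  c.isLocalFrame.sum_coeff_smul hv v.2

theorem coeff_none {v : TotalSpace F E} (hv : v.1 ∈ c.chart.source) :
    c.isLocalFrame.coeff none v.1 v.2 = A.one v.1 v.2 := by
  conv_rhs => rw [← c.sum_coeff_frame hv]
  simp [Fintype.sum_option, c.one_frame_none _ hv, c.one_frame_some _ hv]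

theorem one_sum_frame {x : Q} (hx : x ∈ c.chart.source) (f : Option (Fin mbar ⊕ Fin k) → ℝ) :
    A.one x (∑ β, f β • c.frame β x) = f none := by
  simp [Fintype.sum_option, c.one_frame_none _ hx, c.one_frame_some _ hx]

/-- A point of `ℳ` is determined by its coordinates `(xⁱ, y^a)`. -/
theorem point_baseCoords {a : M} (ha : C.incl a ∈ c.dom) :
    c.point (c.baseCoords (C.incl a)).1 (c.baseCoords (C.incl a)).2 = C.incl a := by
  have hs := c.dom_subset _ ha
  have hA := C.mem_affineBundle a
  have hpsi := (c.mem_iff _ ha hA).1 ⟨a, rfl⟩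
  have hx : c.chart.symm (c.baseCoords (C.incl a)).1 = (C.incl a).1 := c.chart.left_inv hs
  rw [point_eq, hx]
  have h2 := c.sum_coeff_frame hs
  conv_rhs => rw [show C.incl a = ⟨(C.incl a).1, (C.incl a).2⟩ from rfl, ← h2]
  congr 1
  refine Finset.sum_congr rfl fun α _ => ?_
  congr 1
  rcases α with _ | i | b
  · exact ((c.coeff_none hs).trans hA).symm
  · exact (hpsi i).symm
  · rfl

theorem coords_injective {w w' : C.W₀} (hw : C.incl w.1 ∈ c.dom) (hw' : C.incl w'.1 ∈ c.dom)
    (h : c.coords w = c.coords w') : w = w' := by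
  have hb : c.baseCoords (C.incl w.1) = c.baseCoords (C.incl w'.1) :=
    Prod.ext (congrArg (fun z => z.1) h) (congrArg (fun z => z.2.1) h)
  have ha : w.1 = w'.1 := C.injective_incl (by
    rw [← c.point_baseCoords hw, ← c.point_baseCoords hw', hb])
  obtain ⟨a, (φ : E (C.proj a) →L[ℝ] ℝ)⟩ := w
  obtain ⟨a', (φ' : E (C.proj a') →L[ℝ] ℝ)⟩ := w'
  cases ha
  have hp : ∀ α, φ (c.frame α (C.proj a)) = φ' (c.frame α (C.proj a)) :=
    fun α => congrFun (congrArg (fun z => z.2.2) h) α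
  have : φ = φ' := by
    ext v
    have hs := c.dom_subset _ hw
    have h2 := c.sum_coeff_frame (v := ⟨C.proj a, v⟩) hs
    change _ = v at h2
    change φ v = φ' v
    rw [← h2, map_sum, map_sum]
    refine Finset.sum_congr rfl fun α _ => ?_
    rw [map_smul, map_smul, hp]
  rw [this]

theorem contMDiffAt_chart {x : Q} (hx : x ∈ c.chart.source) :
    ContMDiffAt (𝓡 m) 𝓘(ℝ, EuclideanSpace ℝ (Fin m)) ∞ c.chart x :=
  contMDiffAt_of_mem_maximalAtlas c.chart_mem hx

theorem contMDiffAt_chart_symm {x : EuclideanSpace ℝ (Fin m)} (hx : x ∈ c.chart.target) :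
    ContMDiffAt 𝓘(ℝ, EuclideanSpace ℝ (Fin m)) (𝓡 m) ∞ c.chart.symm x :=
  contMDiffAt_symm_of_mem_maximalAtlas c.chart_mem hx

theorem contMDiffAt_baseCoords {v : TotalSpace F E} (hv : v.1 ∈ c.chart.source) :
    ContMDiffAt ((𝓡 m).prod 𝓘(ℝ, F)) 𝓘(ℝ, EuclideanSpace ℝ (Fin m) × (Fin k → ℝ)) ∞
      c.baseCoords v := by
  refine ContMDiffAt.prodMk_space ?_ ?_
  · exact ContMDiffAt.comp v (g := c.chart) (f := TotalSpace.proj) (c.contMDiffAt_chart hv)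
      (contMDiff_proj E).contMDiffAt
  · exact contMDiffAt_pi_space.2 fun a => c.isLocalFrame.contMDiffAt_coeff c.chart.open_source hv _

theorem contMDiffAt_covector_frame {w : C.W₀} (hw : C.nu w ∈ c.chart.source)
    (α : Option (Fin mbar ⊕ Fin k)) :
    ContMDiffAt (modelW₀ m k F) 𝓘(ℝ, ℝ) ∞ (fun w => C.covector w (c.frame α (C.nu w))) w :=
  contMDiffAt_pairing (b := C.nu) (φ := C.covector) (v := fun w => c.frame α (C.nu w))
      C.contMDiff_pr₁.contMDiffAt
      (ContMDiffAt.comp w (g := fun x => (⟨x, c.frame α x⟩ : TotalSpace F E)) (f := C.nu)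
        (c.isLocalFrame.contMDiffAt c.chart.open_source hw α) C.contMDiff_nu.contMDiffAt)

theorem contMDiffAt_coords {w : C.W₀} (hw : C.incl w.1 ∈ c.dom) :
    ContMDiffAt (modelW₀ m k F) 𝓘(ℝ, CoordSpace m k mbar) ∞ c.coords w := by
  have hs := c.dom_subset _ hw
  have h1 : ContMDiffAt (modelW₀ m k F) 𝓘(ℝ, EuclideanSpace ℝ (Fin m) × (Fin k → ℝ)) ∞
      (fun w : C.W₀ => c.baseCoords (C.incl w.1)) w :=
    ContMDiffAt.comp w (g := c.baseCoords) (f := fun w : C.W₀ => C.incl w.1)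
      (c.contMDiffAt_baseCoords hs) C.contMDiff_incl_fst.contMDiffAt
  have h2 : ContMDiffAt (modelW₀ m k F) 𝓘(ℝ, EuclideanSpace ℝ (Fin m)) ∞ c.xCoord w :=
    ContMDiffAt.comp w (g := Prod.fst) (f := fun w : C.W₀ => c.baseCoords (C.incl w.1))
      contDiff_fst.contMDiff.contMDiffAt h1
  have h3 : ContMDiffAt (modelW₀ m k F) 𝓘(ℝ, Fin k → ℝ) ∞ c.yCoord w :=
    ContMDiffAt.comp w (g := Prod.snd) (f := fun w : C.W₀ => c.baseCoords (C.incl w.1))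
      contDiff_snd.contMDiff.contMDiffAt h1
  refine ContMDiffAt.prodMk_space h2 (ContMDiffAt.prodMk_space h3 ?_)
  exact contMDiffAt_pi_space.2 (c.contMDiffAt_covector_frame hs)

/-- The coordinates of points of `ℳ` in the domain. -/
theorem baseCoords_mem {a : M} (ha : C.incl a ∈ c.dom) :
    (c.baseCoords (C.incl a)).1 ∈ c.chart.target ∧ c.baseCoords (C.incl a) ∈ c.psiDom :=
  ⟨c.chart.map_source (c.dom_subset _ ha), c.mem_psiDom _ ha (C.mem_affineBundle a)⟩

theorem contMDiffAt_point {u : EuclideanSpace ℝ (Fin m) × (Fin k → ℝ)}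
    (hu : u.1 ∈ c.chart.target) (hu' : u ∈ c.psiDom) :
    ContMDiffAt 𝓘(ℝ, EuclideanSpace ℝ (Fin m) × (Fin k → ℝ)) ((𝓡 m).prod 𝓘(ℝ, F)) ∞
      (fun u => c.point u.1 u.2) u := by
  simp only [point_eq]
  refine contMDiffAt_sum_smul ?_ (fun α => ?_) fun α => ?_
  · refine ContMDiffAt.comp u (g := c.chart.symm) (f := Prod.fst) (c.contMDiffAt_chart_symm hu) ?_
    exact contDiff_fst.contMDiff.contMDiffAt
  · exact c.isLocalFrame.contMDiffAt c.chart.open_source (c.chart.map_target hu) α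
  · rw [contMDiffAt_iff_contDiffAt]
    rcases α with _ | i | b
    · exact contDiffAt_const
    · exact (c.psi_smooth i).contDiffAt (c.isOpen_psiDom.mem_nhds hu')
    · change ContDiffAt ℝ ∞ (fun u : EuclideanSpace ℝ (Fin m) × (Fin k → ℝ) => u.2 b) u
      fun_prop

theorem point_mem_affineBundle {u : EuclideanSpace ℝ (Fin m) × (Fin k → ℝ)}
    (hu : u.1 ∈ c.chart.target) : c.point u.1 u.2 ∈ A.affineBundle := by
  rw [point_eq]
  exact c.one_sum_frame (c.chart.map_target hu) fun α => c.pointCoeff α u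

theorem coeff_point {u : EuclideanSpace ℝ (Fin m) × (Fin k → ℝ)} (hu : u.1 ∈ c.chart.target)
    (α : Option (Fin mbar ⊕ Fin k)) :
    c.isLocalFrame.coeff α (c.point u.1 u.2).1 (c.point u.1 u.2).2 = c.pointCoeff α u := by
  rw [point_eq]
  exact c.coeff_frame (c.chart.map_target hu) (fun α => c.pointCoeff α u) α

theorem baseCoords_point {u : EuclideanSpace ℝ (Fin m) × (Fin k → ℝ)} (hu : u.1 ∈ c.chart.target) :
    c.baseCoords (c.point u.1 u.2) = u :=
  Prod.ext (c.chart.right_inv hu) (funext fun a => c.coeff_point hu (some (.inr a)))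

/-- The coordinates `(xⁱ, y^a)` are local coordinates of `ℳ`. -/
theorem exists_lift_point {a : M} (ha : C.incl a ∈ c.dom) :
    ∃ g : EuclideanSpace ℝ (Fin m) × (Fin k → ℝ) → M,
      ContMDiffAt 𝓘(ℝ, EuclideanSpace ℝ (Fin m) × (Fin k → ℝ)) (𝓡 (m + k)) ∞ g
        (c.baseCoords (C.incl a)) ∧ g (c.baseCoords (C.incl a)) = a ∧
      ∀ᶠ u in 𝓝 (c.baseCoords (C.incl a)), C.incl (g u) = c.point u.1 u.2 ∧
        u.1 ∈ c.chart.target ∧ u ∈ c.psiDom ∧ C.incl (g u) ∈ c.dom := by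
  obtain ⟨hu, hu'⟩ := c.baseCoords_mem ha
  have hsm := c.contMDiffAt_point hu hu'
  have h1 : ∀ᶠ u : EuclideanSpace ℝ (Fin m) × (Fin k → ℝ) in 𝓝 (c.baseCoords (C.incl a)),
      u.1 ∈ c.chart.target :=
    continuous_fst.continuousAt.preimage_mem_nhds (c.chart.open_target.mem_nhds hu)
  have h2 : ∀ᶠ u in 𝓝 (c.baseCoords (C.incl a)), u ∈ c.psiDom := c.isOpen_psiDom.mem_nhds hu'
  have h3 : ∀ᶠ u : EuclideanSpace ℝ (Fin m) × (Fin k → ℝ) in 𝓝 (c.baseCoords (C.incl a)),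
      c.point u.1 u.2 ∈ c.dom :=
    hsm.continuousAt.preimage_mem_nhds (c.isOpen_dom.mem_nhds (by
      rw [c.point_baseCoords ha]; exact ha))
  have h4 : ∀ᶠ u : EuclideanSpace ℝ (Fin m) × (Fin k → ℝ) in 𝓝 (c.baseCoords (C.incl a)),
      c.point u.1 u.2 ∈ Set.range C.incl := by
    filter_upwards [h1, h3] with u hu hud
    refine (c.mem_iff _ hud (c.point_mem_affineBundle hu)).2 fun i => ?_
    change _ = c.psi i (c.baseCoords (c.point u.1 u.2))
    rw [c.coeff_point hu, c.baseCoords_point hu]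
    rfl
  -- `point` is smooth into the total space and, by the graph description, takes values in `ℳ` near
  -- the given coordinates; the embedding makes it a smooth map into `ℳ`.
  obtain ⟨g, hg, hga, hgp⟩ := C.isEmbedding.exists_lift hsm h4 (c.point_baseCoords ha).symm
  refine ⟨g, hg, hga, ?_⟩
  filter_upwards [hgp, h1, h2, h3] with u e1 e2 e3 e4
  exact ⟨e1, e2, e3, e1 ▸ e4⟩

/-- The coordinates on `W₀` have smooth local inverses. -/
theorem exists_local_inverse {w : C.W₀} (hw : C.incl w.1 ∈ c.dom) :
    ∃ K : CoordSpace m k mbar → C.W₀,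
      ContMDiffAt 𝓘(ℝ, CoordSpace m k mbar) (modelW₀ m k F) ∞ K (c.coords w) ∧
      K (c.coords w) = w ∧
      (∀ᶠ z in 𝓝 (c.coords w), C.incl (K z).1 ∈ c.dom ∧ c.coords (K z) = z) ∧
      ∀ᶠ w' in 𝓝 w, K (c.coords w') = w' := by
  obtain ⟨g, hg, hga, hgp⟩ := c.exists_lift_point hw
  set u₀ := c.baseCoords (C.incl w.1) with hu₀
  let r : CoordSpace m k mbar → EuclideanSpace ℝ (Fin m) × (Fin k → ℝ) := fun z => (z.1, z.2.1)
  have hr : ContDiff ℝ ∞ r := by fun_prop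
  -- The point of `ℳ` is rebuilt from (xⁱ, y^a), the covector from its values on the frame by means
  -- of the dual coframe.
  let K : CoordSpace m k mbar → C.W₀ := fun z =>
    ⟨g (r z), fiberFunctional F (∑ α, z.2.2 α • c.isLocalFrame.coeff α (C.proj (g (r z))))⟩
  have hgp' : ∀ᶠ z in 𝓝 (c.coords w), C.incl (g (r z)) = c.point (r z).1 (r z).2 ∧
        (r z).1 ∈ c.chart.target ∧ r z ∈ c.psiDom ∧ C.incl (g (r z)) ∈ c.dom :=
    (hr.continuous.tendsto (c.coords w)).eventually hgp
  have hKα : ∀ z, C.proj (g (r z)) ∈ c.chart.source → ∀ α,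
      C.covector (K z) (c.frame α (C.nu (K z))) = z.2.2 α := by
    classical
    intro z hz α
    change (∑ β, z.2.2 β • c.isLocalFrame.coeff β (C.proj (g (r z))))
      (c.frame α (C.proj (g (r z)))) = _
    have h (β) := c.coeff_frame hz (Pi.single α 1) β
    simp only [Pi.single_apply, ite_smul, one_smul, zero_smul, Finset.sum_ite_eq',
      Finset.mem_univ, if_true] at h
    rw [LinearMap.sum_apply]
    simp only [LinearMap.smul_apply, h, smul_eq_mul, mul_ite, mul_one, mul_zero,
      Finset.sum_ite_eq', Finset.mem_univ, if_true]
  have hgr : ContMDiffAt 𝓘(ℝ, CoordSpace m k mbar) (𝓡 (m + k)) ∞ (fun z => g (r z))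
      (c.coords w) :=
    ContMDiffAt.comp (c.coords w) (g := g) (f := r) hg hr.contMDiff.contMDiffAt
  have hKc : ∀ᶠ z in 𝓝 (c.coords w), C.incl (K z).1 ∈ c.dom ∧ c.coords (K z) = z := by
    filter_upwards [hgp'] with z hz
    refine ⟨hz.2.2.2, ?_⟩
    have h1 : c.baseCoords (C.incl (g (r z))) = r z := by rw [hz.1, c.baseCoords_point hz.2.1]
    refine Prod.ext (congrArg (fun u => u.1) h1) (Prod.ext (congrArg (fun u => u.2) h1) ?_)
    exact funext fun α => hKα z (c.dom_subset _ hz.2.2.2) α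
  have hKsm : ContMDiffAt 𝓘(ℝ, CoordSpace m k mbar) (modelW₀ m k F) ∞ K (c.coords w) := by
    refine C.contMDiffAt_W₀_iff.2 ⟨hgr, ?_⟩
    have hb : ContMDiffAt 𝓘(ℝ, CoordSpace m k mbar) (𝓡 m) ∞ (fun z => C.proj (g (r z)))
        (c.coords w) :=
      ContMDiffAt.comp (c.coords w) (g := C.proj) (f := fun z => g (r z))
        C.proj.contMDiff.contMDiffAt hgr
    refine c.isLocalFrame.contMDiffAt_covector c.chart.open_source (b := fun z => C.nu (K z))
      (φ := fun z => C.covector (K z)) ?_ hb fun α => ?_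
    · exact c.dom_subset _ hgp'.self_of_nhds.2.2.2
    · have h : ContMDiffAt 𝓘(ℝ, CoordSpace m k mbar) 𝓘(ℝ, ℝ) ∞
          (fun z : CoordSpace m k mbar => z.2.2 α) (c.coords w) := by
        rw [contMDiffAt_iff_contDiffAt]
        fun_prop
      refine h.congr_of_eventuallyEq ?_
      filter_upwards [hgp'] with z hz
      exact hKα z (c.dom_subset _ hz.2.2.2) α
  -- A right inverse of an injective map is also a left inverse, at `w` and, by the same argument
  -- below, near `w`.
  have hKw : K (c.coords w) = w :=
    c.coords_injective hKc.self_of_nhds.1 hw hKc.self_of_nhds.2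
  refine ⟨K, hKsm, hKw, hKc, ?_⟩
  have hd : ∀ᶠ w' in 𝓝 w, C.incl w'.1 ∈ c.dom :=
    C.contMDiff_incl_fst.continuous.continuousAt.preimage_mem_nhds (c.isOpen_dom.mem_nhds hw)
  filter_upwards [hd, (c.contMDiffAt_coords hw).continuousAt.eventually hKc] with w' h1 h2
  exact c.coords_injective h2.1 h1 h2.2

end AdaptedCoordinates

end ConstraintSubmanifold

end Vakonomic

namespace Vakonomic

/-! ### Tangent vectors read through local coordinates. -/

section TangentCharts

variable {EP : Type*} [NormedAddCommGroup EP] [NormedSpace ℝ EP]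
  {HP : Type*} [TopologicalSpace HP] {IP : ModelWithCorners ℝ EP HP}
  {P : Type*} [TopologicalSpace P] [ChartedSpace HP P]
  {G G' : Type*} [NormedAddCommGroup G] [NormedSpace ℝ G] [NormedAddCommGroup G'] [NormedSpace ℝ G']

theorem tderiv_fderiv_comp {f : P → G} {h : G → G'} {p : P}
    (hh : DifferentiableAt ℝ h (f p)) (hf : MDifferentiableAt IP 𝓘(ℝ, G) f p)
    (X : TangentSpace IP p) :
    tderiv IP (fun q => h (f q)) p X = fderiv ℝ h (f p) (tderiv IP f p X) := by
  have h1 := tderiv_comp (IQ := 𝓘(ℝ, G)) (f := h) (g := f) hh.mdifferentiableAt hf X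
  exact h1.trans (tderiv_eq_fderiv h (f p) (tderiv IP f p X))

theorem tderiv_clm_comp {f : P → G} (h : G →L[ℝ] G') {p : P}
    (hf : MDifferentiableAt IP 𝓘(ℝ, G) f p) (X : TangentSpace IP p) :
    tderiv IP (fun q => h (f q)) p X = h (tderiv IP f p X) := by
  rw [tderiv_fderiv_comp h.differentiableAt hf, h.fderiv]

/-- A map with smooth right inverse has surjective differential. -/
theorem exists_tderiv_eq {f : P → G} {g : G → P} {u : G} {p : P} (hgu : g u = p)
    (hf : MDifferentiableAt IP 𝓘(ℝ, G) f p) (hg : MDifferentiableAt 𝓘(ℝ, G) IP g u)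
    (hfg : ∀ᶠ u' in 𝓝 u, f (g u') = u') (v : G) :
    ∃ X : TangentSpace IP p, tderiv IP f p X = v := by
  subst hgu
  refine ⟨mfderiv 𝓘(ℝ, G) IP g u v, ?_⟩
  refine (tderiv_comp hf hg v).symm.trans ((tderiv_eq_fderiv (f ∘ g) u v).trans ?_)
  have : f ∘ g =ᶠ[𝓝 u] id := hfg
  rw [this.fderiv_eq, fderiv_id]
  rfl

/-- A map with smooth left inverse has injective differential. -/
theorem tderiv_injective {f : P → G} {g : G → P} {u : G} {p : P} (hfp : f p = u)
    (hf : MDifferentiableAt IP 𝓘(ℝ, G) f p) (hg : MDifferentiableAt 𝓘(ℝ, G) IP g u)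
    (hgf : ∀ᶠ p' in 𝓝 p, g (f p') = p') {X : TangentSpace IP p} (hX : tderiv IP f p X = 0) :
    X = 0 := by
  subst hfp
  have h : mfderiv IP IP (g ∘ f) p = ContinuousLinearMap.id ℝ (TangentSpace IP p) := by
    rw [← mfderiv_id]
    exact Filter.EventuallyEq.mfderiv_eq hgf
  have h2 := mfderiv_comp_apply p hg hf X
  rw [h] at h2
  refine h2.trans ?_
  exact (congrArg (mfderiv 𝓘(ℝ, G) IP g (f p)) hX).trans (map_zero _)

variable {m : ℕ} {Q : Type*} [TopologicalSpace Q]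
  [ChartedSpace (EuclideanSpace ℝ (Fin m)) Q] [IsManifold (𝓡 m) ∞ Q]

/-- The differential of a map vanishes on a vector iff it does so in a chart of the target. -/
theorem mfderiv_eq_zero_iff {χ : OpenPartialHomeomorph Q (EuclideanSpace ℝ (Fin m))}
    (hχ : χ ∈ IsManifold.maximalAtlas (𝓡 m) ∞ Q) {ν : P → Q} {p : P} (hp : ν p ∈ χ.source)
    (hν : MDifferentiableAt IP (𝓡 m) ν p) (X : TangentSpace IP p) :
    mfderiv IP (𝓡 m) ν p X = 0 ↔ tderiv IP (fun q => χ (ν q)) p X = 0 := by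
  have h1 : MDifferentiableAt (𝓡 m) 𝓘(ℝ, EuclideanSpace ℝ (Fin m)) χ (ν p) :=
    (contMDiffAt_of_mem_maximalAtlas hχ hp).mdifferentiableAt (by simp)
  have h2 : MDifferentiableAt 𝓘(ℝ, EuclideanSpace ℝ (Fin m)) (𝓡 m) χ.symm (χ (ν p)) :=
    (contMDiffAt_symm_of_mem_maximalAtlas hχ (χ.map_source hp)).mdifferentiableAt (by simp)
  have h3 : tderiv IP (fun q => χ (ν q)) p X =
      tderiv (𝓡 m) χ (ν p) (mfderiv IP (𝓡 m) ν p X) := tderiv_comp h1 hν X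
  rw [h3]
  constructor
  · intro h
    rw [h]
    exact tderiv_zero_right _ _
  · refine fun h => tderiv_injective rfl h1 h2 ?_ h
    filter_upwards [χ.open_source.mem_nhds hp] with q hq using χ.left_inv hq

/-- The differential of a map is surjective if it is so in a chart of the target. -/
theorem mfderiv_surjective_of_chart {χ : OpenPartialHomeomorph Q (EuclideanSpace ℝ (Fin m))}
    (hχ : χ ∈ IsManifold.maximalAtlas (𝓡 m) ∞ Q) {ν : P → Q} {p : P} (hp : ν p ∈ χ.source)
    (hν : MDifferentiableAt IP (𝓡 m) ν p)
    (h : ∀ v, ∃ X, tderiv IP (fun q => χ (ν q)) p X = v) :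
    Function.Surjective (mfderiv IP (𝓡 m) ν p) := by
  have h1 : MDifferentiableAt (𝓡 m) 𝓘(ℝ, EuclideanSpace ℝ (Fin m)) χ (ν p) :=
    (contMDiffAt_of_mem_maximalAtlas hχ hp).mdifferentiableAt (by simp)
  have h2 : MDifferentiableAt 𝓘(ℝ, EuclideanSpace ℝ (Fin m)) (𝓡 m) χ.symm (χ (ν p)) :=
    (contMDiffAt_symm_of_mem_maximalAtlas hχ (χ.map_source hp)).mdifferentiableAt (by simp)
  intro Y
  obtain ⟨X, hX⟩ := h (tderiv (𝓡 m) χ (ν p) Y)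
  refine ⟨X, sub_eq_zero.1 (tderiv_injective (IP := 𝓡 m) (p := ν p) rfl h1 h2 ?_ ?_)⟩
  · filter_upwards [χ.open_source.mem_nhds hp] with q hq using χ.left_inv hq
  · have h3 : tderiv IP (fun q => χ (ν q)) p X =
      tderiv (𝓡 m) χ (ν p) (mfderiv IP (𝓡 m) ν p X) := tderiv_comp h1 hν X
    rw [h3] at hX
    refine (map_sub (mfderiv (𝓡 m) 𝓘(ℝ, EuclideanSpace ℝ (Fin m)) χ (ν p)) _ _).trans ?_
    exact sub_eq_zero.2 hX

end TangentCharts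

/-! ### Partial derivatives in the variables y^a. -/

section PartialDerivatives

variable {k : ℕ} {V : Type*} [NormedAddCommGroup V] [NormedSpace ℝ V]

/-- The partial derivative `∂f / ∂y^b`. -/
def partialY (f : V × (Fin k → ℝ) → ℝ) (b : Fin k) (u : V × (Fin k → ℝ)) : ℝ :=
  fderiv ℝ f u (0, Pi.single b 1)

theorem contDiffOn_partialY {f : V × (Fin k → ℝ) → ℝ} {U : Set (V × (Fin k → ℝ))}
    (hU : IsOpen U) (hf : ContDiffOn ℝ ∞ f U) (b : Fin k) : ContDiffOn ℝ ∞ (partialY f b) U :=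
  (hf.fderiv_of_isOpen hU (m := ∞) (by simp)).clm_apply contDiffOn_const

theorem fderiv_apply_snd (f : V × (Fin k → ℝ) → ℝ) (u : V × (Fin k → ℝ)) (y : Fin k → ℝ) :
    fderiv ℝ f u (0, y) = ∑ b, y b * partialY f b u := by
  have h : ((0, y) : V × (Fin k → ℝ)) = ∑ b, y b • ((0, Pi.single b 1) : V × (Fin k → ℝ)) := by
    refine Prod.ext (by simp [Prod.fst_sum]) ?_
    rw [Prod.snd_sum]
    ext a
    simp [Finset.sum_apply, Pi.single_apply]
  rw [h, map_sum]
  exact Finset.sum_congr rfl fun b _ => map_smul _ _ _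

theorem fderiv_slice {f : V × (Fin k → ℝ) → ℝ} {x : V} {y : Fin k → ℝ}
    (hf : DifferentiableAt ℝ f (x, y)) (v : Fin k → ℝ) :
    fderiv ℝ (fun y => f (x, y)) y v = fderiv ℝ f (x, y) (0, v) := by
  have h : HasFDerivAt (fun y : Fin k → ℝ => (x, y))
    (ContinuousLinearMap.inr ℝ V (Fin k → ℝ)) y := hasFDerivAt_prodMk_right x y
  exact DFunLike.congr_fun (hf.hasFDerivAt.comp y h).fderiv v

/-- Connects the slice derivatives of the matrix R with `partialY`, which stays a smooth function of
all variables and can therefore be differentiated again along the graph of W₁'. -/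
theorem secondPartial_eq {f : V × (Fin k → ℝ) → ℝ}
    {U : Set (V × (Fin k → ℝ))} (hU : IsOpen U) (hf : ContDiffOn ℝ ∞ f U) {x : V}
    {y : Fin k → ℝ} (hxy : (x, y) ∈ U) (a b : Fin k) :
    ConstraintSubmanifold.AdaptedCoordinates.secondPartial (fun y => f (x, y)) y a b =
      partialY (partialY f b) a (x, y) := by
  have h1 : (fun y' => fderiv ℝ (fun y => f (x, y)) y' (Pi.single b 1)) =ᶠ[𝓝 y]
      fun y' => partialY f b (x, y') := by
    have : ∀ᶠ y' in 𝓝 y, (x, y') ∈ U :=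
      (Continuous.prodMk_right x).continuousAt.preimage_mem_nhds (hU.mem_nhds hxy)
    filter_upwards [this] with y' hy'
    exact fderiv_slice ((hf.contDiffAt (hU.mem_nhds hy')).differentiableAt (by simp)) _
  rw [ConstraintSubmanifold.AdaptedCoordinates.secondPartial, h1.fderiv_eq, fderiv_slice
    (((contDiffOn_partialY hU hf b).contDiffAt (hU.mem_nhds hxy)).differentiableAt (by simp))]
  rfl

end PartialDerivatives

/-! ### The Hamiltonian in coordinates and the momenta on W₁. -/

namespace ConstraintSubmanifold

variable {m k mbar : ℕ}
  {Q : Type*} [TopologicalSpace Q] [T2Space Q]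
  [ChartedSpace (EuclideanSpace ℝ (Fin m)) Q] [IsManifold (𝓡 m) ∞ Q]
  {F : Type*} [NormedAddCommGroup F] [NormedSpace ℝ F] [FiniteDimensional ℝ F]
  {E : Q → Type*} [TopologicalSpace (TotalSpace F E)]
  [∀ x, AddCommGroup (E x)] [∀ x, Module ℝ (E x)] [∀ x, TopologicalSpace (E x)]
  [∀ x, IsTopologicalAddGroup (E x)] [∀ x, ContinuousSMul ℝ (E x)]
  [FiberBundle F E] [VectorBundle ℝ F E] [ContMDiffVectorBundle ∞ F E (𝓡 m)]
  {A : LieAffgebroid m F E} {M : Type*} [TopologicalSpace M]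
  [ChartedSpace (EuclideanSpace ℝ (Fin (m + k))) M] [IsManifold (𝓡 (m + k)) ∞ M]
  {C : ConstraintSubmanifold A k M}

namespace AdaptedCoordinates

variable (c : C.AdaptedCoordinates mbar)

/-- The range of the coordinates `(xⁱ, y^a)` on `ℳ`. -/
def baseRange : Set (EuclideanSpace ℝ (Fin m) × (Fin k → ℝ)) :=
  (fun a => c.baseCoords (C.incl a)) '' {a | C.incl a ∈ c.dom}

/-- The local lifts of `point` to `ℳ` attain all nearby coordinates. This set, rather than `psiDom`,
is the one over which `point` is known to lie in `ℳ`. -/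
theorem isOpen_baseRange : IsOpen c.baseRange := by
  rw [isOpen_iff_mem_nhds]
  rintro _ ⟨a, ha, rfl⟩
  obtain ⟨g, -, -, hg⟩ := c.exists_lift_point ha
  filter_upwards [hg] with u hu
  refine ⟨g u, hu.2.2.2, ?_⟩
  change c.baseCoords (C.incl (g u)) = u
  rw [hu.1, c.baseCoords_point hu.2.1]

theorem contDiffOn_psi (i : Fin mbar) : ContDiffOn ℝ ∞ (c.psi i) c.baseRange := by
  refine (c.psi_smooth i).mono ?_
  rintro _ ⟨a, ha, rfl⟩
  exact (c.baseCoords_mem ha).2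

/-- The Lagrangian in coordinates. -/
def lagrangian (L : TotalSpace F E → ℝ) (u : EuclideanSpace ℝ (Fin m) × (Fin k → ℝ)) : ℝ :=
  L (c.point u.1 u.2)

/-- Smoothness of `L` is only assumed along 𝒜, so it is transported through `ℳ`: near the given
coordinates `point` is the inclusion composed with a smooth lift. -/
theorem contDiffOn_lagrangian {L : TotalSpace F E → ℝ}
    (hL : ContMDiffOn ((𝓡 m).prod 𝓘(ℝ, F)) 𝓘(ℝ, ℝ) ∞ L A.affineBundle) :
    ContDiffOn ℝ ∞ (c.lagrangian L) c.baseRange := by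
  rintro _ ⟨a, ha, rfl⟩
  obtain ⟨g, hg, -, hgp⟩ := c.exists_lift_point ha
  refine ContDiffAt.contDiffWithinAt ?_
  rw [← contMDiffAt_iff_contDiffAt]
  have hLi : ContMDiff (𝓡 (m + k)) 𝓘(ℝ, ℝ) ∞ (fun a => L (C.incl a)) :=
    hL.comp_contMDiff C.incl.contMDiff C.mem_affineBundle
  refine (ContMDiffAt.comp (c.baseCoords (C.incl a)) (g := fun a => L (C.incl a)) (f := g)
    hLi.contMDiffAt hg).congr_of_eventuallyEq ?_
  filter_upwards [hgp] with u hu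
  change L (c.point u.1 u.2) = L (C.incl (g u))
  rw [hu.1]

theorem contDiffOn_pointCoeff (α : Option (Fin mbar ⊕ Fin k)) :
    ContDiffOn ℝ ∞ (c.pointCoeff α) c.baseRange := by
  rcases α with _ | i | b
  · exact contDiffOn_const
  · exact c.contDiffOn_psi i
  · refine ContDiff.contDiffOn ?_
    change ContDiff ℝ ∞ (fun u : EuclideanSpace ℝ (Fin m) × (Fin k → ℝ) => u.2 b)
    fun_prop

variable (m k mbar) in
/-- The projection to the coordinates `(xⁱ, y^a)`. -/
def basePart : CoordSpace m k mbar →L[ℝ] EuclideanSpace ℝ (Fin m) × (Fin k → ℝ) :=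
  (ContinuousLinearMap.fst ℝ _ _).prod
    ((ContinuousLinearMap.fst ℝ _ _).comp (ContinuousLinearMap.snd ℝ _ _))

variable (m k mbar) in
/-- The projection to the coordinate `φ(e_α)`. -/
def momentumPart (α : Option (Fin mbar ⊕ Fin k)) : CoordSpace m k mbar →L[ℝ] ℝ :=
  (ContinuousLinearMap.proj (R := ℝ) (φ := fun _ : Option (Fin mbar ⊕ Fin k) => ℝ) α).comp
    ((ContinuousLinearMap.snd ℝ (Fin k → ℝ) _).comp
      (ContinuousLinearMap.snd ℝ (EuclideanSpace ℝ (Fin m)) _))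

/-- The Pontryagin Hamiltonian in coordinates. -/
def coordHamiltonian (L : TotalSpace F E → ℝ) (z : CoordSpace m k mbar) : ℝ :=
  ∑ α, c.pointCoeff α (basePart m k mbar z) * z.2.2 α - c.lagrangian L (basePart m k mbar z)

theorem coeff_incl {a : M} (ha : C.incl a ∈ c.dom) (α : Option (Fin mbar ⊕ Fin k)) :
    c.isLocalFrame.coeff α (C.incl a).1 (C.incl a).2 =
      c.pointCoeff α (c.baseCoords (C.incl a)) := by
  have h := c.coeff_point (c.baseCoords_mem ha).1 α
  rwa [c.point_baseCoords ha] at h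

theorem hamiltonian_eq (L : TotalSpace F E → ℝ) {w : C.W₀} (hw : C.incl w.1 ∈ c.dom) :
    C.hamiltonian L w = c.coordHamiltonian L (c.coords w) := by
  have h1 := c.sum_coeff_frame (c.dom_subset _ hw)
  change C.covector w (C.incl w.1).2 - L (C.incl w.1) =
    ∑ α, c.pointCoeff α (c.baseCoords (C.incl w.1)) * C.covector w (c.frame α (C.nu w))
      - L (c.point (c.baseCoords (C.incl w.1)).1 (c.baseCoords (C.incl w.1)).2)
  rw [c.point_baseCoords hw]
  congr 1
  have h2 : C.covector w (C.incl w.1).2 = C.covector w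
    (∑ α, c.isLocalFrame.coeff α (C.incl w.1).1 (C.incl w.1).2 • c.frame α (C.incl w.1).1) :=
    congrArg (C.covector w) h1.symm
  refine h2.trans ((map_sum (C.covector w) _ _).trans ?_)
  refine Finset.sum_congr rfl fun α _ => ?_
  rw [c.coeff_incl hw]
  exact map_smul (C.covector w) _ _

variable {c} in
theorem basePart_coords_mem {w : C.W₀} (hw : C.incl w.1 ∈ c.dom) :
    basePart m k mbar (c.coords w) ∈ c.baseRange := ⟨w.1, hw, rfl⟩

theorem fderiv_coordHamiltonian {L : TotalSpace F E → ℝ}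
    (hL : ContMDiffOn ((𝓡 m).prod 𝓘(ℝ, F)) 𝓘(ℝ, ℝ) ∞ L A.affineBundle)
    {z : CoordSpace m k mbar} (hz : basePart m k mbar z ∈ c.baseRange)
    (v : CoordSpace m k mbar) :
    DifferentiableAt ℝ (c.coordHamiltonian L) z ∧ fderiv ℝ (c.coordHamiltonian L) z v =
      ∑ α, (c.pointCoeff α (basePart m k mbar z) * v.2.2 α +
        z.2.2 α * fderiv ℝ (c.pointCoeff α) (basePart m k mbar z) (basePart m k mbar v))
      - fderiv ℝ (c.lagrangian L) (basePart m k mbar z) (basePart m k mbar v) := by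
  have hr : HasFDerivAt (basePart m k mbar) (basePart m k mbar) z :=
    (basePart m k mbar).hasFDerivAt
  have hd {f : EuclideanSpace ℝ (Fin m) × (Fin k → ℝ) → ℝ} (hf : ContDiffOn ℝ ∞ f c.baseRange) :
      HasFDerivAt (fun z => f (basePart m k mbar z))
        ((fderiv ℝ f (basePart m k mbar z)).comp (basePart m k mbar)) z :=
    ((hf.contDiffAt (c.isOpen_baseRange.mem_nhds hz)).differentiableAt
      (by simp)).hasFDerivAt.comp z hr
  have hp (α) : HasFDerivAt (fun z : CoordSpace m k mbar => z.2.2 α)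
      (momentumPart m k mbar α) z := (momentumPart m k mbar α).hasFDerivAt
  have h := (HasFDerivAt.fun_sum (u := Finset.univ) fun α _ =>
    (hd (c.contDiffOn_pointCoeff α)).mul (hp α)).sub (hd (c.contDiffOn_lagrangian hL))
  refine ⟨h.differentiableAt, ?_⟩
  refine (DFunLike.congr_fun h.fderiv v).trans ?_
  simp [momentumPart]

theorem fderiv_pointCoeff_snd (α : Option (Fin mbar ⊕ Fin k))
    (u : EuclideanSpace ℝ (Fin m) × (Fin k → ℝ)) (b : Fin k) :
    partialY (c.pointCoeff α) b u =
      α.elim 0 (Sum.elim (fun i => partialY (c.psi i) b u) (fun a => if a = b then 1 else 0)) := by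
  rcases α with _ | i | a
  · change fderiv ℝ (fun _ => (1 : ℝ)) u _ = 0
    simp
  · rfl
  · let T := (ContinuousLinearMap.proj (R := ℝ) (φ := fun _ : Fin k => ℝ) a).comp
      (ContinuousLinearMap.snd ℝ (EuclideanSpace ℝ (Fin m)) _)
    have h : HasFDerivAt (c.pointCoeff (some (.inr a))) T u := T.hasFDerivAt
    rw [partialY, h.fderiv]
    simp [T, Pi.single_apply]

/-- The derivative of the Hamiltonian along `y^b`. -/
theorem fderiv_coordHamiltonian_y {L : TotalSpace F E → ℝ}
    (hL : ContMDiffOn ((𝓡 m).prod 𝓘(ℝ, F)) 𝓘(ℝ, ℝ) ∞ L A.affineBundle)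
    {z : CoordSpace m k mbar} (hz : basePart m k mbar z ∈ c.baseRange) (y : Fin k → ℝ) :
    fderiv ℝ (c.coordHamiltonian L) z (0, y, 0) =
      ∑ b, y b * (∑ i, z.2.2 (some (.inl i)) * partialY (c.psi i) b (basePart m k mbar z)
        + z.2.2 (some (.inr b)) - partialY (c.lagrangian L) b (basePart m k mbar z)) := by
  rw [(c.fderiv_coordHamiltonian hL hz _).2]
  change ∑ α, (_ * (0 : ℝ) + _ * fderiv ℝ (c.pointCoeff α) _ (0, y)) - fderiv ℝ _ _ (0, y) = _
  simp only [fderiv_apply_snd, mul_zero, zero_add, fderiv_pointCoeff_snd, Finset.mul_sum]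
  rw [Finset.sum_comm, ← Finset.sum_sub_distrib]
  refine Finset.sum_congr rfl fun b _ => ?_
  simp only [Fintype.sum_option, Fintype.sum_sum_type, Option.elim, Sum.elim_inl, Sum.elim_inr,
    mul_ite, mul_one, mul_zero, Finset.sum_ite_eq', Finset.mem_univ, if_true, zero_add]
  rw [mul_sub, mul_add, Finset.mul_sum, mul_comm (y b) (z.2.2 _)]
  congr 2
  exact Finset.sum_congr rfl fun i _ => by ring

theorem exists_tderiv_coords_eq {w : C.W₀} (hw : C.incl w.1 ∈ c.dom) (v : CoordSpace m k mbar) :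
    ∃ X : TangentSpace (modelW₀ m k F) w, tderiv (modelW₀ m k F) c.coords w X = v := by
  obtain ⟨K, hK, hKw, hK', -⟩ := c.exists_local_inverse hw
  exact exists_tderiv_eq hKw ((c.contMDiffAt_coords hw).mdifferentiableAt (by simp))
    (hK.mdifferentiableAt (by simp)) (hK'.mono fun z hz => hz.2) v

section Pulled

variable {EP : Type*} [NormedAddCommGroup EP] [NormedSpace ℝ EP]
  {HP : Type*} [TopologicalSpace HP] {IP : ModelWithCorners ℝ EP HP}
  {P : Type*} [TopologicalSpace P] [ChartedSpace HP P] {j : P → C.W₀} {p : P}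

theorem contMDiffAt_coords_comp (hj : ContMDiffAt IP (modelW₀ m k F) ∞ j p)
    (hp : C.incl (j p).1 ∈ c.dom) :
    ContMDiffAt IP 𝓘(ℝ, CoordSpace m k mbar) ∞ (fun q => c.coords (j q)) p :=
  ContMDiffAt.comp p (g := c.coords) (f := j) (c.contMDiffAt_coords hp) hj

theorem mfderiv_nu_comp_eq_zero_iff (hj : ContMDiffAt IP (modelW₀ m k F) ∞ j p)
    (hp : C.incl (j p).1 ∈ c.dom) (X : TangentSpace IP p) :
    mfderiv IP (𝓡 m) (C.nu ∘ j) p X = 0 ↔ (tderiv IP (fun q => c.coords (j q)) p X).1 = 0 := by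
  have h := mfderiv_eq_zero_iff c.chart_mem (ν := C.nu ∘ j) (c.dom_subset _ hp)
    ((C.contMDiff_nu.contMDiffAt.comp p hj).mdifferentiableAt (by simp)) X
  have h2 := tderiv_clm_comp (ContinuousLinearMap.fst ℝ (EuclideanSpace ℝ (Fin m)) _)
    ((c.contMDiffAt_coords_comp hj hp).mdifferentiableAt (by simp)) X
  rw [h]
  exact Eq.congr_left h2

theorem tderiv_pairSec_comp_eq (hj : ContMDiffAt IP (modelW₀ m k F) ∞ j p)
    (hp : C.incl (j p).1 ∈ c.dom) {X : TangentSpace IP p}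
    (hX : mfderiv IP (𝓡 m) (C.nu ∘ j) p X = 0) (σ : Cₛ^∞⟮𝓡 m; F, E⟯) :
    tderiv IP (pairSec σ ∘ C.pr₁ ∘ j) p X =
      ∑ α, c.isLocalFrame.coeff α (C.nu (j p)) (σ (C.nu (j p))) *
        (tderiv IP (fun q => c.coords (j q)) p X).2.2 α := by
  refine (tderiv_pairSec_eq_sum (C.contMDiff_pr₁.contMDiffAt.comp p hj) c.isLocalFrame
    c.chart.open_source (c.dom_subset _ hp) σ hX).trans ?_
  refine Finset.sum_congr rfl fun α _ => ?_
  congr 1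
  exact tderiv_clm_comp (momentumPart m k mbar α)
    ((c.contMDiffAt_coords_comp hj hp).mdifferentiableAt (by simp)) X

end Pulled

/-- The vectors tangent to the fibres of π₁ are those whose only coordinate components are along
y^b, so stationarity says ∂H/∂y^b = 0; the momentum y_b enters this equation with coefficient one.
-/
theorem mem_W₁_iff_momenta {L : TotalSpace F E → ℝ}
    (hL : ContMDiffOn ((𝓡 m).prod 𝓘(ℝ, F)) 𝓘(ℝ, ℝ) ∞ L A.affineBundle) {w : C.W₀}
    (hw : C.incl w.1 ∈ c.dom) :
    w ∈ C.W₁ L ↔ ∀ b, (c.coords w).2.2 (some (.inr b)) =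
      partialY (c.lagrangian L) b (basePart m k mbar (c.coords w))
        - ∑ i, (c.coords w).2.2 (some (.inl i)) *
          partialY (c.psi i) b (basePart m k mbar (c.coords w)) := by
  have hbase := basePart_coords_mem hw
  have hid : ContMDiffAt (modelW₀ m k F) (modelW₀ m k F) ∞ (fun w : C.W₀ => w) w := contMDiffAt_id
  have hc : MDifferentiableAt (modelW₀ m k F) 𝓘(ℝ, CoordSpace m k mbar) c.coords w :=
    (c.contMDiffAt_coords hw).mdifferentiableAt (by simp)
  have hH (X : TangentSpace (modelW₀ m k F) w) : tderiv (modelW₀ m k F) (C.hamiltonian L) w X =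
      fderiv ℝ (c.coordHamiltonian L) (c.coords w) (tderiv (modelW₀ m k F) c.coords w X) := by
    rw [← tderiv_fderiv_comp (c.fderiv_coordHamiltonian hL hbase 0).1 hc]
    refine tderiv_congr ?_ X
    filter_upwards [C.contMDiff_incl_fst.continuous.continuousAt.preimage_mem_nhds
      (c.isOpen_dom.mem_nhds hw)] with w' hw'
    exact c.hamiltonian_eq L hw'
  rw [C.mem_W₁_iff hL]
  constructor
  · intro h b
    obtain ⟨X, hX⟩ := c.exists_tderiv_coords_eq hw (0, Pi.single b 1, 0)
    have hν : mfderiv (modelW₀ m k F) (𝓡 m) C.nu w X = 0 :=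
      (c.mfderiv_nu_comp_eq_zero_iff hid hw X).2 (congrArg Prod.fst hX)
    have h1 := h X hν fun σ => by
      refine (c.tderiv_pairSec_comp_eq hid hw hν σ).trans (Finset.sum_eq_zero fun α _ => ?_)
      rw [mul_eq_zero]
      right
      exact congrFun (congrArg (fun z => z.2.2) hX) α
    rw [hH, hX, c.fderiv_coordHamiltonian_y hL hbase,
      Finset.sum_eq_single b (fun a _ ha => by simp [ha]) (by simp)] at h1
    simp only [Pi.single_eq_same, one_mul] at h1
    linarith
  · intro h X hν hσ
    have hx : (tderiv (modelW₀ m k F) c.coords w X).1 = 0 :=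
      (c.mfderiv_nu_comp_eq_zero_iff hid hw X).1 hν
    -- A section through the frame vector e_α isolates the component of `X` along the momentum
    -- φ(e_α).
    have hp : (tderiv (modelW₀ m k F) c.coords w X).2.2 = 0 := by
      classical
      funext α
      obtain ⟨σ, hσα⟩ := exists_section_through m F (c.frame α (C.nu w))
      have h1 := (c.tderiv_pairSec_comp_eq hid hw hν σ).symm.trans (hσ σ)
      have h2 (β) := c.coeff_frame (c.dom_subset _ hw) (Pi.single α 1) β
      simp only [Pi.single_apply, ite_smul, one_smul, zero_smul, Finset.sum_ite_eq',
        Finset.mem_univ, if_true] at h2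
      rw [hσα] at h1
      have h3 (β) : c.isLocalFrame.coeff β (C.nu w) (c.frame α (C.nu w)) =
        if β = α then 1 else 0 := h2 β
      simp only [h3, ite_mul, one_mul, zero_mul, Finset.sum_ite_eq', Finset.mem_univ,
        if_true] at h1
      exact h1
    have hv : tderiv (modelW₀ m k F) c.coords w X =
      (0, (tderiv (modelW₀ m k F) c.coords w X).2.1, 0) := Prod.ext hx (Prod.ext rfl hp)
    rw [hH, hv, c.fderiv_coordHamiltonian_y hL hbase]
    refine Finset.sum_eq_zero fun b _ => ?_
    rw [h b]
    ring

end AdaptedCoordinates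

end ConstraintSubmanifold

end Vakonomic

namespace Vakonomic

/-! ### W₁' as a graph over the coordinates (xⁱ, y^a, y_A). -/

namespace ConstraintSubmanifold

variable {m k mbar : ℕ}
  {Q : Type*} [TopologicalSpace Q] [T2Space Q]
  [ChartedSpace (EuclideanSpace ℝ (Fin m)) Q] [IsManifold (𝓡 m) ∞ Q]
  {F : Type*} [NormedAddCommGroup F] [NormedSpace ℝ F] [FiniteDimensional ℝ F]
  {E : Q → Type*} [TopologicalSpace (TotalSpace F E)]
  [∀ x, AddCommGroup (E x)] [∀ x, Module ℝ (E x)] [∀ x, TopologicalSpace (E x)]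
  [∀ x, IsTopologicalAddGroup (E x)] [∀ x, ContinuousSMul ℝ (E x)]
  [FiberBundle F E] [VectorBundle ℝ F E] [ContMDiffVectorBundle ∞ F E (𝓡 m)]
  {A : LieAffgebroid m F E} {M : Type*} [TopologicalSpace M]
  [ChartedSpace (EuclideanSpace ℝ (Fin (m + k))) M] [IsManifold (𝓡 (m + k)) ∞ M]
  {C : ConstraintSubmanifold A k M}

namespace AdaptedCoordinates

variable (m k mbar) in
/-- The values of the coordinates `(xⁱ, y^a, y_A)` of `W₁'`. -/
abbrev ParamSpace := EuclideanSpace ℝ (Fin m) × (Fin k → ℝ) × (Fin mbar → ℝ)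

variable (m k mbar) in
/-- The projection to the coordinates `(xⁱ, y^a)`. -/
def paramBase : ParamSpace m k mbar →L[ℝ] EuclideanSpace ℝ (Fin m) × (Fin k → ℝ) :=
  (ContinuousLinearMap.fst ℝ _ _).prod
    ((ContinuousLinearMap.fst ℝ _ _).comp (ContinuousLinearMap.snd ℝ _ _))

variable (m k mbar) in
/-- The projection to the coordinate `y_A`. -/
def paramMomentum (i : Fin mbar) : ParamSpace m k mbar →L[ℝ] ℝ :=
  (ContinuousLinearMap.proj (R := ℝ) (φ := fun _ : Fin mbar => ℝ) i).comp
    ((ContinuousLinearMap.snd ℝ (Fin k → ℝ) _).comp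
      (ContinuousLinearMap.snd ℝ (EuclideanSpace ℝ (Fin m)) _))

variable (m k mbar) in
/-- The coordinates `(xⁱ, y^a, y_A)`. -/
def param : CoordSpace m k mbar →L[ℝ] ParamSpace m k mbar :=
  (ContinuousLinearMap.fst ℝ _ _).prod
    (((ContinuousLinearMap.fst ℝ _ _).comp (ContinuousLinearMap.snd ℝ _ _)).prod
      (ContinuousLinearMap.pi fun i => momentumPart m k mbar (some (.inl i))))

variable (c : C.AdaptedCoordinates mbar)

/-- The momenta `y_a = ∂L̃/∂y^a - y_A ∂Ψ^A/∂y^a` of the points of `W₁`. -/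
def graphMomentum (L : TotalSpace F E → ℝ) (b : Fin k) (s : ParamSpace m k mbar) : ℝ :=
  partialY (c.lagrangian L) b (paramBase m k mbar s)
    - ∑ i, s.2.2 i * partialY (c.psi i) b (paramBase m k mbar s)

/-- The momentum `y₀` of the points of `W₁'`. -/
def graphEnergy (L : TotalSpace F E → ℝ) (s : ParamSpace m k mbar) : ℝ :=
  c.lagrangian L (paramBase m k mbar s) - ∑ i, c.psi i (paramBase m k mbar s) * s.2.2 i
    - ∑ b, s.2.1 b * c.graphMomentum L b s

/-- The submanifold `W₁'` in coordinates. -/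
def graph (L : TotalSpace F E → ℝ) (s : ParamSpace m k mbar) : CoordSpace m k mbar :=
  (s.1, s.2.1, fun α => α.elim (c.graphEnergy L s) (Sum.elim s.2.2 fun b => c.graphMomentum L b s))

theorem coordHamiltonian_eq (L : TotalSpace F E → ℝ) (z : CoordSpace m k mbar) :
    c.coordHamiltonian L z = z.2.2 none + (∑ i, c.psi i (basePart m k mbar z) *
      z.2.2 (some (.inl i)) + ∑ b, z.2.1 b * z.2.2 (some (.inr b)))
        - c.lagrangian L (basePart m k mbar z) := by
  simp only [coordHamiltonian, Fintype.sum_option, Fintype.sum_sum_type, pointCoeff, Option.elim,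
    Sum.elim_inl, Sum.elim_inr, one_mul]
  rfl

theorem mem_W₁'_iff {L : TotalSpace F E → ℝ}
    (hL : ContMDiffOn ((𝓡 m).prod 𝓘(ℝ, F)) 𝓘(ℝ, ℝ) ∞ L A.affineBundle) {w : C.W₀}
    (hw : C.incl w.1 ∈ c.dom) :
    w ∈ C.W₁' L ↔ c.coords w = c.graph L (param m k mbar (c.coords w)) := by
  set z := c.coords w with hz
  have hH : C.hamiltonian L w = c.coordHamiltonian L z := c.hamiltonian_eq L hw
  have key : z = c.graph L (param m k mbar z) ↔
      (∀ b, z.2.2 (some (.inr b)) = c.graphMomentum L b (param m k mbar z)) ∧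
        z.2.2 none = c.graphEnergy L (param m k mbar z) := by
    constructor
    · intro h
      have h2 : z.2.2 = (c.graph L (param m k mbar z)).2.2 := congrArg (fun z => z.2.2) h
      exact ⟨fun b => congrFun h2 _, congrFun h2 _⟩
    · rintro ⟨h1, h2⟩
      refine Prod.ext rfl (Prod.ext rfl (funext fun α => ?_))
      rcases α with _ | i | b
      · exact h2
      · rfl
      · exact h1 b
  rw [key]
  -- Once the momenta y_a are those of W₁, the equation H = 0 is solved for y₀, which occurs in H
  -- with coefficient one.
  refine (and_congr_left' (c.mem_W₁_iff_momenta hL hw)).trans (and_congr_right fun h => ?_)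
  rw [hH, coordHamiltonian_eq]
  have h' : ∀ b, z.2.2 (some (.inr b)) = c.graphMomentum L b (param m k mbar z) := h
  simp only [graphEnergy, h']
  change _ + (_ + _) - c.lagrangian L (paramBase m k mbar (param m k mbar z)) = 0 ↔ _
  change z.2.2 none + (∑ i, c.psi i (paramBase m k mbar (param m k mbar z)) *
    (param m k mbar z).2.2 i + ∑ b, (param m k mbar z).2.1 b *
      c.graphMomentum L b (param m k mbar z)) - _ = 0 ↔ _
  constructor <;> intro h <;> linarith

theorem param_graph (L : TotalSpace F E → ℝ) (s : ParamSpace m k mbar) :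
    param m k mbar (c.graph L s) = s := rfl

theorem hasFDerivAt_comp_paramBase {f : EuclideanSpace ℝ (Fin m) × (Fin k → ℝ) → ℝ}
    (hf : ContDiffOn ℝ ∞ f c.baseRange) {s : ParamSpace m k mbar}
    (hs : paramBase m k mbar s ∈ c.baseRange) :
    HasFDerivAt (fun s => f (paramBase m k mbar s))
        ((fderiv ℝ f (paramBase m k mbar s)).comp (paramBase m k mbar)) s :=
  ((hf.contDiffAt (c.isOpen_baseRange.mem_nhds hs)).differentiableAt
      (by simp)).hasFDerivAt.comp s (paramBase m k mbar).hasFDerivAt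

theorem contDiffAt_graph {L : TotalSpace F E → ℝ}
    (hL : ContMDiffOn ((𝓡 m).prod 𝓘(ℝ, F)) 𝓘(ℝ, ℝ) ∞ L A.affineBundle) {s : ParamSpace m k mbar}
    (hs : paramBase m k mbar s ∈ c.baseRange) : ContDiffAt ℝ ∞ (c.graph L) s := by
  have hd {f : EuclideanSpace ℝ (Fin m) × (Fin k → ℝ) → ℝ} (hf : ContDiffOn ℝ ∞ f c.baseRange) :
      ContDiffAt ℝ ∞ (fun s => f (paramBase m k mbar s)) s :=
    (hf.contDiffAt (c.isOpen_baseRange.mem_nhds hs)).comp s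
      (paramBase m k mbar).contDiff.contDiffAt
  have hq (i : Fin mbar) : ContDiffAt ℝ ∞ (fun s : ParamSpace m k mbar => s.2.2 i) s :=
    (paramMomentum m k mbar i).contDiff.contDiffAt
  have hm (b) : ContDiffAt ℝ ∞ (c.graphMomentum L b) s :=
    (hd (contDiffOn_partialY c.isOpen_baseRange (c.contDiffOn_lagrangian hL) b)).sub
      (ContDiffAt.sum fun i _ => (hq i).mul
        (hd (contDiffOn_partialY c.isOpen_baseRange (c.contDiffOn_psi i) b)))
  have hy (b : Fin k) : ContDiffAt ℝ ∞ (fun s : ParamSpace m k mbar => s.2.1 b) s := by fun_prop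
  have he : ContDiffAt ℝ ∞ (c.graphEnergy L) s :=
    ((hd (c.contDiffOn_lagrangian hL)).sub
      (ContDiffAt.sum fun i _ => (hd (c.contDiffOn_psi i)).mul (hq i))).sub
      (ContDiffAt.sum fun b _ => (hy b).mul (hm b))
  refine ContDiffAt.prodMk contDiffAt_fst (ContDiffAt.prodMk (by fun_prop) ?_)
  rw [contDiffAt_pi]
  rintro (_ | i | b)
  · exact he
  · exact hq i
  · exact hm b

theorem fderiv_graphMomentum {L : TotalSpace F E → ℝ}
    (hL : ContMDiffOn ((𝓡 m).prod 𝓘(ℝ, F)) 𝓘(ℝ, ℝ) ∞ L A.affineBundle) {s : ParamSpace m k mbar}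
    (hs : paramBase m k mbar s ∈ c.baseRange) (b : Fin k) (y : Fin k → ℝ) (q : Fin mbar → ℝ) :
    fderiv ℝ (c.graphMomentum L b) s (0, y, q) =
      ∑ a, y a * (partialY (partialY (c.lagrangian L) b) a (paramBase m k mbar s)
        - ∑ i, s.2.2 i * partialY (partialY (c.psi i) b) a (paramBase m k mbar s))
      - ∑ i, q i * partialY (c.psi i) b (paramBase m k mbar s) := by
  have h1 := c.hasFDerivAt_comp_paramBase
    (contDiffOn_partialY c.isOpen_baseRange (c.contDiffOn_lagrangian hL) b) hs
  have h2 (i) := c.hasFDerivAt_comp_paramBase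
    (contDiffOn_partialY c.isOpen_baseRange (c.contDiffOn_psi i) b) hs
  have hq (i : Fin mbar) : HasFDerivAt (fun s : ParamSpace m k mbar => s.2.2 i)
    (paramMomentum m k mbar i) s := (paramMomentum m k mbar i).hasFDerivAt
  have h := h1.sub (HasFDerivAt.fun_sum (u := Finset.univ) fun i _ => (hq i).mul (h2 i))
  refine (DFunLike.congr_fun h.fderiv _).trans ?_
  have hb : paramBase m k mbar (0, y, q) = (0, y) := rfl
  have hm (i) : paramMomentum m k mbar i (0, y, q) = q i := rfl
  simp only [_root_.sub_apply, _root_.sum_apply,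
    _root_.add_apply, _root_.smul_apply, ContinuousLinearMap.comp_apply,
    hb, hm, fderiv_apply_snd, smul_eq_mul, Finset.sum_add_distrib, Finset.mul_sum, mul_sub,
    Finset.sum_sub_distrib]
  rw [Finset.sum_comm (f := fun i a => s.2.2 i * _)]
  have e1 : ∀ a i, s.2.2 i * (y a * partialY (partialY (c.psi i) b) a (paramBase m k mbar s)) =
    y a * (s.2.2 i * partialY (partialY (c.psi i) b) a (paramBase m k mbar s)) := by
    intros; ring
  have e2 : ∀ i, partialY (c.psi i) b (paramBase m k mbar s) * q i =
    q i * partialY (c.psi i) b (paramBase m k mbar s) := by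
    intros; ring
  simp only [e1, e2]
  ring

/-- On `W₁` the derivative of the Hamiltonian along vectors over `Q` only involves the momenta. -/
theorem fderiv_coordHamiltonian_graph {L : TotalSpace F E → ℝ}
    (hL : ContMDiffOn ((𝓡 m).prod 𝓘(ℝ, F)) 𝓘(ℝ, ℝ) ∞ L A.affineBundle) {s : ParamSpace m k mbar}
    (hs : paramBase m k mbar s ∈ c.baseRange) (y : Fin k → ℝ)
    (r : Option (Fin mbar ⊕ Fin k) → ℝ) :
    fderiv ℝ (c.coordHamiltonian L) (c.graph L s) (0, y, r) =
      ∑ α, c.pointCoeff α (paramBase m k mbar s) * r α := by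
  have hs' : basePart m k mbar (c.graph L s) ∈ c.baseRange := hs
  have h : ((0, y, r) : CoordSpace m k mbar) = (0, y, 0) + (0, 0, r) := by simp
  rw [h, map_add, c.fderiv_coordHamiltonian_y hL hs', (c.fderiv_coordHamiltonian hL hs' _).2]
  have hb : basePart m k mbar ((0, 0, r) : CoordSpace m k mbar) = 0 := rfl
  simp only [hb, map_zero, mul_zero, add_zero, sub_zero]
  -- The part along y^b is weighted by ∂H/∂y^b, which vanishes on the graph by the very choice of
  -- `graphMomentum`.
  rw [Finset.sum_eq_zero, zero_add]
  · rfl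
  · intro b _
    change y b * (∑ i, s.2.2 i * partialY (c.psi i) b (paramBase m k mbar s)
      + c.graphMomentum L b s - partialY (c.lagrangian L) b (paramBase m k mbar s)) = 0
    rw [graphMomentum]
    ring

theorem coordHamiltonian_graph (L : TotalSpace F E → ℝ) (s : ParamSpace m k mbar) :
    c.coordHamiltonian L (c.graph L s) = 0 := by
  rw [coordHamiltonian_eq]
  change c.graphEnergy L s + (∑ i, c.psi i (paramBase m k mbar s) * s.2.2 i +
    ∑ b, s.2.1 b * c.graphMomentum L b s) - c.lagrangian L (paramBase m k mbar s) = 0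
  rw [graphEnergy]
  ring

/-- Derivative of `param_graph`: the graph is a section of the linear projection `param`. -/
theorem param_fderiv_graph {L : TotalSpace F E → ℝ}
    (hL : ContMDiffOn ((𝓡 m).prod 𝓘(ℝ, F)) 𝓘(ℝ, ℝ) ∞ L A.affineBundle) {s : ParamSpace m k mbar}
    (hs : paramBase m k mbar s ∈ c.baseRange) (v : ParamSpace m k mbar) :
    param m k mbar (fderiv ℝ (c.graph L) s v) = v := by
  have hg : DifferentiableAt ℝ (c.graph L) s :=
    (c.contDiffAt_graph hL hs).differentiableAt (by simp)
  have hp : HasFDerivAt (fun s => param m k mbar (c.graph L s))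
      ((param m k mbar).comp (fderiv ℝ (c.graph L) s)) s :=
    (param m k mbar).hasFDerivAt.comp s hg.hasFDerivAt
  exact DFunLike.congr_fun (hp.unique (hasFDerivAt_id s)) v

/-- The covector in the direction of a vector tangent to `W₁'` vanishes at the point of `ℳ`. -/
theorem sum_pointCoeff_fderiv_graph {L : TotalSpace F E → ℝ}
    (hL : ContMDiffOn ((𝓡 m).prod 𝓘(ℝ, F)) 𝓘(ℝ, ℝ) ∞ L A.affineBundle) {s : ParamSpace m k mbar}
    (hs : paramBase m k mbar s ∈ c.baseRange) (y : Fin k → ℝ) (q : Fin mbar → ℝ) :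
    ∑ α, c.pointCoeff α (paramBase m k mbar s) *
      (fderiv ℝ (c.graph L) s (0, y, q)).2.2 α = 0 := by
  have hs' : basePart m k mbar (c.graph L s) ∈ c.baseRange := hs
  have hg : DifferentiableAt ℝ (c.graph L) s :=
    (c.contDiffAt_graph hL hs).differentiableAt (by simp)
  have hp := c.param_fderiv_graph hL hs (0, y, q)
  have hp1 := congrArg Prod.fst hp
  have hp2 := congrArg (fun z => z.2.1) hp
  have hv : fderiv ℝ (c.graph L) s (0, y, q) =
      (0, y, (fderiv ℝ (c.graph L) s (0, y, q)).2.2) :=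
    Prod.ext hp1 (Prod.ext hp2 rfl)
  -- The sum is the derivative of H along a vector tangent to the graph, where H vanishes
  -- identically.
  rw [← c.fderiv_coordHamiltonian_graph hL hs y, ← hv]
  have hc : HasFDerivAt (fun s => c.coordHamiltonian L (c.graph L s))
      ((fderiv ℝ (c.coordHamiltonian L) (c.graph L s)).comp (fderiv ℝ (c.graph L) s)) s :=
    (c.fderiv_coordHamiltonian hL hs' 0).1.hasFDerivAt.comp s hg.hasFDerivAt
  have h0 : (fun s => c.coordHamiltonian L (c.graph L s)) = fun _ => (0 : ℝ) :=
    funext (c.coordHamiltonian_graph L)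
  rw [h0] at hc
  exact DFunLike.congr_fun (hc.unique (hasFDerivAt_const 0 s)) (0, y, q)

theorem fderiv_graph_inr {L : TotalSpace F E → ℝ}
    (hL : ContMDiffOn ((𝓡 m).prod 𝓘(ℝ, F)) 𝓘(ℝ, ℝ) ∞ L A.affineBundle) {s : ParamSpace m k mbar}
    (hs : paramBase m k mbar s ∈ c.baseRange) (v : ParamSpace m k mbar) (b : Fin k) :
    (fderiv ℝ (c.graph L) s v).2.2 (some (.inr b)) = fderiv ℝ (c.graphMomentum L b) s v := by
  have hg : DifferentiableAt ℝ (c.graph L) s :=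
    (c.contDiffAt_graph hL hs).differentiableAt (by simp)
  have hp : HasFDerivAt (c.graphMomentum L b)
      ((momentumPart m k mbar (some (.inr b))).comp (fderiv ℝ (c.graph L) s)) s :=
    (momentumPart m k mbar (some (.inr b))).hasFDerivAt.comp s hg.hasFDerivAt
  rw [hp.fderiv]
  rfl

end AdaptedCoordinates

end ConstraintSubmanifold

end Vakonomic

namespace Vakonomic

/-! ### Coordinates on the manifold W₁' and its vertical tangent vectors. -/

namespace ConstraintSubmanifold

variable {m k mbar : ℕ}
  {Q : Type*} [TopologicalSpace Q] [T2Space Q]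
  [ChartedSpace (EuclideanSpace ℝ (Fin m)) Q] [IsManifold (𝓡 m) ∞ Q]
  {F : Type*} [NormedAddCommGroup F] [NormedSpace ℝ F] [FiniteDimensional ℝ F]
  {E : Q → Type*} [TopologicalSpace (TotalSpace F E)]
  [∀ x, AddCommGroup (E x)] [∀ x, Module ℝ (E x)] [∀ x, TopologicalSpace (E x)]
  [∀ x, IsTopologicalAddGroup (E x)] [∀ x, ContinuousSMul ℝ (E x)]
  [FiberBundle F E] [VectorBundle ℝ F E] [ContMDiffVectorBundle ∞ F E (𝓡 m)]
  {A : LieAffgebroid m F E} {M : Type*} [TopologicalSpace M]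
  [ChartedSpace (EuclideanSpace ℝ (Fin (m + k))) M] [IsManifold (𝓡 (m + k)) ∞ M]
  {C : ConstraintSubmanifold A k M}

namespace AdaptedCoordinates

variable (c : C.AdaptedCoordinates mbar) {L : TotalSpace F E → ℝ} {d : ℕ}
  {N : Type*} [TopologicalSpace N] [ChartedSpace (EuclideanSpace ℝ (Fin d)) N]
  [IsManifold (𝓡 d) ∞ N] {j : N → C.W₀}

/-- The coordinates `(xⁱ, y^a, y_A)` on `W₁'`. -/
def paramCoords (j : N → C.W₀) (q : N) : ParamSpace m k mbar := param m k mbar (c.coords (j q))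

theorem contMDiffAt_paramCoords (hj : ContMDiff (𝓡 d) (modelW₀ m k F) ∞ j) {p : N}
    (hp : C.incl (j p).1 ∈ c.dom) :
    ContMDiffAt (𝓡 d) 𝓘(ℝ, ParamSpace m k mbar) ∞ (c.paramCoords j) p :=
  ContMDiffAt.comp p (g := param m k mbar) (f := fun q => c.coords (j q))
    (param m k mbar).contMDiff.contMDiffAt (c.contMDiffAt_coords_comp hj.contMDiffAt hp)

theorem eventually_mem_dom (hj : ContMDiff (𝓡 d) (modelW₀ m k F) ∞ j) {p : N}
    (hp : C.incl (j p).1 ∈ c.dom) : ∀ᶠ q in 𝓝 p, C.incl (j q).1 ∈ c.dom :=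
  (C.contMDiff_incl_fst.continuous.comp hj.continuous).continuousAt.preimage_mem_nhds
    (c.isOpen_dom.mem_nhds hp)

theorem coords_eq_graph (hL : ContMDiffOn ((𝓡 m).prod 𝓘(ℝ, F)) 𝓘(ℝ, ℝ) ∞ L A.affineBundle)
    (hr : Set.range j = C.W₁' L) {q : N} (hq : C.incl (j q).1 ∈ c.dom) :
    c.coords (j q) = c.graph L (c.paramCoords j q) :=
  (c.mem_W₁'_iff hL hq).1 (hr ▸ Set.mem_range_self q)

/-- `(xⁱ, y^a, y_A)` are local coordinates on `W₁'`. -/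
theorem exists_param_inverse
    (hL : ContMDiffOn ((𝓡 m).prod 𝓘(ℝ, F)) 𝓘(ℝ, ℝ) ∞ L A.affineBundle)
    (hj : IsSmoothEmbedding (𝓡 d) (modelW₀ m k F) ∞ j) (hr : Set.range j = C.W₁' L) {p : N}
    (hp : C.incl (j p).1 ∈ c.dom) :
    ∃ γ : ParamSpace m k mbar → N,
      ContMDiffAt 𝓘(ℝ, ParamSpace m k mbar) (𝓡 d) ∞ γ (c.paramCoords j p) ∧
      γ (c.paramCoords j p) = p ∧ (∀ᶠ s in 𝓝 (c.paramCoords j p), c.paramCoords j (γ s) = s) ∧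
      ∀ᶠ q in 𝓝 p, γ (c.paramCoords j q) = q := by
  have hjs : ContMDiff (𝓡 d) (modelW₀ m k F) ∞ j := hj.isImmersion.contMDiff
  obtain ⟨K, hK, hKp, hK', hK''⟩ := c.exists_local_inverse hp
  have hbase : paramBase m k mbar (c.paramCoords j p) ∈ c.baseRange :=
    basePart_coords_mem (c := c) hp
  have hgr := c.coords_eq_graph hL hr hp
  have hG := c.contDiffAt_graph hL hbase
  rw [hgr] at hK hKp hK'
  have hf : ContMDiffAt 𝓘(ℝ, ParamSpace m k mbar) (modelW₀ m k F) ∞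
      (fun s => K (c.graph L s)) (c.paramCoords j p) :=
    ContMDiffAt.comp (c.paramCoords j p) (g := K) (f := c.graph L) hK hG.contMDiffAt
  have hev : ∀ᶠ s in 𝓝 (c.paramCoords j p), C.incl (K (c.graph L s)).1 ∈ c.dom ∧
      c.coords (K (c.graph L s)) = c.graph L s := hG.continuousAt.eventually hK'
  -- The point with coordinates `graph L s` satisfies the graph equation, hence belongs to W₁',
  -- which is the range of `j`; this allows lifting through the embedding.
  have hrange : ∀ᶠ s in 𝓝 (c.paramCoords j p), K (c.graph L s) ∈ Set.range j := by
    filter_upwards [hev] with s hs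
    rw [hr]
    refine (c.mem_W₁'_iff hL hs.1).2 ?_
    rw [hs.2, c.param_graph]
  obtain ⟨γ, hγ, hγp, hjγ⟩ := hj.exists_lift hf hrange hKp.symm
  refine ⟨γ, hγ, hγp, ?_, ?_⟩
  · filter_upwards [hjγ, hev] with s h1 h2
    rw [paramCoords, h1, h2.2, c.param_graph]
  · filter_upwards [(c.contMDiffAt_paramCoords hjs hp).continuousAt.eventually hjγ,
      c.eventually_mem_dom hjs hp, hjs.continuous.continuousAt.eventually hK''] with q h1 h2 h3
    refine hj.isEmbedding.injective ?_
    rw [h1, ← c.coords_eq_graph hL hr h2, h3]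

theorem tderiv_coords_comp_eq
    (hL : ContMDiffOn ((𝓡 m).prod 𝓘(ℝ, F)) 𝓘(ℝ, ℝ) ∞ L A.affineBundle)
    (hj : ContMDiff (𝓡 d) (modelW₀ m k F) ∞ j) (hr : Set.range j = C.W₁' L) {p : N}
    (hp : C.incl (j p).1 ∈ c.dom) (X : TangentSpace (𝓡 d) p) :
    tderiv (𝓡 d) (fun q => c.coords (j q)) p X =
      fderiv ℝ (c.graph L) (c.paramCoords j p) (tderiv (𝓡 d) (c.paramCoords j) p X) := by
  have hbase : paramBase m k mbar (c.paramCoords j p) ∈ c.baseRange :=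
    basePart_coords_mem (c := c) hp
  rw [← tderiv_fderiv_comp ((c.contDiffAt_graph hL hbase).differentiableAt (by simp))
    ((c.contMDiffAt_paramCoords hj hp).mdifferentiableAt (by simp))]
  refine tderiv_congr ?_ X
  filter_upwards [c.eventually_mem_dom hj hp] with q hq using c.coords_eq_graph hL hr hq

/-- The tangent space of `W₁'` in coordinates. -/
theorem exists_tderiv_paramCoords_equiv
    (hL : ContMDiffOn ((𝓡 m).prod 𝓘(ℝ, F)) 𝓘(ℝ, ℝ) ∞ L A.affineBundle)
    (hj : IsSmoothEmbedding (𝓡 d) (modelW₀ m k F) ∞ j) (hr : Set.range j = C.W₁' L) {p : N}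
    (hp : C.incl (j p).1 ∈ c.dom) :
    ∃ e : TangentSpace (𝓡 d) p ≃ₗ[ℝ] ParamSpace m k mbar,
      ∀ X, e X = tderiv (𝓡 d) (c.paramCoords j) p X := by
  have hjs : ContMDiff (𝓡 d) (modelW₀ m k F) ∞ j := hj.isImmersion.contMDiff
  obtain ⟨γ, hγ, hγp, h1, h2⟩ := c.exists_param_inverse hL hj hr hp
  have hκ := (c.contMDiffAt_paramCoords hjs hp).mdifferentiableAt (by simp)
  let f : TangentSpace (𝓡 d) p →ₗ[ℝ] ParamSpace m k mbar :=
    { toFun := tderiv (𝓡 d) (c.paramCoords j) p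
      map_add' := tderiv_add_right _ _
      map_smul' := tderiv_smul_right _ _ }
  refine ⟨LinearEquiv.ofBijective f ⟨?_, ?_⟩, fun _ => rfl⟩
  · rw [injective_iff_map_eq_zero]
    exact fun X hX => tderiv_injective rfl hκ (hγ.mdifferentiableAt (by simp)) h2 hX
  · exact fun v => exists_tderiv_eq hγp hκ (hγ.mdifferentiableAt (by simp)) h1 v

/-- The dimension of `N` is not prescribed; it is forced by the coordinates (xⁱ, y^a, y_A) as soon
as some point lies in an adapted domain. -/
theorem finrank_of_range_eq
    (hL : ContMDiffOn ((𝓡 m).prod 𝓘(ℝ, F)) 𝓘(ℝ, ℝ) ∞ L A.affineBundle)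
    (hj : IsSmoothEmbedding (𝓡 d) (modelW₀ m k F) ∞ j) (hr : Set.range j = C.W₁' L) {p : N}
    (hp : C.incl (j p).1 ∈ c.dom) : d = m + k + mbar := by
  obtain ⟨e, -⟩ := c.exists_tderiv_paramCoords_equiv hL hj hr hp
  have h1 : finrank ℝ (TangentSpace (𝓡 d) p) = d := finrank_euclideanSpace_fin
  have h2 := e.finrank_eq
  rw [h1] at h2
  simpa [add_assoc] using h2

theorem mfderiv_nu_comp_surjective
    (hL : ContMDiffOn ((𝓡 m).prod 𝓘(ℝ, F)) 𝓘(ℝ, ℝ) ∞ L A.affineBundle)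
    (hj : IsSmoothEmbedding (𝓡 d) (modelW₀ m k F) ∞ j) (hr : Set.range j = C.W₁' L) {p : N}
    (hp : C.incl (j p).1 ∈ c.dom) :
    Function.Surjective (mfderiv (𝓡 d) (𝓡 m) (C.nu ∘ j) p) := by
  have hjs : ContMDiff (𝓡 d) (modelW₀ m k F) ∞ j := hj.isImmersion.contMDiff
  refine mfderiv_surjective_of_chart c.chart_mem (c.dom_subset _ hp)
    ((C.contMDiff_nu.comp hjs).contMDiffAt.mdifferentiableAt (by simp)) fun v => ?_
  obtain ⟨e, he⟩ := c.exists_tderiv_paramCoords_equiv hL hj hr hp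
  obtain ⟨X, hX⟩ := e.surjective (v, 0, 0)
  refine ⟨X, ?_⟩
  have h2 := tderiv_clm_comp (ContinuousLinearMap.fst ℝ (EuclideanSpace ℝ (Fin m)) _)
    ((c.contMDiffAt_paramCoords hjs hp).mdifferentiableAt (by simp)) X
  rw [← he, hX] at h2
  exact h2

theorem matrixR_eq (hL : ContMDiffOn ((𝓡 m).prod 𝓘(ℝ, F)) 𝓘(ℝ, ℝ) ∞ L A.affineBundle) {p : N}
    (hp : C.incl (j p).1 ∈ c.dom) (a b : Fin k) :
    c.matrixR L (j p) a b =
      partialY (partialY (c.lagrangian L) b) a (paramBase m k mbar (c.paramCoords j p))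
        - ∑ i, (c.paramCoords j p).2.2 i *
          partialY (partialY (c.psi i) b) a (paramBase m k mbar (c.paramCoords j p)) := by
  have hbase : (c.xCoord (j p), c.yCoord (j p)) ∈ c.baseRange :=
    basePart_coords_mem (c := c) hp
  have h1 := secondPartial_eq c.isOpen_baseRange (c.contDiffOn_lagrangian hL) hbase a b
  have h2 (i) := secondPartial_eq c.isOpen_baseRange (c.contDiffOn_psi i) hbase a b
  rw [matrixR, Matrix.of_apply]
  refine congrArg₂ (· - ·) h1 (Finset.sum_congr rfl fun i _ => ?_)
  rw [h2]
  rfl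

/-- The vertical tangent vectors of `W₁'`. -/
theorem exists_vertical
    (hL : ContMDiffOn ((𝓡 m).prod 𝓘(ℝ, F)) 𝓘(ℝ, ℝ) ∞ L A.affineBundle)
    (hj : IsSmoothEmbedding (𝓡 d) (modelW₀ m k F) ∞ j) (hr : Set.range j = C.W₁' L) {p : N}
    (hp : C.incl (j p).1 ∈ c.dom) (y : Fin k → ℝ) (q : Fin mbar → ℝ) :
    ∃ X : TangentSpace (𝓡 d) p, (X = 0 → y = 0) ∧ mfderiv (𝓡 d) (𝓡 m) (C.nu ∘ j) p X = 0 ∧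
      ∃ r : Option (Fin mbar ⊕ Fin k) → ℝ, (∀ i, r (some (.inl i)) = q i) ∧
        (∀ b, r (some (.inr b)) = Matrix.vecMul y (c.matrixR L (j p)) b -
          ∑ i, q i * partialY (c.psi i) b (paramBase m k mbar (c.paramCoords j p))) ∧
        ∑ α, c.isLocalFrame.coeff α (C.incl (j p).1).1 (C.incl (j p).1).2 * r α = 0 ∧
        ∀ σ : Cₛ^∞⟮𝓡 m; F, E⟯, tderiv (𝓡 d) (pairSec σ ∘ C.pr₁ ∘ j) p X =
          ∑ α, c.isLocalFrame.coeff α (C.nu (j p)) (σ (C.nu (j p))) * r α := by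
  have hjs : ContMDiff (𝓡 d) (modelW₀ m k F) ∞ j := hj.isImmersion.contMDiff
  have hbase : paramBase m k mbar (c.paramCoords j p) ∈ c.baseRange :=
    basePart_coords_mem (c := c) hp
  obtain ⟨e, he⟩ := c.exists_tderiv_paramCoords_equiv hL hj hr hp
  -- `X` has components 0, `y`, `q` along xⁱ, y^a, y_A, and `r` is the resulting variation of the
  -- momenta φ(e_α) along the graph.
  obtain ⟨X, hX⟩ := e.surjective (0, y, q)
  have hd := c.tderiv_coords_comp_eq hL hjs hr hp X
  rw [← he, hX] at hd
  have hpar := c.param_fderiv_graph hL hbase (0, y, q)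
  have hx : (fderiv ℝ (c.graph L) (c.paramCoords j p) (0, y, q)).1 = 0 := by
    have := congrArg Prod.fst hpar
    exact this
  have hν : mfderiv (𝓡 d) (𝓡 m) (C.nu ∘ j) p X = 0 := by
    rw [c.mfderiv_nu_comp_eq_zero_iff hjs.contMDiffAt hp, hd, hx]
  refine ⟨X, fun h0 => ?_, hν, (fderiv ℝ (c.graph L) (c.paramCoords j p) (0, y, q)).2.2,
    fun i => ?_, fun b => ?_, ?_, fun σ => ?_⟩
  · rw [h0, map_zero] at hX
    have := congrArg (fun z => z.2.1) hX
    exact this.symm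
  · have := congrFun (congrArg (fun z => z.2.2) hpar) i
    exact this
  · rw [c.fderiv_graph_inr hL hbase, c.fderiv_graphMomentum hL hbase]
    congr 1
    refine Finset.sum_congr rfl fun a _ => ?_
    exact congrArg (y a * ·) (c.matrixR_eq hL hp a b).symm
  · rw [← c.sum_pointCoeff_fderiv_graph hL hbase y q]
    refine Finset.sum_congr rfl fun α _ => ?_
    rw [c.coeff_incl hp]
    rfl
  · have := c.tderiv_pairSec_comp_eq hjs.contMDiffAt hp hν σ
    rw [hd] at this
    exact this

/-- If the matrix `R` is degenerate, some nonzero vector tangent to `W₁'` is in the kernel. -/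
theorem exists_kernel_of_det_eq_zero
    (hL : ContMDiffOn ((𝓡 m).prod 𝓘(ℝ, F)) 𝓘(ℝ, ℝ) ∞ L A.affineBundle)
    (hj : IsSmoothEmbedding (𝓡 d) (modelW₀ m k F) ∞ j) (hr : Set.range j = C.W₁' L) {p : N}
    (hp : C.incl (j p).1 ∈ c.dom) (hdet : (c.matrixR L (j p)).det = 0) :
    ∃ X : TangentSpace (𝓡 d) p, X ≠ 0 ∧ mfderiv (𝓡 d) (𝓡 m) (C.nu ∘ j) p X = 0 ∧
      ∀ σ : Cₛ^∞⟮𝓡 m; F, E⟯, tderiv (𝓡 d) (pairSec σ ∘ C.pr₁ ∘ j) p X = 0 := by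
  -- With `q = 0` and `y` in the left kernel of R, the variations of the momenta y_A and y_a vanish.
  obtain ⟨y, hy, hyR⟩ := Matrix.exists_vecMul_eq_zero_iff.2 hdet
  obtain ⟨X, hX, hν, r, h1, h2, h3, h4⟩ := c.exists_vertical hL hj hr hp y 0
  refine ⟨X, fun h => hy (hX h), hν, fun σ => ?_⟩
  have hr0 : ∀ α, r α = 0 := by
    have hl (i) : r (some (.inl i)) = 0 := h1 i
    have hrr (b) : r (some (.inr b)) = 0 := by rw [h2, hyR]; simp
    rintro (_ | i | b)
    -- The variation of y₀ vanishes too: in the relation r(a) = 0 it is the only term left, with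
    -- coefficient 1_𝒜(a) = 1.
    · simp only [Fintype.sum_option, Fintype.sum_sum_type, hl, hrr, mul_zero,
        Finset.sum_const_zero, add_zero] at h3
      rwa [c.coeff_none (c.dom_subset _ hp), C.mem_affineBundle, one_mul] at h3
    · exact hl i
    · exact hrr b
  rw [h4]
  simp [hr0]

/-- If the matrix `R` is regular, the vectors tangent to `W₁'` and vertical over `Q` realize all
covectors vanishing at the point of `ℳ`. -/
theorem exists_vertical_of_det_ne_zero
    (hL : ContMDiffOn ((𝓡 m).prod 𝓘(ℝ, F)) 𝓘(ℝ, ℝ) ∞ L A.affineBundle)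
    (hj : IsSmoothEmbedding (𝓡 d) (modelW₀ m k F) ∞ j) (hr : Set.range j = C.W₁' L) {p : N}
    (hp : C.incl (j p).1 ∈ c.dom) (hdet : (c.matrixR L (j p)).det ≠ 0)
    (β : E (C.nu (j p)) →ₗ[ℝ] ℝ) (hβ : β (C.incl (j p).1).2 = 0) :
    ∃ X : TangentSpace (𝓡 d) p, mfderiv (𝓡 d) (𝓡 m) (C.nu ∘ j) p X = 0 ∧
      ∀ σ : Cₛ^∞⟮𝓡 m; F, E⟯,
        tderiv (𝓡 d) (pairSec σ ∘ C.pr₁ ∘ j) p X = β (σ (C.nu (j p))) := by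
  let q : Fin mbar → ℝ := fun i => β (c.frame (some (.inl i)) (C.nu (j p)))
  -- The required value of `yR`: the components of `β` along e_b, corrected by the contribution of
  -- `q` to the variation of y_b. Invertibility of R then yields `y`.
  let t : Fin k → ℝ := fun b => β (c.frame (some (.inr b)) (C.nu (j p))) +
    ∑ i, q i * partialY (c.psi i) b (paramBase m k mbar (c.paramCoords j p))
  have hy : Matrix.vecMul (Matrix.vecMul t (c.matrixR L (j p))⁻¹) (c.matrixR L (j p)) = t := by
    rw [Matrix.vecMul_vecMul, Matrix.nonsing_inv_mul _ (isUnit_iff_ne_zero.2 hdet),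
      Matrix.vecMul_one]
  obtain ⟨X, -, hν, r, h1, h2, h3, h4⟩ := c.exists_vertical hL hj hr hp
    (Matrix.vecMul t (c.matrixR L (j p))⁻¹) q
  have hsum (v : TotalSpace F E) (hv : v.1 = C.nu (j p)) (β : E v.1 →ₗ[ℝ] ℝ) :
      ∑ α, c.isLocalFrame.coeff α v.1 v.2 * β (c.frame α v.1) = β v.2 := by
    conv_rhs => rw [← c.sum_coeff_frame (v := v) (hv ▸ c.dom_subset _ hp), map_sum]
    simp
  have hrβ : ∀ α, r α = β (c.frame α (C.nu (j p))) := by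
    have hl (i) : r (some (.inl i)) = β (c.frame (some (.inl i)) (C.nu (j p))) := h1 i
    have hrr (b) : r (some (.inr b)) = β (c.frame (some (.inr b)) (C.nu (j p))) := by
      rw [h2, hy]; simp [t]
    rintro (_ | i | b)
    -- The component along e₀ cannot be prescribed; it matches because `r` and `β` both annihilate
    -- the point of 𝒜, whose e₀-component is 1.
    · have h5 := (hsum (C.incl (j p).1) rfl β).trans hβ
      have h6 : (1 : ℝ) = c.isLocalFrame.coeff none (C.incl (j p).1).1 (C.incl (j p).1).2 := by
        rw [c.coeff_none (c.dom_subset _ hp), C.mem_affineBundle]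
      rw [Fintype.sum_option, Fintype.sum_sum_type, ← h6] at h3 h5
      simp only [hl, hrr] at h3
      have h7 := h3.trans h5.symm
      rw [one_mul, one_mul] at h7
      exact add_right_cancel h7
    · exact hl i
    · exact hrr b
  refine ⟨X, hν, fun σ => ?_⟩
  rw [h4]
  simp only [hrβ]
  exact hsum ⟨C.nu (j p), σ (C.nu (j p))⟩ rfl β

end AdaptedCoordinates

end ConstraintSubmanifold

end Vakonomic

namespace Vakonomic

/-! ### Nondegeneracy of η ∧ Ωⁿ on W₁' in terms of the matrix R. -/

namespace ConstraintSubmanifold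

variable {m k mbar : ℕ}
  {Q : Type*} [TopologicalSpace Q] [T2Space Q]
  [ChartedSpace (EuclideanSpace ℝ (Fin m)) Q] [IsManifold (𝓡 m) ∞ Q]
  {F : Type*} [NormedAddCommGroup F] [NormedSpace ℝ F] [FiniteDimensional ℝ F]
  {E : Q → Type*} [TopologicalSpace (TotalSpace F E)]
  [∀ x, AddCommGroup (E x)] [∀ x, Module ℝ (E x)] [∀ x, TopologicalSpace (E x)]
  [∀ x, IsTopologicalAddGroup (E x)] [∀ x, ContinuousSMul ℝ (E x)]
  [FiberBundle F E] [VectorBundle ℝ F E] [ContMDiffVectorBundle ∞ F E (𝓡 m)]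
  {A : LieAffgebroid m F E} {M : Type*} [TopologicalSpace M]
  [ChartedSpace (EuclideanSpace ℝ (Fin (m + k))) M] [IsManifold (𝓡 (m + k)) ∞ M]
  {C : ConstraintSubmanifold A k M}

variable {L : TotalSpace F E → ℝ} {d : ℕ}
  {N : Type*} [TopologicalSpace N] [ChartedSpace (EuclideanSpace ℝ (Fin d)) N]
  [IsManifold (𝓡 d) ∞ N] {j : N → C.W₀}

theorem hamiltonian_eq_zero_of_range_eq (hr : Set.range j = C.W₁' L) (p : N) :
    C.hamiltonian L (j p) = 0 :=
  (hr ▸ Set.mem_range_self p : j p ∈ C.W₁' L).2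

/-- The restriction of `Ω_{W₀}` to a fibre of the prolongation over `W₁'`. -/
theorem exists_bilinear_OmegaW₀
    (hL : ContMDiffOn ((𝓡 m).prod 𝓘(ℝ, F)) 𝓘(ℝ, ℝ) ∞ L A.affineBundle)
    (hj : ContMDiff (𝓡 d) (modelW₀ m k F) ∞ j) (hr : Set.range j = C.W₁' L) (p : N) :
    ∃ B : prolongFiber (𝓡 d) A.toLieAlgebroid (C.nu ∘ j) p →ₗ[ℝ]
        prolongFiber (𝓡 d) A.toLieAlgebroid (C.nu ∘ j) p →ₗ[ℝ] ℝ,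
      (∀ z z', B z z' = TwoSection.pullback (𝓡 d) j (C.OmegaW₀ L) p z z') ∧
      (∀ z z', B z z' = - B z' z) ∧
      ∀ (z : prolongFiber (𝓡 d) A.toLieAlgebroid (C.nu ∘ j) p) (σ : Cₛ^∞⟮𝓡 m; F, E⟯)
        (X : TangentSpace (𝓡 d) p) (hX : mfderiv (𝓡 d) (𝓡 m) (C.nu ∘ j) p X = 0),
        z.1.1 = σ (C.nu (j p)) → B z ⟨(0, X), (map_zero _).trans hX.symm⟩ =
          tderiv (𝓡 d) (pairSec σ ∘ C.pr₁ ∘ j) p X := by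
  have hΘ := C.isCanonicalPullback_pullback_OmegaW₀ hL hj (hamiltonian_eq_zero_of_range_eq hr)
  have hΦ : MDifferentiableAt (𝓡 d) (dualModel m F) (C.pr₁ ∘ j) p :=
    (C.contMDiff_pr₁.comp hj).contMDiffAt.mdifferentiableAt (by simp)
  obtain ⟨B, hB, hskew⟩ : ∃ B : prolongFiber (𝓡 d) A.toLieAlgebroid (C.nu ∘ j) p →ₗ[ℝ]
        prolongFiber (𝓡 d) A.toLieAlgebroid (C.nu ∘ j) p →ₗ[ℝ] ℝ,
      (∀ z z', B z z' = TwoSection.pullback (𝓡 d) j (C.OmegaW₀ L) p z z') ∧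
      ∀ z z', B z z' = - B z' z := hΘ.exists_bilinear hΦ
  refine ⟨B, hB, hskew, ?_⟩
  rintro ⟨⟨e, Y⟩, hY⟩ σ X hX he
  obtain rfl : e = σ (C.nu (j p)) := he
  exact (hB _ _).trans (hΘ.apply_vertical hY hX)

variable (A) in
/-- The restriction of `η` to a fibre of the prolongation over `W₁'`. -/
def etaFiber (ν : N → Q) (p : N) : prolongFiber (𝓡 d) A.toLieAlgebroid ν p →ₗ[ℝ] ℝ :=
  (A.one (ν p)).toLinearMap ∘ₗ LinearMap.fst ℝ _ _ ∘ₗ Submodule.subtype _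

/-- The fibre is the kernel of (e, X) ↦ ρ(e) − Tν(X), a map onto the tangent space of `Q` when `ν`
is submersive at `p`. -/
theorem finrank_prolongFiber {ν : N → Q} {p : N}
    (hν : Function.Surjective (mfderiv (𝓡 d) (𝓡 m) ν p)) :
    FiniteDimensional ℝ (prolongFiber (𝓡 d) A.toLieAlgebroid ν p) ∧
    finrank ℝ (prolongFiber (𝓡 d) A.toLieAlgebroid ν p) + m = finrank ℝ F + d := by
  have h1 : FiniteDimensional ℝ (E (ν p)) := (fiberEquiv F E (ν p)).symm.finiteDimensional
  have h2 : FiniteDimensional ℝ (TangentSpace (𝓡 d) p) :=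
    inferInstanceAs (FiniteDimensional ℝ (EuclideanSpace ℝ (Fin d)))
  have h3 : finrank ℝ (TangentSpace (𝓡 d) p) = d := finrank_euclideanSpace_fin
  have h4 : finrank ℝ (TangentSpace (𝓡 m) (ν p)) = m := finrank_euclideanSpace_fin
  refine ⟨inferInstance, ?_⟩
  let f : E (ν p) × TangentSpace (𝓡 d) p →ₗ[ℝ] TangentSpace (𝓡 m) (ν p) :=
    (A.anchor (ν p)).toLinearMap ∘ₗ LinearMap.fst ℝ _ _ -
      (mfderiv (𝓡 d) (𝓡 m) ν p).toLinearMap ∘ₗ LinearMap.snd ℝ _ _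
  have hker : LinearMap.ker f = prolongFiber (𝓡 d) A.toLieAlgebroid ν p := by
    ext z
    exact sub_eq_zero
  have hrange : LinearMap.range f = ⊤ := by
    rw [LinearMap.range_eq_top]
    intro v
    obtain ⟨X, hX⟩ := hν (-v)
    refine ⟨(0, X), ?_⟩
    change A.anchor (ν p) 0 - mfderiv (𝓡 d) (𝓡 m) ν p X = v
    rw [hX, map_zero]
    simp
  have h := f.finrank_range_add_finrank_ker
  rw [hrange, finrank_top, hker, Module.finrank_prod, h3, h4, finrank_fiber F E] at h
  omega

theorem det_matrixR_ne_zero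
    (hF : finrank ℝ F = mbar + k + 1)
    (hL : ContMDiffOn ((𝓡 m).prod 𝓘(ℝ, F)) 𝓘(ℝ, ℝ) ∞ L A.affineBundle)
    (hj : IsSmoothEmbedding (𝓡 d) (modelW₀ m k F) ∞ j) (hr : Set.range j = C.W₁' L)
    (c : C.AdaptedCoordinates mbar) {p : N} (hp : C.incl (j p).1 ∈ c.dom)
    (hnd : ∃ v : Fin (2 * (mbar + k) + 1) → E ((C.nu ∘ j) p) × TangentSpace (𝓡 d) p,
      (∀ i, v i ∈ prolongFiber (𝓡 d) A.toLieAlgebroid (C.nu ∘ j) p) ∧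
      wedgePow (mbar + k) (OneSection.pullback (𝓡 d) j C.eta p)
        (TwoSection.pullback (𝓡 d) j (C.OmegaW₀ L) p) v ≠ 0) :
    (c.matrixR L (j p)).det ≠ 0 := by
  intro hdet
  have hjs : ContMDiff (𝓡 d) (modelW₀ m k F) ∞ j := hj.isImmersion.contMDiff
  obtain ⟨X, hX, hν, hσ⟩ := c.exists_kernel_of_det_eq_zero hL hj hr hp hdet
  obtain ⟨B, hB, hskew, hvert⟩ := exists_bilinear_OmegaW₀ hL hjs hr p
  obtain ⟨v, hv, hne⟩ := hnd
  obtain ⟨hfd, hrk⟩ := finrank_prolongFiber (A := A) (c.mfderiv_nu_comp_surjective hL hj hr hp)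
  have hdim := c.finrank_of_range_eq hL hj hr hp
  let Z : prolongFiber (𝓡 d) A.toLieAlgebroid (C.nu ∘ j) p := ⟨(0, X), (map_zero _).trans hν.symm⟩
  have hZ : Z ≠ 0 := fun h => hX (congrArg (fun z => z.1.2) h)
  have hr' (z) : B z Z = 0 := by
    obtain ⟨σ, hσz⟩ := exists_section_through m F z.1.1
    exact (hvert z σ X hν hσz.symm).trans (hσ σ)
  -- The fibre has dimension (mbar + k + 1) + (m + k + mbar) − m = 2 (mbar + k) + 1, so the form has
  -- top degree and `Z`, in the kernels of both η and Ω, kills it.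
  have h0 := wedgePow_eq_zero (n := mbar + k) (by omega) (etaFiber A (C.nu ∘ j) p) B hZ
    (map_zero (A.one (C.nu (j p)))) (fun z => by rw [hskew, hr', neg_zero]) hr'
    (fun i => ⟨v i, hv i⟩)
  refine hne (Eq.trans ?_ h0)
  refine Finset.sum_congr rfl fun σ _ => ?_
  simp only [hB]
  rfl

theorem exists_wedgePow_pullback_ne_zero
    (hF : finrank ℝ F = mbar + k + 1)
    (hL : ContMDiffOn ((𝓡 m).prod 𝓘(ℝ, F)) 𝓘(ℝ, ℝ) ∞ L A.affineBundle)
    (hj : IsSmoothEmbedding (𝓡 d) (modelW₀ m k F) ∞ j) (hr : Set.range j = C.W₁' L)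
    (c : C.AdaptedCoordinates mbar) {p : N} (hp : C.incl (j p).1 ∈ c.dom)
    (hdet : (c.matrixR L (j p)).det ≠ 0) :
    ∃ v : Fin (2 * (mbar + k) + 1) → E ((C.nu ∘ j) p) × TangentSpace (𝓡 d) p,
      (∀ i, v i ∈ prolongFiber (𝓡 d) A.toLieAlgebroid (C.nu ∘ j) p) ∧
      wedgePow (mbar + k) (OneSection.pullback (𝓡 d) j C.eta p)
        (TwoSection.pullback (𝓡 d) j (C.OmegaW₀ L) p) v ≠ 0 := by
  have hjs : ContMDiff (𝓡 d) (modelW₀ m k F) ∞ j := hj.isImmersion.contMDiff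
  obtain ⟨B, hB, hskew, hvert⟩ := exists_bilinear_OmegaW₀ hL hjs hr p
  have hsurj := c.mfderiv_nu_comp_surjective hL hj hr hp
  have hfd : FiniteDimensional ℝ (E (C.nu (j p))) :=
    (fiberEquiv F E (C.nu (j p))).symm.finiteDimensional
  let one : E (C.nu (j p)) →ₗ[ℝ] ℝ := (A.one (C.nu (j p))).toLinearMap
  let a : E (C.nu (j p)) := (C.incl (j p).1).2
  have ha : one a = 1 := C.mem_affineBundle (j p).1
  have hrange : LinearMap.range one = ⊤ := LinearMap.range_eq_top.2 fun t => ⟨t • a, by simp [ha]⟩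
  have hker : finrank ℝ (LinearMap.ker one) = mbar + k := by
    have := one.finrank_range_add_finrank_ker
    rw [hrange, finrank_top, finrank_fiber F E, hF, Module.finrank_self] at this
    omega
  let b : Basis (Fin (mbar + k)) ℝ (LinearMap.ker one) := finBasisOfFinrankEq ℝ _ hker
  -- Projection onto ker 1_𝒜 along `a`; composed with it, functionals on ker 1_𝒜 become the
  -- covectors annihilating `a`.
  let pr : E (C.nu (j p)) →ₗ[ℝ] LinearMap.ker one :=
    (LinearMap.id - one.smulRight a).codRestrict _ fun v => by simp [ha]
  have hpr (v : LinearMap.ker one) : pr v = v := by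
    refine Subtype.ext ?_
    have hv : one v = 0 := v.2
    change (v : E (C.nu (j p))) - one v • a = v
    rw [hv, zero_smul, sub_zero]
  have hpra : pr a = 0 := by
    refine Subtype.ext ?_
    change a - one a • a = 0
    rw [ha, one_smul, sub_self]
  -- The vertical vectors realizing the dual basis of `b`, extended by zero on `a`.
  choose X hX hXσ using fun i => c.exists_vertical_of_det_ne_zero hL hj hr hp hdet
    (b.coord i ∘ₗ pr) (by change b.coord i (pr a) = 0; rw [hpra, map_zero])
  choose Y hY using fun v => hsurj (A.anchor (C.nu (j p)) v)
  let V := prolongFiber (𝓡 d) A.toLieAlgebroid (C.nu ∘ j) p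
  let lift (v : E (C.nu (j p))) : V := ⟨(v, Y v), (hY v).symm⟩
  let f (i : Fin (mbar + k)) : V := ⟨(0, X i), (map_zero _).trans (hX i).symm⟩
  -- The lift of `a` has η equal to one; lifts of the basis `b` are paired by Ω with the vertical
  -- vectors. The latter are isotropic, since a vertical vector sees only the component in `E` of
  -- the other argument. The lifts themselves need not be isotropic.
  obtain ⟨v, hv⟩ := exists_wedgePow_ne_zero (n := mbar + k) (etaFiber A (C.nu ∘ j) p) B hskew
    (ξ := lift a) (e := fun i => lift (b i)) (f := f) ha (fun i => (b i).2)
    (fun i => map_zero (A.one (C.nu (j p))))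
    (fun i l => by
      obtain ⟨σ, hσ⟩ := exists_section_through m F (b i : E (C.nu (j p)))
      rw [hvert _ σ (X l) (hX l) hσ.symm, hXσ, hσ]
      change b.coord l (pr (b i)) = _
      rw [hpr, Basis.coord_apply, Basis.repr_self, Finsupp.single_apply])
    (fun i l => by
      rw [hvert _ 0 (X l) (hX l) rfl, hXσ]
      exact map_zero _)
  refine ⟨fun i => v i, fun i => (v i).2, fun h0 => hv (Eq.trans ?_ h0)⟩
  refine Finset.sum_congr rfl fun σ _ => ?_
  simp only [hB]
  rfl

end ConstraintSubmanifold

end Vakonomic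

namespace Vakonomic

/-! ### A basis in which the last k components are coordinates. -/

section LinearAlgebra

/-- A basis of `ℝⁿ` adapted to the image of the kernel of a surjective linear map. -/
theorem exists_basis_bijective {mbar k : ℕ} {W V U : Type*} [AddCommGroup W] [Module ℝ W]
    [FiniteDimensional ℝ W] [AddCommGroup V] [Module ℝ V] [FiniteDimensional ℝ V] [AddCommGroup U]
    [Module ℝ U] [FiniteDimensional ℝ U] (hU : finrank ℝ U = mbar + k)
    (hW : finrank ℝ W = finrank ℝ V + k) (p : W →ₗ[ℝ] V) (hp : Function.Surjective p)
    (D : W →ₗ[ℝ] U) (hD : ∀ X, p X = 0 → D X = 0 → X = 0) :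
    ∃ b : Basis (Fin mbar ⊕ Fin k) ℝ U,
      Function.Bijective (fun X => (p X, fun a => b.repr (D X) (Sum.inr a))) := by
  have hk : finrank ℝ (LinearMap.ker p) = k := by
    have h := p.finrank_range_add_finrank_ker
    rw [LinearMap.range_eq_top.2 hp, finrank_top] at h
    omega
  let S : Submodule ℝ U := LinearMap.range (D.domRestrict (LinearMap.ker p))
  have hS : finrank ℝ S = k := by
    rw [LinearMap.finrank_range_of_inj, hk]
    rw [injective_iff_map_eq_zero]
    exact fun X hX => Subtype.ext (hD X X.2 hX)
  obtain ⟨S', hS'⟩ := Submodule.exists_isCompl S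
  have hS'' : finrank ℝ S' = mbar := by
    have := Submodule.finrank_add_eq_of_isCompl hS'
    omega
  -- The second block spans `S`, the image of ker p, so on ker p the first block of components of
  -- `D` vanishes and the second alone detects a vector.
  let b : Basis (Fin mbar ⊕ Fin k) ℝ U :=
    ((finBasisOfFinrankEq ℝ S' hS'').prod (finBasisOfFinrankEq ℝ S hS)).map
      (Submodule.prodEquivOfIsCompl S' S hS'.symm)
  have hb (v : U) (hv : v ∈ S) (i : Fin mbar) : b.repr v (Sum.inl i) = 0 := by
    simp only [b, Basis.map_repr, LinearEquiv.trans_apply, Basis.prod_repr_inl]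
    have := Submodule.prodEquivOfIsCompl_symm_apply_right S' S hS'.symm ⟨v, hv⟩
    rw [this]
    simp
  refine ⟨b, ?_⟩
  let f : W →ₗ[ℝ] V × (Fin k → ℝ) := p.prod (LinearMap.pi fun a => b.coord (Sum.inr a) ∘ₗ D)
  have hf : Function.Injective f := by
    rw [injective_iff_map_eq_zero]
    intro X hX
    have h1 : p X = 0 := congrArg Prod.fst hX
    have h2 (a) : b.repr (D X) (Sum.inr a) = 0 := congrFun (congrArg Prod.snd hX) a
    refine hD X h1 ?_
    rw [← b.repr.map_eq_zero_iff]
    ext s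
    rcases s with i | a
    · exact hb _ ⟨⟨X, h1⟩, rfl⟩ i
    · exact h2 a
  have hdim : finrank ℝ W = finrank ℝ (V × (Fin k → ℝ)) := by
    rw [Module.finrank_prod, hW, Module.finrank_fin_fun]
  exact ⟨hf, (LinearMap.injective_iff_surjective_of_finrank_eq_finrank hdim).1 hf⟩

end LinearAlgebra

/-! ### Inverse function theorem with inverse smooth on an open set. -/

section InverseFunction

variable {V W : Type*} [NormedAddCommGroup V] [NormedSpace ℝ V] [NormedAddCommGroup W]
  [NormedSpace ℝ W] [CompleteSpace V]

/-- The inverse function theorem with a smooth inverse on an open set. -/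
theorem exists_smooth_inverse {f : V → W} {O : Set V} (hO : IsOpen O) (hf : ContDiffOn ℝ ∞ f O)
    {a : V} (ha : a ∈ O) (e : V ≃L[ℝ] W) (he : fderiv ℝ f a = e) :
    ∃ H : OpenPartialHomeomorph V W, a ∈ H.source ∧ H.source ⊆ O ∧ (∀ x, H x = f x) ∧
      ContDiffOn ℝ ∞ H.symm H.target := by
  have hfa : ContDiffAt ℝ ∞ f a := hf.contDiffAt (hO.mem_nhds ha)
  have hda : HasFDerivAt f (e : V →L[ℝ] W) a := he ▸ (hfa.differentiableAt (by simp)).hasFDerivAt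
  let H₀ := hfa.toOpenPartialHomeomorph f hda (by simp)
  have hcont : ContinuousOn (fderiv ℝ f) O := hf.continuousOn_fderiv_of_isOpen hO (by simp)
  let O' : Set V := O ∩ fderiv ℝ f ⁻¹' Set.range ((↑) : (V ≃L[ℝ] W) → V →L[ℝ] W)
  have hO' : IsOpen O' := hcont.isOpen_inter_preimage hO ContinuousLinearEquiv.isOpen
  have haO' : a ∈ O' := ⟨ha, e, he.symm⟩
  have hsrc : (H₀.restrOpen O' hO').source = H₀.source ∩ O' := H₀.restrOpen_source O' hO'
  refine ⟨H₀.restrOpen O' hO', ?_, ?_, fun x => rfl, ?_⟩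
  · rw [hsrc]
    exact ⟨hfa.mem_toOpenPartialHomeomorph_source hda (by simp), haO'⟩
  · rw [hsrc]
    exact fun x hx => hx.2.1
  · intro y hy
    have hx := (H₀.restrOpen O' hO').map_target hy
    rw [hsrc] at hx
    obtain ⟨-, hxO, e', he'⟩ := hx
    have hfx := hf.contDiffAt (hO.mem_nhds hxO)
    refine ((H₀.restrOpen O' hO').contDiffAt_symm hy (f₀' := e') ?_ hfx).contDiffWithinAt
    rw [he']
    exact (hfx.differentiableAt (by simp)).hasFDerivAt

end InverseFunction

/-! ### Local frames adapted to the cocycle 1_𝒜. -/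

section Frames

variable {m : ℕ}
  {Q : Type*} [TopologicalSpace Q]
  [ChartedSpace (EuclideanSpace ℝ (Fin m)) Q] [IsManifold (𝓡 m) ∞ Q]
  {F : Type*} [NormedAddCommGroup F] [NormedSpace ℝ F] [FiniteDimensional ℝ F]
  {E : Q → Type*} [TopologicalSpace (TotalSpace F E)]
  [∀ x, AddCommGroup (E x)] [∀ x, Module ℝ (E x)] [∀ x, TopologicalSpace (E x)]
  [FiberBundle F E] [VectorBundle ℝ F E] [ContMDiffVectorBundle ∞ F E (𝓡 m)]

/-- Smooth sections whose spans contain a local frame form a local frame. -/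
theorem isLocalFrameOn_of_span {ι ι' : Type*} [Fintype ι] [Fintype ι']
    (hι : Fintype.card ι' = Fintype.card ι) {s : ι → (x : Q) → E x} {s' : ι' → (x : Q) → E x}
    {u u' : Set Q} (hs : IsLocalFrameOn (𝓡 m) F ∞ s u) (hu : u' ⊆ u)
    (hsm : ∀ i, ContMDiffOn (𝓡 m) ((𝓡 m).prod 𝓘(ℝ, F)) ∞
      (fun x => (⟨x, s' i x⟩ : TotalSpace F E)) u')
    (hspan : ∀ x ∈ u', ∀ i, s i x ∈ Submodule.span ℝ (Set.range (s' · x))) :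
    IsLocalFrameOn (𝓡 m) F ∞ s' u' := by
  have hgen {x : Q} (hx : x ∈ u') : ⊤ ≤ Submodule.span ℝ (Set.range (s' · x)) := by
    refine (hs.generating (hu hx)).trans (Submodule.span_le.2 ?_)
    rintro _ ⟨i, rfl⟩
    exact hspan x hx i
  exact
    { linearIndependent := fun {x} hx => linearIndependent_of_top_le_span_of_card_eq_finrank
        (hgen hx) (hι.trans (Module.finrank_eq_card_basis (hs.toBasisAt (hu hx))).symm)
      generating := hgen
      contMDiffOn := hsm }

/-- In any local frame some member has 1_𝒜 nonzero at x₀, hence nearby. Put first and normalized it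
is e₀; subtracting multiples of it from the others makes 1_𝒜 vanish on them without changing the
span. -/
theorem exists_adapted_frame (A : LieAffgebroid m F E) {n : ℕ} (hF : finrank ℝ F = n + 1) (x₀ : Q) :
    ∃ (u : Set Q) (s : Option (Fin n) → (x : Q) → E x), IsOpen u ∧ x₀ ∈ u ∧
      IsLocalFrameOn (𝓡 m) F ∞ s u ∧ (∀ x ∈ u, A.one x (s none x) = 1) ∧
      ∀ x ∈ u, ∀ i, A.one x (s (some i) x) = 0 := by
  classical
  let e := trivializationAt F E x₀
  have hx₀ : x₀ ∈ e.baseSet := FiberBundle.mem_baseSet_trivializationAt F E x₀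
  let b : Basis (Option (Fin n)) ℝ F := (finBasisOfFinrankEq ℝ F hF).reindex (finSuccEquiv n)
  have hε := e.isLocalFrameOn_localFrame_baseSet (𝓡 m) ∞ b
  obtain ⟨α₀, hα₀⟩ : ∃ α, A.one x₀ (e.localFrame b α x₀) ≠ 0 := by
    by_contra! h
    refine A.one_ne_zero x₀ (ContinuousLinearMap.coe_injective
      ((hε.toBasisAt hx₀).ext fun α => ?_))
    rw [hε.toBasisAt_coe hx₀]
    exact h α
  let ε : Option (Fin n) → (x : Q) → E x := fun α => e.localFrame b (Equiv.swap none α₀ α)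
  have hεsm (α) : ContMDiffOn (𝓡 m) ((𝓡 m).prod 𝓘(ℝ, F)) ∞
      (fun x => (⟨x, ε α x⟩ : TotalSpace F E)) e.baseSet := hε.contMDiffOn _
  let g : Option (Fin n) → Q → ℝ := fun α x => A.one x (ε α x)
  have hg (α) : ContMDiffOn (𝓡 m) 𝓘(ℝ, ℝ) ∞ (g α) e.baseSet :=
    A.one_smooth.comp_contMDiffOn (hεsm α)
  let u : Set Q := e.baseSet ∩ g none ⁻¹' {0}ᶜ
  have hu : IsOpen u := (hg none).continuousOn.isOpen_inter_preimage e.open_baseSet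
    isOpen_compl_singleton
  let t : (x : Q) → E x := fun x => (g none x)⁻¹ • ε none x
  let s : Option (Fin n) → (x : Q) → E x := fun α =>
    α.elim t fun i x => ε (some i) x - g (some i) x • t x
  have ht : ContMDiffOn (𝓡 m) ((𝓡 m).prod 𝓘(ℝ, F)) ∞ (fun x => (⟨x, t x⟩ : TotalSpace F E)) u :=
    (((hg none).mono Set.inter_subset_left).inv₀ fun x hx => hx.2).smul_section
      ((hεsm none).mono Set.inter_subset_left)
  have hone (x : Q) (hx : x ∈ u) : A.one x (t x) = 1 := by
    have h : g none x ≠ 0 := hx.2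
    change A.one x ((g none x)⁻¹ • ε none x) = 1
    rw [map_smul, smul_eq_mul]
    exact inv_mul_cancel₀ h
  refine ⟨u, s, hu, ⟨hx₀, ?_⟩, isLocalFrameOn_of_span rfl hε Set.inter_subset_left ?_ ?_, hone, ?_⟩
  · change A.one x₀ (ε none x₀) ≠ 0
    simpa [ε] using hα₀
  · rintro (_ | i)
    · exact ht
    · exact ((hεsm _).mono Set.inter_subset_left).sub_section
        (((hg _).mono Set.inter_subset_left).smul_section ht)
  · intro x hx
    have h0 : t x ∈ Submodule.span ℝ (Set.range (s · x)) := Submodule.subset_span ⟨none, rfl⟩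
    have h1 : ∀ α, ε α x ∈ Submodule.span ℝ (Set.range (s · x)) := by
      rintro (_ | i)
      · have h : ε none x = g none x • t x := by
          change _ = g none x • ((g none x)⁻¹ • ε none x)
          rw [smul_inv_smul₀ hx.2]
        rw [h]
        exact Submodule.smul_mem _ _ h0
      · have h : ε (some i) x = s (some i) x + g (some i) x • t x := by
          change _ = ε (some i) x - g (some i) x • t x + _
          rw [sub_add_cancel]
        rw [h]
        exact Submodule.add_mem _ (Submodule.subset_span ⟨some i, rfl⟩)
          (Submodule.smul_mem _ _ h0)
    intro α
    have := h1 (Equiv.swap none α₀ α)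
    simpa [ε] using this
  · intro x hx i
    change A.one x (ε (some i) x - g (some i) x • t x) = 0
    rw [map_sub, map_smul, hone x hx, smul_eq_mul, mul_one]
    exact sub_self _

end Frames

end Vakonomic

namespace Vakonomic

/-! ### A frame in which xⁱ and the components y^a have bijective differential on ℳ. -/

namespace ConstraintSubmanifold

variable {m k mbar : ℕ}
  {Q : Type*} [TopologicalSpace Q] [T2Space Q]
  [ChartedSpace (EuclideanSpace ℝ (Fin m)) Q] [IsManifold (𝓡 m) ∞ Q]
  {F : Type*} [NormedAddCommGroup F] [NormedSpace ℝ F] [FiniteDimensional ℝ F]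
  {E : Q → Type*} [TopologicalSpace (TotalSpace F E)]
  [∀ x, AddCommGroup (E x)] [∀ x, Module ℝ (E x)] [∀ x, TopologicalSpace (E x)]
  [∀ x, IsTopologicalAddGroup (E x)] [∀ x, ContinuousSMul ℝ (E x)]
  [FiberBundle F E] [VectorBundle ℝ F E] [ContMDiffVectorBundle ∞ F E (𝓡 m)]
  {A : LieAffgebroid m F E} {M : Type*} [TopologicalSpace M]
  [ChartedSpace (EuclideanSpace ℝ (Fin (m + k))) M] [IsManifold (𝓡 (m + k)) ∞ M]
  (C : ConstraintSubmanifold A k M)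

section Components

variable {ι : Type*} [Fintype ι] {s : ι → (x : Q) → E x}
  {χ : OpenPartialHomeomorph Q (EuclideanSpace ℝ (Fin m))}

/-- The vector with given position in a chart and given components in a frame. -/
def ofComponents (s : ι → (x : Q) → E x)
    (χ : OpenPartialHomeomorph Q (EuclideanSpace ℝ (Fin m)))
    (z : EuclideanSpace ℝ (Fin m) × (ι → ℝ)) : TotalSpace F E :=
  ⟨χ.symm z.1, ∑ i, z.2 i • s i (χ.symm z.1)⟩

theorem ofComponents_coeff (hs : IsLocalFrameOn (𝓡 m) F ∞ s χ.source) {v : TotalSpace F E}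
    (hv : v.1 ∈ χ.source) : ofComponents s χ (χ v.1, fun i => hs.coeff i v.1 v.2) = v := by
  obtain ⟨x, v⟩ := v
  have hx : χ.symm (χ x) = x := χ.left_inv hv
  change (⟨χ.symm (χ x), ∑ i, hs.coeff i x v • s i (χ.symm (χ x))⟩ : TotalSpace F E) = _
  rw [hx, hs.sum_coeff_smul hv]

theorem one_eq_coeff {κ : Type*} [Fintype κ] {t : Option κ → (x : Q) → E x} {u : Set Q}
    (ht : IsLocalFrameOn (𝓡 m) F ∞ t u) {x : Q} (hx : x ∈ u) (h1 : A.one x (t none x) = 1)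
    (h0 : ∀ i, A.one x (t (some i) x) = 0) (v : E x) : A.one x v = ht.coeff none x v := by
  conv_lhs => rw [← ht.sum_coeff_smul hx v]
  simp [Fintype.sum_option, h1, h0]

theorem contMDiffAt_ofComponents (hχ : χ ∈ IsManifold.maximalAtlas (𝓡 m) ∞ Q)
    (hs : IsLocalFrameOn (𝓡 m) F ∞ s χ.source) {z : EuclideanSpace ℝ (Fin m) × (ι → ℝ)}
    (hz : z.1 ∈ χ.target) :
    ContMDiffAt 𝓘(ℝ, EuclideanSpace ℝ (Fin m) × (ι → ℝ)) ((𝓡 m).prod 𝓘(ℝ, F)) ∞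
      (ofComponents (F := F) s χ) z := by
  refine contMDiffAt_sum_smul ?_ (fun i => ?_) fun i => ?_
  · exact ContMDiffAt.comp z (g := χ.symm) (f := Prod.fst)
      (contMDiffAt_symm_of_mem_maximalAtlas hχ hz) contDiff_fst.contMDiff.contMDiffAt
  · exact hs.contMDiffAt χ.open_source (χ.map_target hz) i
  · rw [contMDiffAt_iff_contDiffAt]
    fun_prop

/-- The components in a chart and a frame of a point of `ℳ`. -/
def components (hs : IsLocalFrameOn (𝓡 m) F ∞ s χ.source) (a : M) : ι → ℝ :=
  fun i => hs.coeff i (C.incl a).1 (C.incl a).2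

theorem contMDiffAt_components (hs : IsLocalFrameOn (𝓡 m) F ∞ s χ.source) {a : M}
    (ha : C.proj a ∈ χ.source) :
    ContMDiffAt (𝓡 (m + k)) 𝓘(ℝ, ι → ℝ) ∞ (C.components hs) a :=
  contMDiffAt_pi_space.2 fun i => ContMDiffAt.comp a
    (g := fun v : TotalSpace F E => hs.coeff i v.1 v.2) (f := C.incl)
    (hs.contMDiffAt_coeff χ.open_source ha i) C.incl.contMDiff.contMDiffAt

theorem contMDiffAt_chart_proj (hχ : χ ∈ IsManifold.maximalAtlas (𝓡 m) ∞ Q) {a : M}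
    (ha : C.proj a ∈ χ.source) :
    ContMDiffAt (𝓡 (m + k)) 𝓘(ℝ, EuclideanSpace ℝ (Fin m)) ∞ (fun a => χ (C.proj a)) a :=
  ContMDiffAt.comp a (g := χ) (f := C.proj) (contMDiffAt_of_mem_maximalAtlas hχ ha)
    C.proj.contMDiff.contMDiffAt

theorem tderiv_prodMk {EP : Type*} [NormedAddCommGroup EP] [NormedSpace ℝ EP]
    {HP : Type*} [TopologicalSpace HP] {IP : ModelWithCorners ℝ EP HP}
    {P : Type*} [TopologicalSpace P] [ChartedSpace HP P]
    {G G' : Type*} [NormedAddCommGroup G] [NormedSpace ℝ G] [NormedAddCommGroup G']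
    [NormedSpace ℝ G'] {f : P → G} {g : P → G'} {p : P}
    (hf : ContMDiffAt IP 𝓘(ℝ, G) ∞ f p) (hg : ContMDiffAt IP 𝓘(ℝ, G') ∞ g p)
    (X : TangentSpace IP p) :
    tderiv IP (fun q => (f q, g q)) p X = (tderiv IP f p X, tderiv IP g p X) := by
  have h : MDifferentiableAt IP 𝓘(ℝ, G × G') (fun q => (f q, g q)) p :=
    (hf.prodMk_space hg).mdifferentiableAt (by simp)
  exact Prod.ext (tderiv_clm_comp (ContinuousLinearMap.fst ℝ G G') h X).symm
    (tderiv_clm_comp (ContinuousLinearMap.snd ℝ G G') h X).symm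

/-- A tangent vector of `ℳ` is determined by its components. -/
theorem eq_zero_of_tderiv_components_eq_zero (hχ : χ ∈ IsManifold.maximalAtlas (𝓡 m) ∞ Q)
    (hs : IsLocalFrameOn (𝓡 m) F ∞ s χ.source) {a : M} (ha : C.proj a ∈ χ.source)
    {X : TangentSpace (𝓡 (m + k)) a}
    (h₁ : tderiv (𝓡 (m + k)) (fun a => χ (C.proj a)) a X = 0)
    (h₂ : tderiv (𝓡 (m + k)) (C.components hs) a X = 0) : X = 0 := by
  -- The inclusion factors locally through position and components, so its differential kills `X`;
  -- an immersion then forces `X = 0`.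
  refine (C.isEmbedding.isImmersion.isImmersionAt a).mfderiv_injective ?_
  let κ : M → EuclideanSpace ℝ (Fin m) × (ι → ℝ) := fun a => (χ (C.proj a), C.components hs a)
  have hκ : MDifferentiableAt (𝓡 (m + k)) 𝓘(ℝ, EuclideanSpace ℝ (Fin m) × (ι → ℝ)) κ a :=
    ((C.contMDiffAt_chart_proj hχ ha).prodMk_space
      (C.contMDiffAt_components hs ha)).mdifferentiableAt (by simp)
  have hX : tderiv (𝓡 (m + k)) κ a X = 0 := by
    rw [tderiv_prodMk (C.contMDiffAt_chart_proj hχ ha) (C.contMDiffAt_components hs ha), h₁, h₂]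
    rfl
  have hof : MDifferentiableAt 𝓘(ℝ, EuclideanSpace ℝ (Fin m) × (ι → ℝ)) ((𝓡 m).prod 𝓘(ℝ, F))
      (ofComponents (F := F) s χ) (κ a) :=
    (contMDiffAt_ofComponents hχ hs (χ.map_source ha)).mdifferentiableAt (by simp)
  have hev : C.incl =ᶠ[𝓝 a] ofComponents s χ ∘ κ := by
    filter_upwards [C.proj.contMDiff.continuous.continuousAt.preimage_mem_nhds
      (χ.open_source.mem_nhds ha)] with b hb
    exact (ofComponents_coeff hs hb).symm
  have h3 := mfderiv_comp_apply a hof hκ X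
  have h4 : mfderiv (𝓡 (m + k)) ((𝓡 m).prod 𝓘(ℝ, F)) C.incl a X =
      mfderiv (𝓡 (m + k)) ((𝓡 m).prod 𝓘(ℝ, F)) (ofComponents s χ ∘ κ) a X :=
    DFunLike.congr_fun hev.mfderiv_eq X
  have h5 := (congrArg (mfderiv 𝓘(ℝ, EuclideanSpace ℝ (Fin m) × (ι → ℝ)) ((𝓡 m).prod 𝓘(ℝ, F))
    (ofComponents (F := F) s χ) (κ a)) hX).trans (map_zero _)
  exact (h4.trans (h3.trans h5)).trans (map_zero _).symm

end Components

/-- Around each point of `ℳ` there is an adapted frame, in which the coordinates of `Q` and some of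
the components are coordinates of `ℳ`. -/
theorem exists_frame_bijective (hF : finrank ℝ F = mbar + k + 1) (a₀ : M) :
    ∃ (χ : OpenPartialHomeomorph Q (EuclideanSpace ℝ (Fin m)))
      (s : Option (Fin mbar ⊕ Fin k) → (x : Q) → E x)
      (hs : IsLocalFrameOn (𝓡 m) F ∞ s χ.source),
      χ ∈ IsManifold.maximalAtlas (𝓡 m) ∞ Q ∧ C.proj a₀ ∈ χ.source ∧
      (∀ x ∈ χ.source, A.one x (s none x) = 1) ∧
      (∀ x ∈ χ.source, ∀ i, A.one x (s (some i) x) = 0) ∧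
      Function.Bijective (tderiv (𝓡 (m + k))
        (fun a => (χ (C.proj a), fun i : Fin k => C.components hs a (some (.inr i)))) a₀) := by
  obtain ⟨u, t, hu, hxu, ht, ht1, ht0⟩ := exists_adapted_frame A hF (C.proj a₀)
  let χ : OpenPartialHomeomorph Q (EuclideanSpace ℝ (Fin m)) := (chartAt _ (C.proj a₀)).restr u
  have hχsrc : χ.source = (chartAt (EuclideanSpace ℝ (Fin m)) (C.proj a₀)).source ∩ u := by
    rw [OpenPartialHomeomorph.restr_source, hu.interior_eq]
  have hχ : χ ∈ IsManifold.maximalAtlas (𝓡 m) ∞ Q :=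
    restr_mem_maximalAtlas _ (IsManifold.chart_mem_maximalAtlas _) hu
  have hx₀ : C.proj a₀ ∈ χ.source := by rw [hχsrc]; exact ⟨mem_chart_source _ _, hxu⟩
  have hsub : χ.source ⊆ u := by rw [hχsrc]; exact Set.inter_subset_right
  have ht' := ht.mono hsub
  have hp := C.contMDiffAt_chart_proj hχ hx₀
  have hc := C.contMDiffAt_components ht' hx₀
  let p : TangentSpace (𝓡 (m + k)) a₀ →ₗ[ℝ] EuclideanSpace ℝ (Fin m) :=
    { toFun := tderiv (𝓡 (m + k)) (fun a => χ (C.proj a)) a₀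
      map_add' := tderiv_add_right _ _
      map_smul' := tderiv_smul_right _ _ }
  let R : (Option (Fin (mbar + k)) → ℝ) →L[ℝ] (Fin (mbar + k) → ℝ) :=
    ContinuousLinearMap.pi fun i => ContinuousLinearMap.proj (some i)
  let D₀ : TangentSpace (𝓡 (m + k)) a₀ →ₗ[ℝ] (Option (Fin (mbar + k)) → ℝ) :=
    { toFun := tderiv (𝓡 (m + k)) (C.components ht') a₀
      map_add' := tderiv_add_right _ _
      map_smul' := tderiv_smul_right _ _ }
  let D : TangentSpace (𝓡 (m + k)) a₀ →ₗ[ℝ] (Fin (mbar + k) → ℝ) := R.toLinearMap ∘ₗ D₀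
  have : FiniteDimensional ℝ (TangentSpace (𝓡 (m + k)) a₀) :=
    inferInstanceAs (FiniteDimensional ℝ (EuclideanSpace ℝ (Fin (m + k))))
  have hW : finrank ℝ (TangentSpace (𝓡 (m + k)) a₀) =
      finrank ℝ (EuclideanSpace ℝ (Fin m)) + k := by
    rw [finrank_euclideanSpace_fin]
    exact finrank_euclideanSpace_fin
  have hsurj : Function.Surjective p := by
    intro v
    have hχd : MDifferentiableAt (𝓡 m) 𝓘(ℝ, EuclideanSpace ℝ (Fin m)) χ (C.proj a₀) :=
      (contMDiffAt_of_mem_maximalAtlas hχ hx₀).mdifferentiableAt (by simp)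
    have hχs : MDifferentiableAt 𝓘(ℝ, EuclideanSpace ℝ (Fin m)) (𝓡 m) χ.symm (χ (C.proj a₀)) :=
      (contMDiffAt_symm_of_mem_maximalAtlas hχ (χ.map_source hx₀)).mdifferentiableAt (by simp)
    obtain ⟨Y, hY⟩ := exists_tderiv_eq (χ.left_inv hx₀) hχd hχs
      (by filter_upwards [χ.open_target.mem_nhds (χ.map_source hx₀)] with y hy using χ.right_inv hy)
      v
    obtain ⟨X, hX⟩ := (C.isSubmersion.isSubmersionAt a₀).mfderiv_surjective Y
    refine ⟨X, ?_⟩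
    have h : tderiv (𝓡 (m + k)) (fun a => χ (C.proj a)) a₀ X =
        tderiv (𝓡 m) χ (C.proj a₀) (mfderiv (𝓡 (m + k)) (𝓡 m) C.proj a₀ X) :=
      tderiv_comp hχd (C.proj.contMDiff.contMDiffAt.mdifferentiableAt (by simp)) X
    refine h.trans (Eq.trans ?_ hY)
    exact congrArg (tderiv (𝓡 m) χ (C.proj a₀)) hX
  -- On 𝒜 the component along e₀ is 1_𝒜 and so constantly one; dropping it through `R` loses no
  -- tangential information.
  have hnone (X : TangentSpace (𝓡 (m + k)) a₀) : D₀ X none = 0 := by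
    have h1 := tderiv_clm_comp (ContinuousLinearMap.proj (R := ℝ)
      (φ := fun _ : Option (Fin (mbar + k)) => ℝ) none) (hc.mdifferentiableAt (by simp)) X
    refine h1.symm.trans ?_
    rw [tderiv_congr (g := fun _ => (1 : ℝ)), tderiv_const]
    filter_upwards [C.proj.contMDiff.continuous.continuousAt.preimage_mem_nhds
      (χ.open_source.mem_nhds hx₀)] with a ha
    change ht'.coeff none (C.incl a).1 (C.incl a).2 = 1
    have h2 : A.one (C.incl a).1 (C.incl a).2 = 1 := C.mem_affineBundle a
    have ha' : (C.incl a).1 ∈ χ.source := ha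
    exact (one_eq_coeff ht' ha' (ht1 _ (hsub ha')) (ht0 _ (hsub ha')) _).symm.trans h2
  obtain ⟨b, hb⟩ := exists_basis_bijective (mbar := mbar) (k := k) (by simp) hW p hsurj D (by
    intro X h1 h2
    refine C.eq_zero_of_tderiv_components_eq_zero hχ ht' hx₀ h1 ?_
    change D₀ X = 0
    funext α
    rcases α with _ | i
    · exact hnone X
    · exact congrFun h2 i)
  -- e₀ is kept and the remaining members are recombined with constant coefficients, so that the new
  -- components are the coordinates in `b` of the old ones and 1_𝒜 still vanishes on them.
  let s : Option (Fin mbar ⊕ Fin k) → (x : Q) → E x := fun α x =>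
    α.elim (t none x) fun σ => ∑ i, b σ i • t (some i) x
  have hcomb (c : Fin (mbar + k) → ℝ) (x : Q) :
      ∑ σ, b.repr c σ • s (some σ) x = ∑ i, c i • t (some i) x := by
    simp only [s, Option.elim, Finset.smul_sum, smul_smul]
    rw [Finset.sum_comm]
    refine Finset.sum_congr rfl fun i _ => ?_
    rw [← Finset.sum_smul]
    congr 1
    have := congrFun (b.sum_repr c) i
    simpa using this
  have hs : IsLocalFrameOn (𝓡 m) F ∞ s χ.source := by
    refine isLocalFrameOn_of_span (by simp) ht' subset_rfl ?_ ?_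
    · rintro (_ | σ)
      · exact ht'.contMDiffOn none
      · intro x hx
        exact (contMDiffAt_sum_smul (b := fun x => x) contMDiffAt_id
          (fun i => ht'.contMDiffAt χ.open_source hx (some i))
          fun i => contMDiffAt_const).contMDiffWithinAt
    · rintro x - (_ | i)
      · exact Submodule.subset_span ⟨none, rfl⟩
      · have h := hcomb (Pi.single i 1) x
        simp only [Pi.single_apply, ite_smul, one_smul, zero_smul, Finset.sum_ite_eq',
          Finset.mem_univ, if_true] at h
        rw [← h]
        exact Submodule.sum_mem _ fun σ _ => Submodule.smul_mem _ _
          (Submodule.subset_span ⟨some σ, rfl⟩)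
  have hcoeff (x : Q) (hx : x ∈ χ.source) (v : E x) (σ) :
      hs.coeff (some σ) x v = b.repr (fun i => ht'.coeff (some i) x v) σ := by
    have h : v = ∑ α, (α.elim (ht'.coeff none x v)
        fun σ => b.repr (fun i => ht'.coeff (some i) x v) σ) • s α x := by
      rw [Fintype.sum_option]
      simp only [Option.elim]
      rw [hcomb]
      conv_lhs => rw [← ht'.sum_coeff_smul hx v, Fintype.sum_option]
      rfl
    conv_lhs => rw [h]
    exact hs.coeff_sum_smul hx _ (some σ)
  refine ⟨χ, s, hs, hχ, hx₀, fun x hx => ht1 x (hsub hx), fun x hx i => ?_, ?_⟩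
  · change A.one x (∑ l, b i l • t (some l) x) = 0
    rw [map_sum]
    simp [ht0 x (hsub hx)]
  · have hcs := C.contMDiffAt_components hs hx₀
    let T : (Option (Fin mbar ⊕ Fin k) → ℝ) →L[ℝ] (Fin k → ℝ) :=
      ContinuousLinearMap.pi fun i => ContinuousLinearMap.proj (some (.inr i))
    have hT : ContMDiffAt (𝓡 (m + k)) 𝓘(ℝ, Fin k → ℝ) ∞ (fun a => T (C.components hs a)) a₀ :=
      ContMDiffAt.comp a₀ (g := T) (f := C.components hs) T.contMDiff.contMDiffAt hcs
    let T' : (Option (Fin (mbar + k)) → ℝ) →L[ℝ] (Fin k → ℝ) :=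
      (ContinuousLinearMap.pi fun i =>
        (LinearMap.toContinuousLinearMap (b.coord (.inr i)))).comp R
    have hTT' : (fun a => T (C.components hs a)) =ᶠ[𝓝 a₀] fun a => T' (C.components ht' a) := by
      filter_upwards [C.proj.contMDiff.continuous.continuousAt.preimage_mem_nhds
        (χ.open_source.mem_nhds hx₀)] with a ha
      funext i
      exact hcoeff _ ha _ (.inr i)
    convert hb using 1
    funext X
    refine (tderiv_prodMk hp hT X).trans (Prod.ext rfl ?_)
    change tderiv (𝓡 (m + k)) (fun a => T (C.components hs a)) a₀ X = _
    rw [tderiv_congr hTT', tderiv_clm_comp T' (hc.mdifferentiableAt (by simp))]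
    rfl

end ConstraintSubmanifold

end Vakonomic

namespace Vakonomic

/-! ### Existence of adapted coordinates around each point of ℳ. -/

namespace ConstraintSubmanifold

variable {m k mbar : ℕ}
  {Q : Type*} [TopologicalSpace Q] [T2Space Q]
  [ChartedSpace (EuclideanSpace ℝ (Fin m)) Q] [IsManifold (𝓡 m) ∞ Q]
  {F : Type*} [NormedAddCommGroup F] [NormedSpace ℝ F] [FiniteDimensional ℝ F]
  {E : Q → Type*} [TopologicalSpace (TotalSpace F E)]
  [∀ x, AddCommGroup (E x)] [∀ x, Module ℝ (E x)] [∀ x, TopologicalSpace (E x)]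
  [∀ x, IsTopologicalAddGroup (E x)] [∀ x, ContinuousSMul ℝ (E x)]
  [FiberBundle F E] [VectorBundle ℝ F E] [ContMDiffVectorBundle ∞ F E (𝓡 m)]
  {A : LieAffgebroid m F E} {M : Type*} [TopologicalSpace M]
  [ChartedSpace (EuclideanSpace ℝ (Fin (m + k))) M] [IsManifold (𝓡 (m + k)) ∞ M]
  (C : ConstraintSubmanifold A k M)

/-- Around each point of `ℳ` there are adapted coordinates. -/
theorem exists_adaptedCoordinates (hF : finrank ℝ F = mbar + k + 1) (a₀ : M) :
    ∃ c : C.AdaptedCoordinates mbar, C.incl a₀ ∈ c.dom := by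
  obtain ⟨χ, s, hs, hχ, ha₀, hs1, hs0, hbij⟩ := C.exists_frame_bijective hF a₀
  let V := EuclideanSpace ℝ (Fin (m + k))
  let W := EuclideanSpace ℝ (Fin m) × (Fin k → ℝ)
  let κ : M → W := fun a => (χ (C.proj a), fun i : Fin k => C.components hs a (some (.inr i)))
  let T : (Option (Fin mbar ⊕ Fin k) → ℝ) →L[ℝ] (Fin k → ℝ) :=
    ContinuousLinearMap.pi fun i => ContinuousLinearMap.proj (some (.inr i))
  have hκ {a : M} (ha : C.proj a ∈ χ.source) : ContMDiffAt (𝓡 (m + k)) 𝓘(ℝ, W) ∞ κ a :=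
    (C.contMDiffAt_chart_proj hχ ha).prodMk_space
      (ContMDiffAt.comp a (g := T) (f := C.components hs) T.contMDiff.contMDiffAt
        (C.contMDiffAt_components hs ha))
  let φ : OpenPartialHomeomorph M V := chartAt V a₀
  have hφm : φ ∈ IsManifold.maximalAtlas (𝓡 (m + k)) ∞ M := IsManifold.chart_mem_maximalAtlas a₀
  have hφ₀ : a₀ ∈ φ.source := mem_chart_source V a₀
  have hφ {a : M} (ha : a ∈ φ.source) : ContMDiffAt (𝓡 (m + k)) 𝓘(ℝ, V) ∞ φ a :=
    contMDiffAt_of_mem_maximalAtlas hφm ha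
  have hφs {z : V} (hz : z ∈ φ.target) : ContMDiffAt 𝓘(ℝ, V) (𝓡 (m + k)) ∞ φ.symm z :=
    contMDiffAt_symm_of_mem_maximalAtlas hφm hz
  let f : V → W := fun z => κ (φ.symm z)
  let O : Set V := φ.target ∩ φ.symm ⁻¹' (C.proj ⁻¹' χ.source)
  have hO : IsOpen O := φ.symm.isOpen_inter_preimage
    (χ.open_source.preimage C.proj.contMDiff.continuous)
  have hf : ContDiffOn ℝ ∞ f O := by
    intro z hz
    refine ContDiffAt.contDiffWithinAt (contMDiffAt_iff_contDiffAt.1 ?_)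
    exact ContMDiffAt.comp z (g := κ) (f := φ.symm) (hκ hz.2) (hφs hz.1)
  have hφφ : φ.symm (φ a₀) = a₀ := φ.left_inv hφ₀
  have haO : φ a₀ ∈ O := ⟨φ.map_source hφ₀, by
    change C.proj (φ.symm (φ a₀)) ∈ χ.source
    rw [hφφ]
    exact ha₀⟩
  have hsurj : Function.Surjective (fderiv ℝ f (φ a₀)) := by
    intro z
    obtain ⟨X, hX⟩ := hbij.2 z
    refine ⟨tderiv (𝓡 (m + k)) φ a₀ X, ?_⟩
    rw [← tderiv_fderiv_comp ((hf.contDiffAt (hO.mem_nhds haO)).differentiableAt (by simp))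
      ((hφ hφ₀).mdifferentiableAt (by simp)), ← hX]
    refine tderiv_congr ?_ X
    filter_upwards [φ.open_source.mem_nhds hφ₀] with a ha
    exact congrArg κ (φ.left_inv ha)
  have hdim : finrank ℝ V = finrank ℝ W := by
    rw [Module.finrank_prod, Module.finrank_fin_fun, finrank_euclideanSpace_fin (𝕜 := ℝ)]
    exact congrArg (· + k) (finrank_euclideanSpace_fin (𝕜 := ℝ)).symm
  have hinj : Function.Injective (fderiv ℝ f (φ a₀)) :=
    (LinearMap.injective_iff_surjective_of_finrank_eq_finrank
      (f := (fderiv ℝ f (φ a₀)).toLinearMap) hdim).2 hsurj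
  let e : V ≃L[ℝ] W := (LinearEquiv.ofBijective (fderiv ℝ f (φ a₀)).toLinearMap
    ⟨hinj, hsurj⟩).toContinuousLinearEquiv
  obtain ⟨H, haH, hHO, hHf, hHs⟩ := exists_smooth_inverse hO hf haO e (ContinuousLinearMap.ext fun _ => rfl)
  let l : W → M := fun z => φ.symm (H.symm z)
  have hl {z : W} (hz : z ∈ H.target) : ContMDiffAt 𝓘(ℝ, W) (𝓡 (m + k)) ∞ l z := by
    refine ContMDiffAt.comp z (g := φ.symm) (f := H.symm) (hφs (hHO (H.map_target hz)).1) ?_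
    exact (hHs.contDiffAt (H.open_target.mem_nhds hz)).contMDiffAt
  have hlχ {z : W} (hz : z ∈ H.target) : C.proj (l z) ∈ χ.source := (hHO (H.map_target hz)).2
  have hκl {z : W} (hz : z ∈ H.target) : κ (l z) = z := (hHf _).symm.trans (H.right_inv hz)
  let S : Set M := φ.source ∩ φ ⁻¹' H.source
  have hS : IsOpen S := φ.isOpen_inter_preimage H.open_source
  have hlκ {a : M} (ha : a ∈ S) : l (κ a) = a := by
    have h : κ a = H (φ a) := by
      rw [hHf]
      exact congrArg κ (φ.left_inv ha.1).symm
    change φ.symm (H.symm (κ a)) = a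
    rw [h, H.left_inv ha.2, φ.left_inv ha.1]
  have hκH {a : M} (ha : a ∈ S) : κ a ∈ H.target := by
    have h : κ a = H (φ a) := by
      rw [hHf]
      exact congrArg κ (φ.left_inv ha.1).symm
    rw [h]
    exact H.map_source ha.2
  -- Embeddedness enters here: an open part of `ℳ` is cut out by an open set of the total space, so
  -- that no other sheet of `ℳ` meets the domain.
  obtain ⟨O', hO', hO'S⟩ := C.isEmbedding.isEmbedding.isInducing.isOpen_iff.1 hS
  let base : TotalSpace F E → W := fun v => (χ v.1, fun a => hs.coeff (some (.inr a)) v.1 v.2)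
  let U : Set (TotalSpace F E) := TotalSpace.proj ⁻¹' χ.source
  have hU : IsOpen U := χ.open_source.preimage (contMDiff_proj (IB := 𝓡 m) (n := ∞) E).continuous
  have hbase : ContinuousOn base U := by
    intro v hv
    refine ContinuousAt.continuousWithinAt (ContinuousAt.prodMk ?_ ?_)
    · exact ContinuousAt.comp (x := v) (g := χ) (f := TotalSpace.proj) (χ.continuousAt hv)
        (contMDiff_proj (IB := 𝓡 m) (n := ∞) E).continuous.continuousAt
    · exact continuousAt_pi.2 fun a =>
        (hs.contMDiffAt_coeff χ.open_source hv (some (.inr a))).continuousAt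
  have hopen : IsOpen (U ∩ base ⁻¹' H.target) := hbase.isOpen_inter_preimage hU H.open_target
  have hmem (a : M) : C.incl a ∈ O' ↔ a ∈ S := by rw [← hO'S]; rfl
  have ha₀S : a₀ ∈ S := ⟨hφ₀, haH⟩
  let c : C.AdaptedCoordinates mbar :=
    { chart := χ
      chart_mem := hχ
      frame := s
      isLocalFrame := hs
      one_frame_none := hs1
      one_frame_some := hs0
      dom := O' ∩ (U ∩ base ⁻¹' H.target)
      isOpen_dom := hO'.inter hopen
      dom_subset := fun v hv => hv.2.1
      psiDom := H.target
      isOpen_psiDom := H.open_target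
      -- Ψ^A is the e_A-component of the point of `ℳ` with coordinates z, given by the local inverse
      -- `l` of `κ`.
      psi := fun i z => C.components hs (l z) (some (.inl i))
      psi_smooth := by
        intro i z hz
        have h1 := ContMDiffAt.comp z (g := C.components hs) (f := l)
          (C.contMDiffAt_components hs (hlχ hz)) (hl hz)
        exact (contMDiffAt_iff_contDiffAt.1
          (contMDiffAt_pi_space.1 h1 (some (.inl i)))).contDiffWithinAt
      mem_psiDom := fun v hv _ => hv.2.2
      mem_iff := by
        intro v hv hvA
        constructor
        · rintro ⟨a, rfl⟩ i
          change C.components hs a _ = C.components hs (l (κ a)) _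
          rw [hlκ ((hmem a).1 hv.1)]
        · intro h
          have hz : base v ∈ H.target := hv.2.2
          have hvχ : v.1 ∈ χ.source := hv.2.1
          have hlχ' : (C.incl (l (base v))).1 ∈ χ.source := hlχ hz
          have h1 : χ (C.incl (l (base v))).1 = χ v.1 := congrArg Prod.fst (hκl hz)
          have h2 : (fun i : Fin k => C.components hs (l (base v)) (some (.inr i))) =
            fun i => hs.coeff (some (.inr i)) v.1 v.2 := congrArg Prod.snd (hκl hz)
          refine ⟨l (base v), (ofComponents_coeff hs hlχ').symm.trans
            (Eq.trans ?_ (ofComponents_coeff hs hvχ))⟩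
          refine congrArg (ofComponents s χ) (Prod.ext h1 (funext ?_))
          -- The components agree for three reasons: along e₀ both vectors lie in 𝒜, along e_A by
          -- the graph equation, along e_a since `l` inverts `κ`.
          rintro (_ | i | i)
          · have h3 : A.one (C.incl (l (base v))).1 (C.incl (l (base v))).2 = A.one v.1 v.2 :=
              (C.mem_affineBundle _).trans hvA.symm
            rw [one_eq_coeff hs hlχ' (hs1 _ hlχ') (hs0 _ hlχ'),
              one_eq_coeff hs hvχ (hs1 _ hvχ) (hs0 _ hvχ)] at h3
            exact h3
          · exact (h i).symm
          · exact congrFun h2 i }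
  exact ⟨c, (hmem a₀).2 ha₀S, ha₀, hκH ha₀S⟩

end ConstraintSubmanifold

end Vakonomic

end

/-! ### The theorem. -/

theorem proposition3p2 {m mbar k d : ℕ}
    {Q : Type*} [TopologicalSpace Q] [T2Space Q] [SecondCountableTopology Q]
    [ChartedSpace (EuclideanSpace ℝ (Fin m)) Q] [IsManifold (𝓡 m) ∞ Q]
    {F : Type*} [NormedAddCommGroup F] [NormedSpace ℝ F]
    {E : Q → Type*} [TopologicalSpace (TotalSpace F E)]
    [∀ x, AddCommGroup (E x)] [∀ x, Module ℝ (E x)] [∀ x, TopologicalSpace (E x)]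
    [∀ x, IsTopologicalAddGroup (E x)] [∀ x, ContinuousSMul ℝ (E x)]
    [FiberBundle F E] [VectorBundle ℝ F E] [ContMDiffVectorBundle ∞ F E (𝓡 m)]
    (hF : Module.finrank ℝ F = mbar + k + 1)
    (A : Vakonomic.LieAffgebroid m F E)
    {M : Type*} [TopologicalSpace M] [ChartedSpace (EuclideanSpace ℝ (Fin (m + k))) M]
    [IsManifold (𝓡 (m + k)) ∞ M]
    (C : Vakonomic.ConstraintSubmanifold A k M)
    (L : TotalSpace F E → ℝ)
    (hL : ContMDiffOn ((𝓡 m).prod 𝓘(ℝ, F)) 𝓘(ℝ, ℝ) ∞ L A.affineBundle)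
    {N : Type*} [TopologicalSpace N] [ChartedSpace (EuclideanSpace ℝ (Fin d)) N]
    [IsManifold (𝓡 d) ∞ N]
    (j : N → C.W₀)
    (hj : IsSmoothEmbedding (𝓡 d) (Vakonomic.ConstraintSubmanifold.modelW₀ m k F) ∞ j)
    (hj_range : Set.range j = C.W₁' L) :
    Vakonomic.IsCosymplectic (𝓡 d) A.toLieAlgebroid (C.nu ∘ j) (mbar + k)
        (Vakonomic.TwoSection.pullback (𝓡 d) j (C.OmegaW₀ L))
        (Vakonomic.OneSection.pullback (𝓡 d) j C.eta) ↔
      ∀ c : C.AdaptedCoordinates mbar, ∀ w ∈ C.W₁' L, C.incl w.1 ∈ c.dom →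
        (c.matrixR L w).det ≠ 0 := by
  have : FiniteDimensional ℝ F := Module.finite_of_finrank_pos (by omega)
  have hjs : ContMDiff (𝓡 d) (Vakonomic.ConstraintSubmanifold.modelW₀ m k F) ∞ j :=
    hj.isImmersion.contMDiff
  constructor
  · rintro ⟨-, -, h⟩ c w hw hc
    rw [← hj_range] at hw
    obtain ⟨p, rfl⟩ := hw
    exact Vakonomic.ConstraintSubmanifold.det_matrixR_ne_zero hF hL hj hj_range c hc (h p)
  · intro h
    refine ⟨?_, C.eta_closed hjs, fun p => ?_⟩
    · exact (C.isCanonicalPullback_pullback_OmegaW₀ hL hjs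
        (Vakonomic.ConstraintSubmanifold.hamiltonian_eq_zero_of_range_eq hj_range)).isClosedTwo
        (C.contMDiff_pr₁.comp hjs)
    -- The hypothesis speaks only about points inside adapted domains; such a domain exists around
    -- every point.
    · obtain ⟨c, hc⟩ := C.exists_adaptedCoordinates hF (j p).1
      exact Vakonomic.ConstraintSubmanifold.exists_wedgePow_pullback_ne_zero hF hL hj hj_range c hc
        (h c (j p) (hj_range ▸ Set.mem_range_self p) hc)
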